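/- Let $l>-\tfrac12$ and let $q:(0,\infty)\to\mathbb R$ be locally integrable on $(0,\infty)$ with \[ \int_0^1 x|q(x)|\,dx<\infty ,\qquad \int_1^\infty x|q(x)|\,dx<\infty . \] Solutions of $-y''+\frac{l(l+1)}{x^2}y+q(x)y=zy$ on $(0,\infty)$ are understood with $y,y'$ locally absolutely continuous. For $z\in\mathbb C$ let $\phi(z,\cdot)$ be the regular solution, i.e. the solution such that on $(0,1]$ \[ \phi(z,x)=C_l\,x^{l+1}\tilde\phi(z,x),\quad \tilde\phi(z,\cdot)\in W^{1,1}[0,1],\quad \tilde\phi(z,0)=1,\qquad C_l=\frac{\sqrt\pi}{\Gamma(l+\frac32)\,2^{l+1}} . \] For $k\in\mathbb C$ with $\operatorname{Im}k\ge 0$, $k\ne0$, let $f(k,\cdot)$ be the Jost solution, i.e. the solution for $z=k^2$ with $f(k,x)=e^{ikx}(1+o(1))$ and $f'(k,x)=ik\,e^{ikx}(1+o(1))$ as $x\to\infty$. With the ($x$-independent) Wronskian $W(u,v)=uv'-u'v$, put \[ F(k)=e^{-i\pi l/2}\,k^{l}\,W\big(f(k,\cdot),\phi(k^2,\cdot)\big),\qquad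 \operatorname{Im}k\ge0,\ k\neq 0, \] where $k^l$ is taken with $0\le\arg k\le\pi$. Then $F$ is differentiable at every $k\ne0$ with $\operatorname{Im}k\ge0$ (with respect to the complex variable $k$ in the closed upper half plane), and there are constants $C,R$ (depending on $l$ and $q$) such that \[ |F'(k)|\le\frac{C}{1+|k|}\qquad\text{for all } k \text{ with } \operatorname{Im}k\ge0,\ |k|\ge R . \] If in addition $\int_1^\infty x^2|q(x)|\,dx<\infty$, then \[ |F'(k)|=\mathcal O\big(|k|^{\min(0,2l)}\big)\qquad\text{as } k\to0,\ \operatorname{Im}k\ge0,\ k\neq 0 . \] -/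

import Mathlib

open MeasureTheory Filter Topology

noncomputable section

namespace RadialSchrodinger

/-- `y` solves `-y'' + (l(l+1)/x² + q) y = z y` on `(0,∞)`: `y` is differentiable there and `y'` is
locally absolutely continuous with the prescribed a.e. derivative, written as an integral identity
(the integrand is integrable on `[a,b]` as `q` is locally integrable on `(0,∞)`). -/
def IsSolution (l : ℝ) (q : ℝ → ℝ) (z : ℂ) (y : ℝ → ℂ) : Prop :=
  (∀ x : ℝ, 0 < x → DifferentiableAt ℝ y x) ∧
  ∀ a b : ℝ, 0 < a → 0 < b →
    deriv y b - deriv y a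
      = ∫ x in a..b, (((l * (l + 1) / x ^ 2 + q x : ℝ) : ℂ) - z) * y x

/-- The normalization constant `C_l = √π / (Γ(l + 3/2) 2^(l+1))`. -/
def normConst (l : ℝ) : ℝ :=
  Real.sqrt Real.pi / (Real.Gamma (l + 3 / 2) * (2 : ℝ) ^ (l + 1))

/-- `y` is the regular solution at energy `z`: on `(0,1]` one has `y = C_l x^(l+1) u` with
`u ∈ W^{1,1}[0,1]` and `u 0 = 1`, i.e. `u x = 1 + ∫_0^x g` for some integrable `g`. -/
def IsRegularSolution (l : ℝ) (q : ℝ → ℝ) (z : ℂ) (y : ℝ → ℂ) : Prop :=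
  IsSolution l q z y ∧
  ∃ g : ℝ → ℂ, IntegrableOn g (Set.Ioc 0 1) ∧
    ∀ x ∈ Set.Ioc (0 : ℝ) 1,
      y x = ((normConst l * x ^ (l + 1) : ℝ) : ℂ) * (1 + ∫ t in (0 : ℝ)..x, g t)

/-- `y` is the Jost solution at momentum `k`: it solves the equation with `z = k²`, and
`y = e^{ikx}(1+o(1))`, `y' = ik e^{ikx}(1+o(1))` as `x → ∞`. -/
def IsJostSolution (l : ℝ) (q : ℝ → ℝ) (k : ℂ) (y : ℝ → ℂ) : Prop :=
  IsSolution l q (k ^ 2) y ∧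
  Tendsto (fun x : ℝ => Complex.exp (-(Complex.I * k * x)) * y x) atTop (𝓝 1) ∧
  Tendsto (fun x : ℝ => Complex.exp (-(Complex.I * k * x)) * deriv y x) atTop
    (𝓝 (Complex.I * k))

/-- The regular solution `φ(z,·)`; it is unique on `(0,∞)` (values at `x ≤ 0` are irrelevant). -/
def regularSolution (l : ℝ) (q : ℝ → ℝ) (z : ℂ) : ℝ → ℂ :=
  Classical.epsilon (IsRegularSolution l q z)

/-- The Jost solution `f(k,·)`, for `Im k ≥ 0`, `k ≠ 0`; it is unique on `(0,∞)`. -/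
def jostSolution (l : ℝ) (q : ℝ → ℝ) (k : ℂ) : ℝ → ℂ :=
  Classical.epsilon (IsJostSolution l q k)

/-- The Wronskian `W(u,v) = u v' - u' v` at the point `x`. -/
def wronskian (u v : ℝ → ℂ) (x : ℝ) : ℂ :=
  u x * deriv v x - deriv u x * v x

/-- The Jost function `f(k) = W(f(k,·), φ(k²,·))`. Both functions solve the same equation, so that
their Wronskian does not depend on the point; it is evaluated at `x = 1`. -/
def jostFunction (l : ℝ) (q : ℝ → ℝ) (k : ℂ) : ℂ :=
  wronskian (jostSolution l q k) (regularSolution l q (k ^ 2)) 1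

/-- `F(k) = e^{-iπl/2} k^l f(k)`; the principal power has `0 ≤ arg k ≤ π` on `Im k ≥ 0`. -/
def normJost (l : ℝ) (q : ℝ → ℝ) (k : ℂ) : ℂ :=
  Complex.exp (-(Complex.I * Real.pi * l / 2)) * k ^ (l : ℂ) * jostFunction l q k

/-- The closed upper half plane `Im k ≥ 0`. -/
def closedUpperHalfPlane : Set ℂ := {k : ℂ | 0 ≤ k.im}

/-- `F'(k)`, as a derivative in the domain `Im k ≥ 0` of `F`: the complex derivative for `Im k > 0`,
and the derivative relative to the closed half plane for real `k`. -/
def normJostDeriv (l : ℝ) (q : ℝ → ℝ) (k : ℂ) : ℂ :=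
  derivWithin (normJost l q) closedUpperHalfPlane k

end RadialSchrodinger

end

/-! The Jost solution never has to be differentiated in k. Put ψ(k,x) = x^{-l} g(kx) with g(ξ) =
Γ(l+1)⁻¹ e^{iξ} ∫₀^∞ e^{-t} t^l (ξ + it/2)^l dt (`freeJost`, `freeJostSol`); this is k^l times the
Jost solution for q = 0. The Wronskian of ψ with the regular solution φ has derivative qψφ. At
infinity it tends to k^l W(f,φ): ψ and k^l f agree up to o(e^{ikx}), together with their
derivatives, while φ and φ' are O(e^{x Im k}). At the origin it tends to C_l (2l+1) g(0), which does
not depend on k. Hence k^l W(f,φ) = C_l (2l+1) g(0) + ∫₀^∞ q ψ φ dx (`cpow_mul_jostFunction_eq`),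
and up to a unimodular constant F' is ∫ q ∂_k(ψφ) dx.

It remains to bound ∂_k(ψφ), with m = min(0, 2l). For φ one has |φ| ≤ C (x/(1+|k|x))^{l+1} e^{x|Im
k|} (`exists_norm_regSol_le`): the Volterra equation at the origin gives this for |k|x ≤ 1, and
Gronwall's inequality for y' ± iky, started at x = 1/|k|, continues it to larger x. As φ is entire
in k, Cauchy's inequality on a disc of radius 1/x bounds ∂_kφ at the cost of one factor x. For g the
integral gives |g| ≤ C (1+|ξ|)^l e^{-Im ξ} and |g'| ≤ C |ξ|^m (1+|ξ|)^{l-m} e^{-Im ξ}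
(`exists_norm_freeJost_le`). In the products the exponentials cancel, and |∂_k(ψφ)| ≤ C x² (|k|x)^m
(1+|k|x)^{-1-m}. This is at most C x/|k|, which settles large k and also supplies a dominating
function near any k ≠ 0; it is also at most C |k|^m x^{2+m}, which settles k → 0 under the second
moment condition.

Differentiation under the integral is carried out relative to the closed half plane, so that real k
is included (`hasDerivWithinAt_integral_of_dominated`). Since φ and f are introduced by choice,
existence is proved for both; uniqueness is needed only for φ (`eq_regSol`), because any solution
with the Jost asymptotics yields the same limit of the Wronskian. -/

noncomputable section

namespace RadialSchrodinger

/-! ### Primitives of locally integrable functions -/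

section Primitive

variable {𝕜 : Type*} [RCLike 𝕜] {s : Set ℝ} {F G f g : ℝ → 𝕜}

/-- `F` is a primitive of the locally integrable function `f` on `s`. -/
def IsPrimitiveOn (s : Set ℝ) (F f : ℝ → 𝕜) : Prop :=
  ∀ a ∈ s, ∀ b ∈ s, IntervalIntegrable f volume a b ∧ F b - F a = ∫ x in a..b, f x

/-- Increments of the integral of `f` are bounded by those of the integral of `‖f‖`, so the sums in
the definition are dominated by the ones of a real-valued integral. -/
lemma absolutelyContinuousOnInterval_integral {a b : ℝ} (h : IntervalIntegrable f volume a b) :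
    AbsolutelyContinuousOnInterval (fun x => ∫ t in a..x, f t) a b := by
  have h1 := h.norm.absolutelyContinuousOnInterval_intervalIntegral (c := a) (by simp)
  refine squeeze_zero' (Eventually.of_forall fun _ => Finset.sum_nonneg fun _ _ => dist_nonneg)
    ?_ h1
  rw [eventually_inf_principal]
  filter_upwards with E hE
  refine Finset.sum_le_sum fun i hi => ?_
  have h2 := hE.1 i hi
  have i1 : IntervalIntegrable f volume a (E.2 i).1 :=
    h.mono_set (Set.uIcc_subset_uIcc (by simp) h2.1)
  have i2 : IntervalIntegrable f volume a (E.2 i).2 :=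
    h.mono_set (Set.uIcc_subset_uIcc (by simp) h2.2)
  rw [dist_eq_norm, dist_eq_norm, intervalIntegral.integral_interval_sub_left i1 i2,
    intervalIntegral.integral_interval_sub_left i1.norm i2.norm]
  exact intervalIntegral.norm_integral_le_abs_integral_norm

namespace IsPrimitiveOn

lemma congr (hF : IsPrimitiveOn s F f) [hs : s.OrdConnected] (h : ∀ x ∈ s, f x = g x) :
    IsPrimitiveOn s F g := by
  intro a ha b hb
  have hab : Set.uIcc a b ⊆ s := hs.uIcc_subset ha hb
  obtain ⟨h1, h2⟩ := hF a ha b hb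
  refine ⟨h1.congr (fun x hx => h x (hab (Set.uIoc_subset_uIcc hx))), ?_⟩
  rw [h2]
  exact intervalIntegral.integral_congr fun x hx => h x (hab hx)

lemma congr_left (hF : IsPrimitiveOn s F f) (h : ∀ x ∈ s, F x = G x) : IsPrimitiveOn s G f := by
  intro a ha b hb
  rw [← h a ha, ← h b hb]
  exact hF a ha b hb

lemma absolutelyContinuousOnInterval (hF : IsPrimitiveOn s F f) [hs : s.OrdConnected]
    {a b : ℝ} (ha : a ∈ s) (hb : b ∈ s) : AbsolutelyContinuousOnInterval F a b := by
  have h1 := absolutelyContinuousOnInterval_integral (hF a ha b hb).1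
  refine squeeze_zero' (Eventually.of_forall fun _ => Finset.sum_nonneg fun _ _ => dist_nonneg)
    ?_ h1
  rw [eventually_inf_principal]
  filter_upwards with E hE
  refine Finset.sum_le_sum fun i hi => ?_
  have h2 := hE.1 i hi
  have hab : Set.uIcc a b ⊆ s := hs.uIcc_subset ha hb
  have e1 := (hF a ha _ (hab h2.1)).2
  have e2 := (hF a ha _ (hab h2.2)).2
  rw [← e1, ← e2, dist_sub_right]

lemma continuousOn (hF : IsPrimitiveOn s F f) [s.OrdConnected] {a b : ℝ}
    (ha : a ∈ s) (hb : b ∈ s) : ContinuousOn F (Set.uIcc a b) :=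
  (hF.absolutelyContinuousOnInterval ha hb).continuousOn

lemma continuousAt (hF : IsPrimitiveOn s F f) [s.OrdConnected] (hs : IsOpen s) {x : ℝ}
    (hx : x ∈ s) : ContinuousAt F x := by
  obtain ⟨a, b, ⟨hxa, hxb⟩, hab⟩ := mem_nhds_iff_exists_Ioo_subset.1 (hs.mem_nhds hx)
  have h1 : (a + x) / 2 ∈ s := hab ⟨by linarith, by linarith⟩
  have h2 : (x + b) / 2 ∈ s := hab ⟨by linarith, by linarith⟩
  refine (hF.continuousOn h1 h2).continuousAt ?_
  rw [Set.uIcc_of_le (by linarith)]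
  exact Icc_mem_nhds (by linarith) (by linarith)

lemma ae_hasDerivAt (hF : IsPrimitiveOn s F f) [hs : s.OrdConnected] {a b : ℝ}
    (ha : a ∈ s) (hb : b ∈ s) :
    ∀ᵐ x, x ∈ Set.Ioo a b → HasDerivAt F (f x) x := by
  filter_upwards [(hF a ha b hb).1.ae_hasDerivAt_integral] with x hx hx2
  have hab : a ≤ b := (hx2.1.trans hx2.2).le
  have h3 := hx (by rw [Set.uIcc_of_le hab]; exact ⟨hx2.1.le, hx2.2.le⟩) a (by simp)
  have h4 : HasDerivAt (fun y => F a + ∫ t in a..y, f t) (f x) x := h3.const_add (F a)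
  refine h4.congr_of_eventuallyEq ?_
  filter_upwards [Ioo_mem_nhds hx2.1 hx2.2] with y hy
  have := (hF a ha y (hs.out ha hb ⟨hy.1.le, hy.2.le⟩)).2
  rw [← this]; ring

lemma add (hF : IsPrimitiveOn s F f) (hG : IsPrimitiveOn s G g) :
    IsPrimitiveOn s (fun x => F x + G x) (fun x => f x + g x) := by
  intro a ha b hb
  obtain ⟨h1, h2⟩ := hF a ha b hb
  obtain ⟨h3, h4⟩ := hG a ha b hb
  refine ⟨h1.add h3, ?_⟩
  rw [intervalIntegral.integral_add h1 h3, ← h2, ← h4]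
  ring

lemma const_mul (hF : IsPrimitiveOn s F f) (c : 𝕜) :
    IsPrimitiveOn s (fun x => c * F x) (fun x => c * f x) := by
  intro a ha b hb
  obtain ⟨h1, h2⟩ := hF a ha b hb
  refine ⟨h1.const_mul c, ?_⟩
  rw [intervalIntegral.integral_const_mul, ← h2]
  ring

lemma sub (hF : IsPrimitiveOn s F f) (hG : IsPrimitiveOn s G g) :
    IsPrimitiveOn s (fun x => F x - G x) (fun x => f x - g x) := by
  intro a ha b hb
  obtain ⟨h1, h2⟩ := hF a ha b hb
  obtain ⟨h3, h4⟩ := hG a ha b hb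
  refine ⟨h1.sub h3, ?_⟩
  rw [intervalIntegral.integral_sub h1 h3, ← h2, ← h4]
  ring

lemma const_add (hF : IsPrimitiveOn s F f) (c : 𝕜) : IsPrimitiveOn s (fun x => c + F x) f := by
  intro a ha b hb
  obtain ⟨h1, h2⟩ := hF a ha b hb
  exact ⟨h1, by rw [← h2]; ring⟩

/-- The product rule for primitives. -/
lemma mul (hF : IsPrimitiveOn s F f) (hG : IsPrimitiveOn s G g) [hs : s.OrdConnected] :
    IsPrimitiveOn s (fun x => F x * G x) (fun x => f x * G x + F x * g x) := by
  have key : ∀ a ∈ s, ∀ b ∈ s, a ≤ b →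
      IntervalIntegrable (fun x => f x * G x + F x * g x) volume a b ∧
      F b * G b - F a * G a = ∫ x in a..b, f x * G x + F x * g x := by
    intro a ha b hb hab
    have hi : IntervalIntegrable (fun x => f x * G x + F x * g x) volume a b :=
      ((hF a ha b hb).1.mul_continuousOn (hG.continuousOn ha hb)).add
        ((hG a ha b hb).1.continuousOn_mul (hF.continuousOn ha hb))
    refine ⟨hi, ?_⟩
    -- The product minus the candidate integral is absolutely continuous with derivative zero almost
    -- everywhere, hence constant; comparing its values at `a` and `b` gives the formula.
    have hac : AbsolutelyContinuousOnInterval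
        (fun x => F x * G x - ∫ t in a..x, f t * G t + F t * g t) a b := by
      refine AbsolutelyContinuousOnInterval.sub ?_ (absolutelyContinuousOnInterval_integral hi)
      exact (hF.absolutelyContinuousOnInterval ha hb).smul
        (hG.absolutelyContinuousOnInterval ha hb)
    have hae : ∀ᵐ x, x ∈ Set.uIcc a b →
        HasDerivAt (fun x => F x * G x - ∫ t in a..x, f t * G t + F t * g t) 0 x := by
      have na : ∀ᵐ x : ℝ, x ≠ a := by simp [ae_iff, measure_singleton]
      have nb : ∀ᵐ x : ℝ, x ≠ b := by simp [ae_iff, measure_singleton]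
      filter_upwards [hF.ae_hasDerivAt ha hb, hG.ae_hasDerivAt ha hb,
        hi.ae_hasDerivAt_integral, na, nb] with x h1 h2 h3 hna hnb hx
      have hx' : x ∈ Set.Ioo a b := by
        rw [Set.uIcc_of_le hab] at hx
        exact ⟨lt_of_le_of_ne hx.1 (Ne.symm hna), lt_of_le_of_ne hx.2 hnb⟩
      have := ((h1 hx').mul (h2 hx')).sub (h3 hx a (by simp))
      rw [sub_self] at this
      exact this
    obtain ⟨C, hC⟩ := hac.const_of_ae_hasDerivAt_zero hae
    have e1 := hC a (by simp)
    have e2 := hC b (by simp)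
    simp only [intervalIntegral.integral_same, sub_zero] at e1 e2
    rw [e1, ← e2]; ring
  intro a ha b hb
  rcases le_total a b with hab | hab
  · exact key a ha b hb hab
  · obtain ⟨h1, h2⟩ := key b hb a ha hab
    refine ⟨h1.symm, ?_⟩
    rw [intervalIntegral.integral_symm, ← h2]; ring

lemma of_hasDerivAt [hs : s.OrdConnected] (h : ∀ x ∈ s, HasDerivAt F (f x) x)
    (hf : ContinuousOn f s) : IsPrimitiveOn s F f := by
  intro a ha b hb
  have hab : Set.uIcc a b ⊆ s := hs.uIcc_subset ha hb
  have hi : IntervalIntegrable f volume a b := (hf.mono hab).intervalIntegrable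
  exact ⟨hi, (intervalIntegral.integral_eq_sub_of_hasDerivAt (fun x hx => h x (hab hx)) hi).symm⟩

/-- Applied to solutions: the second derivative exists only almost everywhere, but the first one is
continuous, so y itself is differentiable at every point. -/
lemma hasDerivAt (hF : IsPrimitiveOn s F f) (ho : IsOpen s)
    (hf : ContinuousOn f s) {x : ℝ} (hx : x ∈ s) : HasDerivAt F (f x) x := by
  have h1 : HasDerivAt (fun y => F x + ∫ t in x..y, f t) (f x) x := by
    refine (intervalIntegral.integral_hasDerivAt_right (by simp) ?_
      (hf.continuousAt (ho.mem_nhds hx))).const_add _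
    exact hf.stronglyMeasurableAtFilter ho x hx
  refine h1.congr_of_eventuallyEq ?_
  filter_upwards [ho.mem_nhds hx] with y hy
  rw [← (hF x hx y hy).2]; ring

lemma pow [s.OrdConnected] (hF : IsPrimitiveOn s F f) (n : ℕ) :
    IsPrimitiveOn s (fun x => F x ^ (n + 1)) (fun x => (n + 1) * (f x * F x ^ n)) := by
  induction n with
  | zero => simpa using hF
  | succ n ih =>
    refine ((ih.mul hF).congr_left fun x _ => by ring).congr fun x _ => ?_
    push_cast; ring

end IsPrimitiveOn

end Primitive

/-! ### Gronwall's inequality with an integrable weight -/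

/-- Differentiating a truncated exponential series lowers the truncation by one. This is the
induction step of Gronwall's inequality. -/
lemma IsPrimitiveOn.expSum {s : Set ℝ} [s.OrdConnected] {Q w : ℝ → ℝ} (hQ : IsPrimitiveOn s Q w)
    (n : ℕ) :
    IsPrimitiveOn s (fun x => ∑ j ∈ Finset.range (n + 1), Q x ^ j / (j.factorial : ℝ))
      (fun x => w x * ∑ j ∈ Finset.range n, Q x ^ j / (j.factorial : ℝ)) := by
  induction n with
  | zero =>
    intro a _ b _
    simp
  | succ n ih =>
    refine ((ih.add ((hQ.pow n).const_mul (((n + 1).factorial : ℝ)⁻¹))).congr_left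
      fun x _ => ?_).congr fun x _ => ?_
    · rw [Finset.sum_range_succ _ (n + 1)]
      ring
    · rw [Finset.sum_range_succ _ n, Nat.factorial_succ]
      have : (n.factorial : ℝ) ≠ 0 := by positivity
      have : (n + 1 : ℝ) ≠ 0 := by positivity
      push_cast
      field_simp

lemma isPrimitiveOn_integral {𝕜 : Type*} [RCLike 𝕜] {w : ℝ → 𝕜} {a b : ℝ} (hab : a ≤ b)
    (hw : IntervalIntegrable w volume a b) :
    IsPrimitiveOn (Set.Icc a b) (fun x => ∫ t in a..x, w t) w := by
  intro c hc d hd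
  have h1 : IntervalIntegrable w volume a c := hw.mono_set (by
    rw [Set.uIcc_of_le hab, Set.uIcc_of_le hc.1]; exact Set.Icc_subset_Icc_right hc.2)
  have h2 : IntervalIntegrable w volume a d := hw.mono_set (by
    rw [Set.uIcc_of_le hab, Set.uIcc_of_le hd.1]; exact Set.Icc_subset_Icc_right hd.2)
  exact ⟨h1.symm.trans h2, intervalIntegral.integral_interval_sub_left h2 h1⟩

/-- Inserting the hypothesis into itself n times produces the partial sum of the exponential plus a
remainder M Qⁿ/n!, where M bounds |v| on the compact interval; the remainder tends to zero. -/
lemma gronwall {a b A : ℝ} {v w : ℝ → ℝ} (hab : a ≤ b) (hA : 0 ≤ A)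
    (hw : IntervalIntegrable w volume a b) (hw0 : ∀ x ∈ Set.Icc a b, 0 ≤ w x)
    (hv : ContinuousOn v (Set.Icc a b))
    (h : ∀ x ∈ Set.Icc a b, v x ≤ A + ∫ t in a..x, w t * v t) :
    ∀ x ∈ Set.Icc a b, v x ≤ A * Real.exp (∫ t in a..x, w t) := by
  obtain ⟨M, hM⟩ := isCompact_Icc.exists_bound_of_continuousOn hv
  have hM0 : 0 ≤ M := (norm_nonneg _).trans (hM a ⟨le_rfl, hab⟩)
  have hQ := isPrimitiveOn_integral hab hw
  set Q : ℝ → ℝ := fun x => ∫ t in a..x, w t with hQdef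
  have hQ0 : ∀ x ∈ Set.Icc a b, 0 ≤ Q x := fun x hx =>
    intervalIntegral.integral_nonneg hx.1 fun t ht => hw0 t ⟨ht.1, ht.2.trans hx.2⟩
  have ha : a ∈ Set.Icc a b := ⟨le_rfl, hab⟩
  have hQa : Q a = 0 := by simp [hQdef]
  have key : ∀ n : ℕ, ∀ x ∈ Set.Icc a b,
      v x ≤ A * (∑ j ∈ Finset.range n, Q x ^ j / (j.factorial : ℝ))
        + M * (Q x ^ n / (n.factorial : ℝ)) := by
    intro n
    induction n with
    | zero =>
      intro x hx
      simpa using (le_abs_self _).trans (hM x hx)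
    | succ n ih =>
      intro x hx
      have hp := ((hQ.expSum n).const_mul A).add
        ((hQ.pow n).const_mul (M * ((n + 1).factorial : ℝ)⁻¹))
      obtain ⟨hi, he⟩ := hp a ha x hx
      have hsum : ∑ j ∈ Finset.range (n + 1), Q a ^ j / (j.factorial : ℝ) = 1 := by
        rw [Finset.sum_range_succ']
        simp [hQa]
      have hle : ∫ t in a..x, w t * v t ≤ ∫ t in a..x,
          (A * (w t * ∑ j ∈ Finset.range n, Q t ^ j / (j.factorial : ℝ))
            + M * ((n + 1).factorial : ℝ)⁻¹ * ((n + 1) * (w t * Q t ^ n))) := by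
        have hsub : Set.Icc a x ⊆ Set.Icc a b := Set.Icc_subset_Icc_right hx.2
        refine intervalIntegral.integral_mono_on hx.1 ?_ hi fun t ht => ?_
        · refine IntervalIntegrable.mul_continuousOn (hw.mono_set ?_) ?_
          · rw [Set.uIcc_of_le hab, Set.uIcc_of_le hx.1]; exact hsub
          · rw [Set.uIcc_of_le hx.1]; exact hv.mono hsub
        · refine (mul_le_mul_of_nonneg_left (ih t (hsub ht)) (hw0 t (hsub ht))).trans (le_of_eq ?_)
          rw [Nat.factorial_succ]
          have : (n.factorial : ℝ) ≠ 0 := by positivity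
          have : (n + 1 : ℝ) ≠ 0 := by positivity
          push_cast
          field_simp
      have := h x hx
      beta_reduce at he
      rw [hsum, hQa, zero_pow n.succ_ne_zero] at he
      calc v x ≤ _ := this
        _ ≤ _ := add_le_add_right hle A
        _ = _ := by rw [← he]; ring
  intro x hx
  have hlim : Tendsto (fun n : ℕ => A * Real.exp (Q x) + M * (Q x ^ n / (n.factorial : ℝ))) atTop
      (𝓝 (A * Real.exp (Q x) + M * 0)) :=
    ((FloorSemiring.tendsto_pow_div_factorial_atTop (Q x)).const_mul M).const_add _
  rw [mul_zero, add_zero] at hlim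
  refine ge_of_tendsto' hlim fun n => (key n x hx).trans ?_
  gcongr
  exact Real.sum_le_exp_of_nonneg (hQ0 x hx) n

/-! ### Differentiation of parameter integrals relative to a convex set -/

/-- Dominated convergence for difference quotients. Convexity makes the mean value inequality
available inside `s`, so `k₀` may be a boundary point; this is what real momenta require. -/
lemma hasDerivWithinAt_integral_of_dominated {α : Type*} [MeasurableSpace α] {μ : Measure α}
    {s : Set ℂ} (hs : Convex ℝ s) {F F' : ℂ → α → ℂ} {k₀ : ℂ} (hk₀ : k₀ ∈ s) {ε : ℝ} (hε : 0 < ε)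
    {bound : α → ℝ} (hF_int : ∀ k ∈ s ∩ Metric.ball k₀ ε, Integrable (F k) μ)
    (hb_int : Integrable bound μ)
    (hb : ∀ᵐ a ∂μ, ∀ k ∈ s ∩ Metric.ball k₀ ε, ‖F' k a‖ ≤ bound a)
    (hd : ∀ᵐ a ∂μ, ∀ k ∈ s ∩ Metric.ball k₀ ε, HasDerivWithinAt (fun k => F k a) (F' k a) s k) :
    HasDerivWithinAt (fun k => ∫ a, F k a ∂μ) (∫ a, F' k₀ a ∂μ) s k₀ := by
  rw [hasDerivWithinAt_iff_tendsto_slope]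
  have hmem : s ∩ Metric.ball k₀ ε ∈ 𝓝[s \ {k₀}] k₀ :=
    inter_mem (mem_of_superset self_mem_nhdsWithin Set.sdiff_subset)
      (mem_nhdsWithin_of_mem_nhds (Metric.ball_mem_nhds _ hε))
  have hk₀_mem : k₀ ∈ s ∩ Metric.ball k₀ ε := ⟨hk₀, Metric.mem_ball_self hε⟩
  have hconv : Convex ℝ (s ∩ Metric.ball k₀ ε) := hs.inter (convex_ball _ _)
  have hev : ∀ᶠ k in 𝓝[s \ {k₀}] k₀,
      (∫ a, slope (fun k => F k a) k₀ k ∂μ) = slope (fun k => ∫ a, F k a ∂μ) k₀ k := by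
    filter_upwards [hmem] with k hk
    simp only [slope_def_field]
    rw [integral_div, integral_sub (hF_int k hk) (hF_int k₀ hk₀_mem)]
  refine Tendsto.congr' hev ?_
  refine tendsto_integral_filter_of_dominated_convergence bound ?_ ?_ hb_int ?_
  · filter_upwards [hmem] with k hk
    simp only [slope_def_field]
    exact (((hF_int k hk).sub (hF_int k₀ hk₀_mem)).div_const _).aestronglyMeasurable
  · filter_upwards [hmem, self_mem_nhdsWithin] with k hk hk'
    filter_upwards [hb, hd] with a ha hda
    have hne : k - k₀ ≠ 0 := sub_ne_zero.2 hk'.2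
    have := hconv.norm_image_sub_le_of_norm_hasDerivWithin_le
      (fun x hx => (hda x hx).mono Set.inter_subset_left) ha hk₀_mem hk
    rw [slope_def_field, norm_div, div_le_iff₀ (norm_pos_iff.2 hne)]
    exact this
  · filter_upwards [hd] with a hda
    exact hasDerivWithinAt_iff_tendsto_slope.1 (hda k₀ hk₀_mem)

/-- An integral depending holomorphically and boundedly on a parameter is holomorphic. -/
lemma differentiableOn_integral_of_dominated {α : Type*} [MeasurableSpace α] {μ : Measure α}
    {U : Set ℂ} (hU : IsOpen U) {F : ℂ → α → ℂ} {bound : α → ℝ}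
    (hF : ∀ z ∈ U, AEStronglyMeasurable (F z) μ) (hb_int : Integrable bound μ)
    (hb : ∀ᵐ a ∂μ, ∀ z ∈ U, ‖F z a‖ ≤ bound a)
    (hd : ∀ᵐ a ∂μ, DifferentiableOn ℂ (fun z => F z a) U) :
    DifferentiableOn ℂ (fun z => ∫ a, F z a ∂μ) U := by
  intro z₀ hz₀
  obtain ⟨r, hr, hball⟩ := Metric.isOpen_iff.1 hU z₀ hz₀
  -- Since r/2 + r/3 < r, Cauchy's inequality on discs of radius r/3 turns the bound on `F` into one
  -- on its derivative.
  have hsub : ∀ k ∈ Metric.ball z₀ (r / 2), Metric.closedBall k (r / 3) ⊆ U := by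
    intro k hk
    refine (fun w hw => hball ?_)
    rw [Metric.mem_ball] at hk ⊢
    rw [Metric.mem_closedBall] at hw
    linarith [dist_triangle w k z₀]
  have hmem : ∀ k ∈ Metric.ball z₀ (r / 2), k ∈ U := fun k hk =>
    hsub k hk (Metric.mem_closedBall_self (by positivity))
  have := hasDerivWithinAt_integral_of_dominated (μ := μ) (s := Set.univ) convex_univ
    (F := F) (F' := fun k a => deriv (fun z => F z a) k) (k₀ := z₀) (Set.mem_univ _)
    (ε := r / 2) (by positivity) (bound := fun a => bound a / (r / 3)) ?_ (hb_int.div_const _) ?_ ?_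
  · exact (hasDerivWithinAt_univ.1 this).differentiableAt.differentiableWithinAt
  · intro k hk
    refine hb_int.mono' (hF k (hmem k hk.2)) ?_
    filter_upwards [hb] with a ha using ha k (hmem k hk.2)
  · filter_upwards [hb, hd] with a ha hda k hk
    refine Complex.norm_deriv_le_of_forall_mem_sphere_norm_le (by positivity)
      ((hda.mono (hsub k hk.2)).diffContOnCl_ball subset_rfl) fun z hz => ?_
    exact ha z (hsub k hk.2 (Metric.sphere_subset_closedBall hz))
  · filter_upwards [hd] with a hda k hk
    exact (hda.differentiableAt (hU.mem_nhds (hmem k hk.2))).hasDerivAt.hasDerivWithinAt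

/-! ### Volterra equations on the half-line -/

/-- The Neumann iterates of the Volterra equation `u = 1 + ∫ K(·,y) u(y) dy`. -/
def volterraIter (K : ℝ → ℝ → ℂ) : ℕ → ℝ → ℂ
  | 0, _ => 1
  | n + 1, x => ∫ y in Set.Ioi 0, K x y * volterraIter K n y

/-- The Neumann series of the Volterra equation `u = 1 + ∫ K(·,y) u(y) dy`. -/
def volterraSol (K : ℝ → ℝ → ℂ) (x : ℝ) : ℂ := ∑' n, volterraIter K n x

/-- The kernel `K` on the half-line is of Volterra type: `K x` is supported in `S x` and dominated
there by the weight `w`, and `Q` majorizes the weight of `S x`. -/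
structure IsVolterraKernel (K : ℝ → ℝ → ℂ) (S : ℝ → Set ℝ) (w Q : ℝ → ℝ) : Prop where
  meas : ∀ x > 0, AEStronglyMeasurable (K x) (volume.restrict (Set.Ioi 0))
  cont : ∀ x₀ > 0, ∀ᵐ y ∂(volume.restrict (Set.Ioi 0)), ContinuousAt (fun x => K x y) x₀
  meas_supp : ∀ x > 0, MeasurableSet (S x)
  supp_pos : ∀ x > 0, S x ⊆ Set.Ioi 0
  bound : ∀ x > 0, ∀ y > 0, ‖K x y‖ ≤ (S x).indicator w y
  weight_nonneg : ∀ y > 0, 0 ≤ w y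
  weight_int : ∀ x > 0, IntegrableOn w (S x)
  majorant_nonneg : ∀ x > 0, 0 ≤ Q x
  majorant_mono : ∀ x > 0, ∀ y ∈ S x, Q y ≤ Q x
  majorant_cont : ContinuousOn Q (Set.Ioi 0)
  majorant_iter : ∀ n : ℕ, ∀ x > 0, ∫ y in S x, w y * Q y ^ n ≤ Q x ^ (n + 1) / (n + 1)
  local_bound : ∀ x₀ > 0, ∃ x₁ > 0, ∀ᶠ x in 𝓝 x₀, S x ⊆ S x₁ ∧ Q x ≤ Q x₁

/-! ### Convergence, continuity and holomorphy of the Neumann series. -/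

namespace IsVolterraKernel

variable {K : ℝ → ℝ → ℂ} {S : ℝ → Set ℝ} {w Q : ℝ → ℝ}

lemma integrable_weight (h : IsVolterraKernel K S w Q) {x : ℝ} (hx : 0 < x) :
    Integrable ((S x).indicator w) (volume.restrict (Set.Ioi 0)) :=
  ((integrable_indicator_iff (h.meas_supp x hx)).2 (h.weight_int x hx)).integrableOn

/-- The two claims are proved together: continuity of one iterate makes the next integrand
measurable, and its bound makes it dominated. The factorial comes from `majorant_iter`. -/
lemma iter_bound_and_continuous (h : IsVolterraKernel K S w Q) (n : ℕ) :
    (∀ x > 0, ‖volterraIter K n x‖ ≤ Q x ^ n / (n.factorial : ℝ)) ∧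
    ContinuousOn (volterraIter K n) (Set.Ioi 0) := by
  induction n with
  | zero => exact ⟨fun x _ => by simp [volterraIter], continuousOn_const⟩
  | succ n ih =>
    obtain ⟨ihb, ihc⟩ := ih
    have hpt : ∀ x > 0, ∀ y > 0, ‖K x y * volterraIter K n y‖ ≤
        (S x).indicator (fun y => w y * Q y ^ n * (n.factorial : ℝ)⁻¹) y := by
      intro x hx y hy
      have h1 := h.bound x hx y hy
      rw [norm_mul]
      by_cases hyS : y ∈ S x
      · rw [Set.indicator_of_mem hyS] at h1 ⊢
        calc _ ≤ w y * (Q y ^ n / (n.factorial : ℝ)) :=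
              mul_le_mul h1 (ihb y hy) (norm_nonneg _) (h.weight_nonneg y hy)
          _ = _ := by ring
      · rw [Set.indicator_of_notMem hyS] at h1 ⊢
        have : ‖K x y‖ = 0 := le_antisymm h1 (norm_nonneg _)
        rw [this, zero_mul]
    have hint : ∀ x > 0, IntegrableOn (fun y => w y * Q y ^ n) (S x) := by
      intro x hx
      have hm : AEStronglyMeasurable (fun y => Q y ^ n) (volume.restrict (S x)) :=
        ((h.majorant_cont.pow n).aestronglyMeasurable measurableSet_Ioi).mono_measure
          (Measure.restrict_mono (h.supp_pos x hx) le_rfl)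
      refine (h.weight_int x hx).mul_bdd (c := Q x ^ n) hm ?_
      rw [ae_restrict_iff' (h.meas_supp x hx)]
      refine Eventually.of_forall fun y hy => ?_
      have hQy := h.majorant_nonneg y (h.supp_pos x hx hy)
      rw [Real.norm_of_nonneg (pow_nonneg hQy n)]
      exact pow_le_pow_left₀ hQy (h.majorant_mono x hx y hy) n
    constructor
    · intro x hx
      have hind : Integrable ((S x).indicator (fun y => w y * Q y ^ n * (n.factorial : ℝ)⁻¹))
          (volume.restrict (Set.Ioi 0)) :=
        ((integrable_indicator_iff (h.meas_supp x hx)).2 ((hint x hx).mul_const _)).integrableOn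
      calc ‖volterraIter K (n + 1) x‖
          ≤ ∫ y in Set.Ioi 0, (S x).indicator (fun y => w y * Q y ^ n * (n.factorial : ℝ)⁻¹) y := by
            refine norm_integral_le_of_norm_le hind ?_
            rw [ae_restrict_iff' measurableSet_Ioi]
            exact Eventually.of_forall fun y hy => hpt x hx y hy
        _ = (∫ y in S x, w y * Q y ^ n) * (n.factorial : ℝ)⁻¹ := by
            rw [setIntegral_indicator (h.meas_supp x hx),
              Set.inter_eq_self_of_subset_right (h.supp_pos x hx), integral_mul_const]
        _ ≤ Q x ^ (n + 1) / (n + 1) * (n.factorial : ℝ)⁻¹ := by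
            gcongr
            exact h.majorant_iter n x hx
        _ = _ := by
            rw [Nat.factorial_succ]
            push_cast
            field_simp
    · intro x₀ hx₀
      refine ContinuousAt.continuousWithinAt ?_
      obtain ⟨x₁, hx₁, hev⟩ := h.local_bound x₀ hx₀
      refine continuousAt_of_dominated
        (bound := fun y => (S x₁).indicator w y * (Q x₁ ^ n / (n.factorial : ℝ))) ?_ ?_
        ((h.integrable_weight hx₁).mul_const _) ?_
      · filter_upwards [lt_mem_nhds hx₀] with x hx
        exact (h.meas x hx).mul (ihc.aestronglyMeasurable measurableSet_Ioi)
      · filter_upwards [hev, lt_mem_nhds hx₀] with x ⟨hS, hQ⟩ hx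
        rw [ae_restrict_iff' measurableSet_Ioi]
        refine Eventually.of_forall fun y hy => (hpt x hx y hy).trans ?_
        by_cases hyS : y ∈ S x
        · rw [Set.indicator_of_mem hyS, Set.indicator_of_mem (hS hyS), mul_assoc, div_eq_mul_inv]
          have := h.weight_nonneg y hy
          have := h.majorant_nonneg y hy
          gcongr
          exact (h.majorant_mono x hx y hyS).trans hQ
        · rw [Set.indicator_of_notMem hyS]
          have := h.majorant_nonneg x₁ hx₁
          exact mul_nonneg (Set.indicator_nonneg (fun y hy =>
            h.weight_nonneg y (h.supp_pos x₁ hx₁ hy)) y) (by positivity)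
      · filter_upwards [h.cont x₀ hx₀] with y hy
        exact hy.mul continuousAt_const

lemma iter_bound (h : IsVolterraKernel K S w Q) (n : ℕ) {x : ℝ} (hx : 0 < x) :
    ‖volterraIter K n x‖ ≤ Q x ^ n / (n.factorial : ℝ) :=
  (h.iter_bound_and_continuous n).1 x hx

lemma iter_continuousOn (h : IsVolterraKernel K S w Q) (n : ℕ) :
    ContinuousOn (volterraIter K n) (Set.Ioi 0) :=
  (h.iter_bound_and_continuous n).2

lemma hasSum_iter (h : IsVolterraKernel K S w Q) {x : ℝ} (hx : 0 < x) :
    HasSum (fun n => volterraIter K n x) (volterraSol K x) :=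
  (Summable.of_norm_bounded (Real.summable_pow_div_factorial (Q x))
    fun n => h.iter_bound n hx).hasSum

lemma norm_sol_le (h : IsVolterraKernel K S w Q) {x : ℝ} (hx : 0 < x) :
    ‖volterraSol K x‖ ≤ Real.exp (Q x) := by
  refine tsum_of_norm_bounded ?_ fun n => h.iter_bound n hx
  rw [Real.exp_eq_exp_ℝ]
  exact NormedSpace.expSeries_div_hasSum_exp (Q x)

lemma sol_continuousOn (h : IsVolterraKernel K S w Q) :
    ContinuousOn (volterraSol K) (Set.Ioi 0) := by
  intro x₀ hx₀
  obtain ⟨x₁, hx₁, hev⟩ := h.local_bound x₀ hx₀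
  refine ContinuousAt.continuousWithinAt ?_
  have hmem : {x | 0 < x ∧ Q x ≤ Q x₁} ∈ 𝓝 x₀ := by
    filter_upwards [hev, lt_mem_nhds (Set.mem_Ioi.1 hx₀)] with x h1 h2 using ⟨h2, h1.2⟩
  refine ContinuousOn.continuousAt (s := {x | 0 < x ∧ Q x ≤ Q x₁}) ?_ hmem
  refine continuousOn_tsum (fun n => (h.iter_continuousOn n).mono fun x hx => hx.1)
    (Real.summable_pow_div_factorial (Q x₁)) fun n x hx => (h.iter_bound n hx.1).trans ?_
  have := h.majorant_nonneg x hx.1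
  gcongr
  exact hx.2

lemma norm_kernel_mul_sol_le (h : IsVolterraKernel K S w Q) {x y : ℝ} (hx : 0 < x) (hy : 0 < y) :
    ‖K x y * volterraSol K y‖ ≤ (S x).indicator w y * Real.exp (Q x) := by
  have h1 := h.bound x hx y hy
  rw [norm_mul]
  by_cases hyS : y ∈ S x
  · rw [Set.indicator_of_mem hyS] at h1 ⊢
    refine mul_le_mul h1 ((h.norm_sol_le hy).trans ?_) (norm_nonneg _) (h.weight_nonneg y hy)
    exact Real.exp_le_exp.2 (h.majorant_mono x hx y hyS)
  · rw [Set.indicator_of_notMem hyS] at h1 ⊢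
    have : ‖K x y‖ = 0 := le_antisymm h1 (norm_nonneg _)
    rw [this, zero_mul, zero_mul]

/-- The Neumann series solves the Volterra equation. -/
lemma sol_eq (h : IsVolterraKernel K S w Q) {x : ℝ} (hx : 0 < x) :
    volterraSol K x = 1 + ∫ y in Set.Ioi 0, K x y * volterraSol K y := by
  have hs : HasSum (fun n => volterraIter K (n + 1) x)
      (∫ y in Set.Ioi 0, K x y * volterraSol K y) := by
    have hnn : ∀ y, 0 ≤ (S x).indicator w y := Set.indicator_nonneg fun y hy =>
      h.weight_nonneg y (h.supp_pos x hx hy)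
    refine hasSum_integral_of_dominated_convergence
      (fun n y => (S x).indicator w y * (Q x ^ n / (n.factorial : ℝ))) (fun n => ?_) (fun n => ?_)
      ?_ ?_ ?_
    · exact (h.meas x hx).mul ((h.iter_continuousOn n).aestronglyMeasurable measurableSet_Ioi)
    · rw [ae_restrict_iff' measurableSet_Ioi]
      refine Eventually.of_forall fun y hy => ?_
      have h1 := h.bound x hx y hy
      rw [norm_mul]
      by_cases hyS : y ∈ S x
      · refine mul_le_mul h1 ((h.iter_bound n hy).trans ?_) (norm_nonneg _) (hnn y)
        have := h.majorant_nonneg y hy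
        gcongr
        exact h.majorant_mono x hx y hyS
      · rw [Set.indicator_of_notMem hyS] at h1 ⊢
        have : ‖K x y‖ = 0 := le_antisymm h1 (norm_nonneg _)
        rw [this, zero_mul, zero_mul]
    · exact Eventually.of_forall fun y => (Real.summable_pow_div_factorial (Q x)).mul_left _
    · simp_rw [tsum_mul_left]
      exact (h.integrable_weight hx).mul_const _
    · rw [ae_restrict_iff' measurableSet_Ioi]
      exact Eventually.of_forall fun y hy => (h.hasSum_iter hy).mul_left _
  have h2 := (hasSum_nat_add_iff' 1).2 (h.hasSum_iter hx)
  have h3 := h2.unique hs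
  simp only [Finset.range_one, Finset.sum_singleton, volterraIter] at h3
  rw [← h3]; ring

lemma norm_sol_sub_one_le (h : IsVolterraKernel K S w Q) {x : ℝ} (hx : 0 < x) :
    ‖volterraSol K x - 1‖ ≤ Q x * Real.exp (Q x) := by
  rw [h.sol_eq hx, add_sub_cancel_left]
  calc _ ≤ ∫ y in Set.Ioi 0, (S x).indicator w y * Real.exp (Q x) := by
        refine norm_integral_le_of_norm_le ((h.integrable_weight hx).mul_const _) ?_
        rw [ae_restrict_iff' measurableSet_Ioi]
        exact Eventually.of_forall fun y hy => h.norm_kernel_mul_sol_le hx hy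
    _ = (∫ y in S x, w y) * Real.exp (Q x) := by
        rw [integral_mul_const, setIntegral_indicator (h.meas_supp x hx),
          Set.inter_eq_self_of_subset_right (h.supp_pos x hx)]
    _ ≤ _ := by
        gcongr
        simpa using h.majorant_iter 0 x hx

lemma differentiableOn_iter {K : ℂ → ℝ → ℝ → ℂ} {U : Set ℂ} (hU : IsOpen U)
    (h : ∀ z ∈ U, IsVolterraKernel (K z) S w Q)
    (hK : ∀ x > 0, ∀ y > 0, DifferentiableOn ℂ (fun z => K z x y) U) (n : ℕ) :
    ∀ x > 0, DifferentiableOn ℂ (fun z => volterraIter (K z) n x) U := by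
  induction n with
  | zero => exact fun x _ => differentiableOn_const _
  | succ n ih =>
    intro x hx
    rcases U.eq_empty_or_nonempty with rfl | ⟨z₀, hz₀⟩
    · exact differentiableOn_empty
    refine differentiableOn_integral_of_dominated hU
      (bound := fun y => (S x).indicator w y * (Q x ^ n / (n.factorial : ℝ))) (fun z hz => ?_)
      (((h z₀ hz₀).integrable_weight hx).mul_const _) ?_ ?_
    · exact ((h z hz).meas x hx).mul
        (((h z hz).iter_continuousOn n).aestronglyMeasurable measurableSet_Ioi)
    · rw [ae_restrict_iff' measurableSet_Ioi]
      refine Eventually.of_forall fun y hy z hz => ?_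
      have h1 := (h z hz).bound x hx y hy
      rw [norm_mul]
      by_cases hyS : y ∈ S x
      · rw [Set.indicator_of_mem hyS] at h1 ⊢
        refine mul_le_mul h1 (((h z hz).iter_bound n hy).trans ?_) (norm_nonneg _)
          ((h z hz).weight_nonneg y hy)
        have := (h z hz).majorant_nonneg y hy
        gcongr
        exact (h z hz).majorant_mono x hx y hyS
      · rw [Set.indicator_of_notMem hyS] at h1 ⊢
        have : ‖K z x y‖ = 0 := le_antisymm h1 (norm_nonneg _)
        rw [this, zero_mul, zero_mul]
    · rw [ae_restrict_iff' measurableSet_Ioi]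
      exact Eventually.of_forall fun y hy => (hK x hx y hy).mul (ih y hy)

/-- The solution of a Volterra equation depends holomorphically on a parameter in the kernel. -/
lemma differentiableOn_sol {K : ℂ → ℝ → ℝ → ℂ} {U : Set ℂ} (hU : IsOpen U)
    (h : ∀ z ∈ U, IsVolterraKernel (K z) S w Q)
    (hK : ∀ x > 0, ∀ y > 0, DifferentiableOn ℂ (fun z => K z x y) U) {x : ℝ} (hx : 0 < x) :
    DifferentiableOn ℂ (fun z => volterraSol (K z) x) U :=
  Complex.differentiableOn_tsum_of_summable_norm (Real.summable_pow_div_factorial (Q x))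
    (fun n => differentiableOn_iter hU h hK n x hx) hU fun n z hz => (h z hz).iter_bound n hx

end IsVolterraKernel

/-- A kernel supported in `0 < y ≤ x` and dominated by a weight integrable at `0`. -/
lemma isVolterraKernel_of_Ioc {K : ℝ → ℝ → ℂ} {w : ℝ → ℝ}
    (meas : ∀ x > 0, AEStronglyMeasurable (K x) (volume.restrict (Set.Ioi 0)))
    (cont : ∀ x₀ > 0, ∀ᵐ y ∂(volume.restrict (Set.Ioi 0)), ContinuousAt (fun x => K x y) x₀)
    (bound : ∀ x > 0, ∀ y > 0, ‖K x y‖ ≤ (Set.Ioc 0 x).indicator w y)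
    (hw : ∀ y > 0, 0 ≤ w y) (hwi : ∀ x > 0, IntegrableOn w (Set.Ioc 0 x)) :
    IsVolterraKernel K (fun x => Set.Ioc 0 x) w (fun x => ∫ t in (0 : ℝ)..x, w t) := by
  have hii : ∀ x > 0, IntervalIntegrable w volume 0 x := fun x hx =>
    (intervalIntegrable_iff_integrableOn_Ioc_of_le hx.le).2 (hwi x hx)
  have hmono : ∀ x > 0, ∀ y, 0 < y → y ≤ x → ∫ t in (0 : ℝ)..y, w t ≤ ∫ t in (0 : ℝ)..x, w t := by
    intro x hx y hy hyx
    rw [intervalIntegral.integral_of_le hx.le, intervalIntegral.integral_of_le hy.le]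
    refine setIntegral_mono_set (hwi x hx) ?_ (Set.Ioc_subset_Ioc_right hyx).eventuallyLE
    rw [EventuallyLE, ae_restrict_iff' measurableSet_Ioc]
    exact Eventually.of_forall fun t ht => hw t ht.1
  refine ⟨meas, cont, fun _ _ => measurableSet_Ioc, fun x _ y hy => hy.1, bound, hw, hwi,
    fun x hx => ?_, fun x hx y hy => hmono x hx y hy.1 hy.2, fun x hx => ?_, fun n x hx => ?_,
    fun x hx => ⟨x + 1, by positivity, ?_⟩⟩
  · rw [intervalIntegral.integral_of_le hx.le]
    exact setIntegral_nonneg measurableSet_Ioc fun t ht => hw t ht.1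
  · have hx' : (0 : ℝ) < x := hx
    have hp := isPrimitiveOn_integral (by positivity : (0 : ℝ) ≤ x + 1) (hii (x + 1) (by positivity))
    have := hp.continuousOn (Set.left_mem_Icc.2 (by positivity)) (Set.right_mem_Icc.2 (by positivity))
    rw [Set.uIcc_of_le (by positivity)] at this
    exact (this.continuousAt (Icc_mem_nhds hx' (by linarith))).continuousWithinAt
  -- Here `majorant_iter` is an equality, because (n+1) w Qⁿ integrates to Q^{n+1} and Q vanishes at
  -- 0.
  · have hp := ((isPrimitiveOn_integral hx.le (hii x hx)).pow n) 0 (Set.left_mem_Icc.2 hx.le) x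
      (Set.right_mem_Icc.2 hx.le)
    have h2 := hp.2
    beta_reduce at h2
    rw [intervalIntegral.integral_same, zero_pow n.succ_ne_zero, sub_zero,
      intervalIntegral.integral_const_mul, intervalIntegral.integral_of_le hx.le
        (f := fun t => w t * _)] at h2
    rw [h2]
    exact (mul_div_cancel_left₀ _ (by positivity)).ge
  · filter_upwards [gt_mem_nhds (show x < x + 1 by linarith), lt_mem_nhds hx] with y hy hy0
    exact ⟨Set.Ioc_subset_Ioc_right hy.le, hmono _ (by positivity) y hy0 hy.le⟩

lemma isPrimitiveOn_tail {𝕜 : Type*} [RCLike 𝕜] {h : ℝ → 𝕜}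
    (hi : ∀ x > 0, IntegrableOn h (Set.Ioi x)) :
    IsPrimitiveOn (Set.Ioi 0) (fun x => ∫ y in Set.Ioi x, h y) (fun x => -h x) := by
  intro a ha b hb
  have key : IntervalIntegrable h volume a b := by
    rw [intervalIntegrable_iff]
    refine (hi (min a b) (lt_min ha hb)).mono_set fun y hy => hy.1
  refine ⟨key.neg, ?_⟩
  rw [intervalIntegral.integral_neg, ← intervalIntegral.integral_Ioi_sub_Ioi' (hi a ha) (hi b hb)]
  ring

lemma tendsto_tail {h : ℝ → ℝ} (hi : ∀ x > 0, IntegrableOn h (Set.Ioi x)) :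
    Tendsto (fun x => ∫ y in Set.Ioi x, h y) atTop (𝓝 0) := by
  have h1 := intervalIntegral_tendsto_integral_Ioi 1 (hi 1 one_pos) tendsto_id
  have h2 := h1.const_sub (∫ y in Set.Ioi (1 : ℝ), h y)
  rw [sub_self] at h2
  refine h2.congr' ?_
  filter_upwards [eventually_gt_atTop 0] with x hx
  rw [id, ← intervalIntegral.integral_Ioi_sub_Ioi' (hi 1 one_pos) (hi x hx)]
  ring

/-- A kernel supported in `y > x` and dominated by a weight integrable at infinity. -/
lemma isVolterraKernel_of_Ioi {K : ℝ → ℝ → ℂ} {w : ℝ → ℝ}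
    (meas : ∀ x > 0, AEStronglyMeasurable (K x) (volume.restrict (Set.Ioi 0)))
    (cont : ∀ x₀ > 0, ∀ᵐ y ∂(volume.restrict (Set.Ioi 0)), ContinuousAt (fun x => K x y) x₀)
    (bound : ∀ x > 0, ∀ y > 0, ‖K x y‖ ≤ (Set.Ioi x).indicator w y)
    (hw : ∀ y > 0, 0 ≤ w y) (hwi : ∀ x > 0, IntegrableOn w (Set.Ioi x)) :
    IsVolterraKernel K (fun x => Set.Ioi x) w (fun x => ∫ t in Set.Ioi x, w t) := by
  have hp := isPrimitiveOn_tail hwi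
  have hnn : ∀ x > 0, 0 ≤ ∫ t in Set.Ioi x, w t := fun x hx =>
    setIntegral_nonneg measurableSet_Ioi fun t ht => hw t (hx.trans ht)
  have hmono : ∀ x > 0, ∀ y, x ≤ y → ∫ t in Set.Ioi y, w t ≤ ∫ t in Set.Ioi x, w t := by
    intro x hx y hxy
    refine setIntegral_mono_set (hwi x hx) ?_ (Set.Ioi_subset_Ioi hxy).eventuallyLE
    rw [EventuallyLE, ae_restrict_iff' measurableSet_Ioi]
    exact Eventually.of_forall fun t ht => hw t (hx.trans ht)
  refine ⟨meas, cont, fun _ _ => measurableSet_Ioi, fun x hx y hy => lt_trans hx hy, bound, hw, hwi,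
    hnn, fun x hx y hy => hmono x hx y (le_of_lt hy),
    fun x hx => (hp.continuousAt isOpen_Ioi hx).continuousWithinAt, fun n x hx => ?_,
    fun x hx => ⟨x / 2, by positivity, ?_⟩⟩
  -- On a finite interval (x, b] the identity for Q^{n+1} leaves a boundary term at `b` of
  -- favourable sign. If the integrand were not integrable, its integral would be 0 by convention
  -- and the claim trivial.
  · by_cases hint : IntegrableOn (fun y => w y * (∫ t in Set.Ioi y, w t) ^ n) (Set.Ioi x)
    · refine le_of_tendsto (intervalIntegral_tendsto_integral_Ioi x hint tendsto_id) ?_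
      filter_upwards [eventually_gt_atTop x] with b hb
      have h2 := (hp.pow n x hx b (hx.trans hb)).2
      have e : ∀ t, ((n : ℝ) + 1) * (-w t * (∫ t in Set.Ioi t, w t) ^ n)
          = -((n : ℝ) + 1) * (w t * (∫ t in Set.Ioi t, w t) ^ n) := fun t => by ring
      simp_rw [e] at h2
      rw [intervalIntegral.integral_const_mul] at h2
      rw [id, le_div_iff₀ (by positivity)]
      have := pow_nonneg (hnn b (hx.trans hb)) (n + 1)
      linarith
    · rw [integral_undef hint]
      have := hnn x hx
      positivity
  · filter_upwards [lt_mem_nhds (show x / 2 < x by linarith)] with y hy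
    exact ⟨Set.Ioi_subset_Ioi hy.le, hmono _ (by positivity) y hy.le⟩

/-! ### Solutions of the radial equation -/

/-- The effective potential `l(l+1)/x² + q`. -/
def effPotential (l : ℝ) (q : ℝ → ℝ) (x : ℝ) : ℝ := l * (l + 1) / x ^ 2 + q x

lemma intervalIntegrable_of_locallyIntegrableOn {q : ℝ → ℝ}
    (hq : LocallyIntegrableOn q (Set.Ioi 0)) {a b : ℝ} (ha : 0 < a) (hb : 0 < b) :
    IntervalIntegrable q volume a b := by
  rw [intervalIntegrable_iff']
  exact hq.integrableOn_compact_subset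
    (Set.OrdConnected.uIcc_subset Set.ordConnected_Ioi ha hb) isCompact_uIcc

lemma intervalIntegrable_effPotential {l : ℝ} {q : ℝ → ℝ}
    (hq : LocallyIntegrableOn q (Set.Ioi 0)) {a b : ℝ} (ha : 0 < a) (hb : 0 < b) :
    IntervalIntegrable (effPotential l q) volume a b := by
  refine IntervalIntegrable.add (ContinuousOn.intervalIntegrable ?_)
    (intervalIntegrable_of_locallyIntegrableOn hq ha hb)
  intro x hx
  have hx0 : x ≠ 0 :=
    ne_of_gt (Set.OrdConnected.uIcc_subset Set.ordConnected_Ioi ha hb hx)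
  exact ContinuousAt.continuousWithinAt (by fun_prop (disch := positivity))

lemma isSolution_of_isPrimitiveOn {l : ℝ} {q : ℝ → ℝ} {z : ℂ} {y y' : ℝ → ℂ}
    (h : ∀ x > 0, HasDerivAt y (y' x) x)
    (h' : IsPrimitiveOn (Set.Ioi 0) y' (fun x => ((effPotential l q x : ℂ) - z) * y x)) :
    IsSolution l q z y := by
  refine ⟨fun x hx => (h x hx).differentiableAt, fun a b ha hb => ?_⟩
  rw [(h a ha).deriv, (h b hb).deriv]
  exact (h' a ha b hb).2

lemma IsSolution.continuousOn {l : ℝ} {q : ℝ → ℝ} {z : ℂ} {y : ℝ → ℂ} (h : IsSolution l q z y) :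
    ContinuousOn y (Set.Ioi 0) :=
  fun x hx => (h.1 x hx).continuousAt.continuousWithinAt

lemma IsSolution.isPrimitiveOn_deriv {l : ℝ} {q : ℝ → ℝ} {z : ℂ} {y : ℝ → ℂ}
    (h : IsSolution l q z y) (hq : LocallyIntegrableOn q (Set.Ioi 0)) :
    IsPrimitiveOn (Set.Ioi 0) (deriv y) (fun x => ((effPotential l q x : ℂ) - z) * y x) := by
  intro a ha b hb
  have hab : Set.uIcc a b ⊆ Set.Ioi 0 := Set.OrdConnected.uIcc_subset Set.ordConnected_Ioi ha hb
  refine ⟨?_, h.2 a b ha hb⟩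
  refine IntervalIntegrable.mul_continuousOn (IntervalIntegrable.sub ?_ (by simp))
    (h.continuousOn.mono hab)
  have := intervalIntegrable_effPotential (l := l) hq ha hb
  exact ⟨this.1.ofReal, this.2.ofReal⟩

lemma IsSolution.continuousOn_deriv {l : ℝ} {q : ℝ → ℝ} {z : ℂ} {y : ℝ → ℂ}
    (h : IsSolution l q z y) (hq : LocallyIntegrableOn q (Set.Ioi 0)) :
    ContinuousOn (deriv y) (Set.Ioi 0) :=
  fun _ hx => ((h.isPrimitiveOn_deriv hq).continuousAt isOpen_Ioi hx).continuousWithinAt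

lemma IsSolution.isPrimitiveOn {l : ℝ} {q : ℝ → ℝ} {z : ℂ} {y : ℝ → ℂ}
    (h : IsSolution l q z y) (hq : LocallyIntegrableOn q (Set.Ioi 0)) :
    IsPrimitiveOn (Set.Ioi 0) y (deriv y) :=
  IsPrimitiveOn.of_hasDerivAt (fun x hx => (h.1 x hx).hasDerivAt) (h.continuousOn_deriv hq)

/-- The Wronskian of solutions for two potentials is a primitive of the difference. -/
lemma isPrimitiveOn_wronskian {y₁ y₂ y₁' y₂' V₁ V₂ : ℝ → ℂ}
    (h₁ : IsPrimitiveOn (Set.Ioi 0) y₁ y₁')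
    (h₁' : IsPrimitiveOn (Set.Ioi 0) y₁' (fun x => V₁ x * y₁ x))
    (h₂ : IsPrimitiveOn (Set.Ioi 0) y₂ y₂')
    (h₂' : IsPrimitiveOn (Set.Ioi 0) y₂' (fun x => V₂ x * y₂ x)) :
    IsPrimitiveOn (Set.Ioi 0) (fun x => y₁ x * y₂' x - y₁' x * y₂ x)
      (fun x => (V₂ x - V₁ x) * (y₁ x * y₂ x)) :=
  ((h₁.mul h₂').sub (h₁'.mul h₂)).congr fun x _ => by ring

lemma IsSolution.wronskian_eq {l : ℝ} {q : ℝ → ℝ} {z : ℂ} {y₁ y₂ : ℝ → ℂ}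
    (h₁ : IsSolution l q z y₁) (h₂ : IsSolution l q z y₂)
    (hq : LocallyIntegrableOn q (Set.Ioi 0)) {a b : ℝ} (ha : 0 < a) (hb : 0 < b) :
    wronskian y₁ y₂ b = wronskian y₁ y₂ a := by
  have := (isPrimitiveOn_wronskian (h₁.isPrimitiveOn hq) (h₁.isPrimitiveOn_deriv hq)
    (h₂.isPrimitiveOn hq) (h₂.isPrimitiveOn_deriv hq) a ha b hb).2
  simp only [sub_self, zero_mul, intervalIntegral.integral_zero] at this
  exact sub_eq_zero.1 this

/-! ### Existence of the Jost solution -/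

/-- The Volterra kernel of the equation for `e^{-ikx} f(k,x)`. -/
def jostKernel (V : ℝ → ℝ) (k : ℂ) (x y : ℝ) : ℂ :=
  (Set.Ioi x).indicator
    (fun y => (Complex.exp (2 * Complex.I * k * (y - x)) - 1) / (2 * Complex.I * k) * V y) y

lemma norm_exp_two_mul_le_one {k : ℂ} (hk : 0 ≤ k.im) {x y : ℝ} (hxy : x ≤ y) :
    ‖Complex.exp (2 * Complex.I * k * (y - x))‖ ≤ 1 := by
  rw [Complex.norm_exp, Real.exp_le_one_iff]
  have : (2 * Complex.I * k * (y - x)).re = -(2 * (k.im * (y - x))) := by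
    simp
    ring
  rw [this, neg_nonpos]
  have := mul_nonneg hk (sub_nonneg.2 hxy)
  positivity

/-- For Im k ≥ 0 and y ≥ x the exponential has modulus at most 1, so the numerator is at most 2 and
|V|/|k| is a dominating weight. -/
lemma isVolterraKernel_jost {V : ℝ → ℝ} (hV : ∀ x > 0, IntegrableOn V (Set.Ioi x))
    (hVm : AEStronglyMeasurable V (volume.restrict (Set.Ioi 0))) {k : ℂ} (hk : 0 ≤ k.im)
    (hk0 : k ≠ 0) :
    IsVolterraKernel (jostKernel V k) (fun x => Set.Ioi x) (fun y => |V y| / ‖k‖)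
      (fun x => ∫ t in Set.Ioi x, |V t| / ‖k‖) := by
  refine isVolterraKernel_of_Ioi (fun x _ => ?_) (fun x₀ _ => ?_) (fun x _ y _ => ?_)
    (fun y _ => by positivity) (fun x hx => (hV x hx).abs.div_const _)
  · refine AEStronglyMeasurable.indicator ?_ measurableSet_Ioi
    refine AEStronglyMeasurable.mul (Continuous.aestronglyMeasurable (by fun_prop)) ?_
    exact Complex.continuous_ofReal.comp_aestronglyMeasurable hVm
  · have hne : ∀ᵐ y ∂(volume.restrict (Set.Ioi (0 : ℝ))), y ≠ x₀ :=
      ae_restrict_of_ae (by simp [ae_iff, measure_singleton])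
    filter_upwards [hne] with y hy
    rcases lt_or_gt_of_ne hy with h | h
    · refine (continuousAt_const (y := (0 : ℂ))).congr ?_
      filter_upwards [lt_mem_nhds h] with x hx
      rw [jostKernel, Set.indicator_of_notMem (by simpa using hx.le)]
    · have : ContinuousAt (fun x : ℝ => (Complex.exp (2 * Complex.I * k * (y - x)) - 1)
          / (2 * Complex.I * k) * V y) x₀ := by fun_prop
      refine this.congr ?_
      filter_upwards [gt_mem_nhds h] with x hx
      rw [jostKernel, Set.indicator_of_mem (by simpa using hx)]
  · rw [jostKernel]
    by_cases hy : y ∈ Set.Ioi x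
    · rw [Set.indicator_of_mem hy, Set.indicator_of_mem hy, norm_mul, norm_div]
      have h1 : ‖Complex.exp (2 * Complex.I * k * (y - x)) - 1‖ ≤ 2 := by
        refine (norm_sub_le _ _).trans ?_
        rw [norm_one]
        linarith [norm_exp_two_mul_le_one hk (le_of_lt (Set.mem_Ioi.1 hy))]
      have h2 : ‖2 * Complex.I * k‖ = 2 * ‖k‖ := by simp
      have hk1 : 0 < ‖k‖ := norm_pos_iff.2 hk0
      rw [h2, Complex.norm_real, Real.norm_eq_abs, div_mul_eq_mul_div, div_le_div_iff₀ (by positivity)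
        hk1]
      have := mul_le_mul_of_nonneg_right h1 (mul_nonneg (abs_nonneg (V y)) hk1.le)
      linarith
    · rw [Set.indicator_of_notMem hy, Set.indicator_of_notMem hy, norm_zero]

/-- The centrifugal term is treated as part of the perturbation, since it is integrable at infinity.
With f = e^{ikx} u the equation becomes u'' + 2ik u' = V u; its Volterra form gives u → 1, and then
u' → 0. -/
lemma exists_isJostSolution {l : ℝ} {q : ℝ → ℝ}
    (hq : ∀ x > 0, IntegrableOn (effPotential l q) (Set.Ioi x))
    (hqm : AEStronglyMeasurable (effPotential l q) (volume.restrict (Set.Ioi 0)))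
    {k : ℂ} (hk : 0 ≤ k.im) (hk0 : k ≠ 0) : ∃ f, IsJostSolution l q k f := by
  set V := effPotential l q with hV
  have hK := isVolterraKernel_jost hq hqm hk hk0
  set u := volterraSol (jostKernel V k) with hu
  set Q : ℝ → ℝ := fun x => ∫ t in Set.Ioi x, |V t| / ‖k‖ with hQ
  have hk1 : 0 < ‖k‖ := norm_pos_iff.2 hk0
  have hQlim : Tendsto Q atTop (𝓝 0) := tendsto_tail fun x hx => (hq x hx).abs.div_const _
  have huc : ContinuousOn u (Set.Ioi 0) := hK.sol_continuousOn
  have hVu : ∀ x > 0, IntegrableOn (fun y => (V y : ℂ) * u y) (Set.Ioi x) := by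
    intro x hx
    refine Integrable.mul_bdd (c := Real.exp (Q x)) (hq x hx).ofReal ?_ ?_
    · exact (huc.mono (Set.Ioi_subset_Ioi hx.le)).aestronglyMeasurable measurableSet_Ioi
    · rw [ae_restrict_iff' measurableSet_Ioi]
      exact Eventually.of_forall fun y hy => (hK.norm_sol_le (hx.trans hy)).trans
        (Real.exp_le_exp.2 (hK.majorant_mono x hx y hy))
  have heVu : ∀ x > 0, IntegrableOn (fun y : ℝ => Complex.exp (2 * Complex.I * k * y) *
      ((V y : ℂ) * u y)) (Set.Ioi x) := by
    intro x hx
    refine Integrable.bdd_mul (c := 1) (hVu x hx)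
      (Continuous.aestronglyMeasurable (by fun_prop)) ?_
    rw [ae_restrict_iff' measurableSet_Ioi]
    refine Eventually.of_forall fun y hy => ?_
    have := norm_exp_two_mul_le_one hk (hx.trans hy).le
    simpa using this
  -- The kernel separates into two tails, and in u' the contributions of V u cancel, leaving u' =
  -- -e^{-2ikx} A(x). Only products of tails and smooth functions are differentiated.
  set A : ℝ → ℂ := fun x => ∫ y in Set.Ioi x, Complex.exp (2 * Complex.I * k * y) *
      ((V y : ℂ) * u y) with hA
  set B : ℝ → ℂ := fun x => ∫ y in Set.Ioi x, (V y : ℂ) * u y with hB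
  have h2k : 2 * Complex.I * k ≠ 0 := by simp [hk0]
  have hue : ∀ x > 0, u x = 1 + (2 * Complex.I * k)⁻¹ *
      (Complex.exp (-(2 * Complex.I * k) * x) * A x - B x) := by
    intro x hx
    rw [hu, hK.sol_eq hx, ← hu]
    congr 1
    have e : ∀ y, jostKernel V k x y * u y = (Set.Ioi x).indicator (fun y : ℝ =>
        (2 * Complex.I * k)⁻¹ * (Complex.exp (-(2 * Complex.I * k) * x) *
        (Complex.exp (2 * Complex.I * k * y) * ((V y : ℂ) * u y)) - (V y : ℂ) * u y)) y := by
      intro y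
      rw [jostKernel]
      by_cases hy : y ∈ Set.Ioi x
      · rw [Set.indicator_of_mem hy, Set.indicator_of_mem hy]
        have : Complex.exp (2 * Complex.I * k * (y - x)) =
            Complex.exp (-(2 * Complex.I * k) * x) * Complex.exp (2 * Complex.I * k * y) := by
          rw [← Complex.exp_add]; ring_nf
        rw [this]; field_simp
      · rw [Set.indicator_of_notMem hy, Set.indicator_of_notMem hy, zero_mul]
    simp_rw [e]
    rw [setIntegral_indicator measurableSet_Ioi, Set.inter_eq_self_of_subset_right
      (Set.Ioi_subset_Ioi hx.le), integral_const_mul, integral_sub ((heVu x hx).const_mul _)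
      (hVu x hx), integral_const_mul]
  have hAp : IsPrimitiveOn (Set.Ioi 0) A _ := isPrimitiveOn_tail heVu
  have hBp : IsPrimitiveOn (Set.Ioi 0) B _ := isPrimitiveOn_tail hVu
  have hexp : ∀ c : ℂ, IsPrimitiveOn (Set.Ioi 0) (fun x : ℝ => Complex.exp (c * x))
      (fun x : ℝ => c * Complex.exp (c * x)) := by
    intro c
    refine IsPrimitiveOn.of_hasDerivAt (fun x _ => ?_) (by fun_prop)
    have := ((hasDerivAt_id (x : ℂ)).const_mul c).cexp.comp_ofReal
    simpa [mul_comm] using this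
  have hee : ∀ x : ℝ, Complex.exp (-(2 * Complex.I * k) * x) * Complex.exp (2 * Complex.I * k * x)
      = 1 := by
    intro x; rw [← Complex.exp_add]; simp
  set u1 : ℝ → ℂ := fun x => -(Complex.exp (-(2 * Complex.I * k) * x) * A x) with hu1
  have hup : IsPrimitiveOn (Set.Ioi 0) u u1 := by
    refine ((((((hexp (-(2 * Complex.I * k))).mul hAp).sub hBp).const_mul
      (2 * Complex.I * k)⁻¹).const_add 1).congr_left fun x hx => (hue x hx).symm).congr fun x _ => ?_
    rw [hu1]
    linear_combination (-(Complex.exp (-(2 * Complex.I * k) * x) * A x)) * inv_mul_cancel₀ h2k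
      - (2 * Complex.I * k)⁻¹ * ((V x : ℂ) * u x) * hee x
  have hu1p : IsPrimitiveOn (Set.Ioi 0) u1 (fun x => V x * u x - 2 * Complex.I * k * u1 x) := by
    refine ((((hexp (-(2 * Complex.I * k))).mul hAp).const_mul (-1)).congr_left
      fun x _ => by rw [hu1]; ring).congr fun x _ => ?_
    rw [hu1]
    linear_combination ((V x : ℂ) * u x) * hee x
  have hE := hexp (Complex.I * k)
  set f : ℝ → ℂ := fun x => Complex.exp (Complex.I * k * x) * u x with hf
  set f1 : ℝ → ℂ := fun x => Complex.exp (Complex.I * k * x) * (Complex.I * k * u x + u1 x) with hf1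
  have hfp : IsPrimitiveOn (Set.Ioi 0) f f1 :=
    (hE.mul hup).congr fun x _ => by rw [hf1]; ring
  have hf1p : IsPrimitiveOn (Set.Ioi 0) f1 (fun x => ((V x : ℂ) - k ^ 2) * f x) :=
    (hE.mul ((hup.const_mul (Complex.I * k)).add hu1p)).congr fun x _ => by
      rw [hf]
      linear_combination (k ^ 2 * Complex.exp (Complex.I * k * x) * u x) * Complex.I_sq
  have hder : ∀ x > 0, HasDerivAt f (f1 x) x := fun x hx => hfp.hasDerivAt isOpen_Ioi
    (fun y hy => (hf1p.continuousAt isOpen_Ioi hy).continuousWithinAt) hx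
  have hulim : Tendsto u atTop (𝓝 1) := by
    rw [tendsto_iff_norm_sub_tendsto_zero]
    have hb : Tendsto (fun x => Q x * Real.exp (Q x)) atTop (𝓝 (0 * Real.exp 0)) :=
      hQlim.mul ((Real.continuous_exp.tendsto 0).comp hQlim)
    rw [zero_mul] at hb
    refine squeeze_zero' (Eventually.of_forall fun _ => norm_nonneg _) ?_ hb
    filter_upwards [eventually_gt_atTop 0] with x hx using hK.norm_sol_sub_one_le hx
  have hu1lim : Tendsto u1 atTop (𝓝 0) := by
    have hb : Tendsto (fun x => ‖k‖ * Real.exp (Q x) * Q x) atTop (𝓝 (‖k‖ * Real.exp 0 * 0)) :=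
      (((Real.continuous_exp.tendsto 0).comp hQlim).const_mul _).mul hQlim
    rw [mul_zero] at hb
    refine squeeze_zero_norm' ?_ hb
    filter_upwards [eventually_gt_atTop 0] with x hx
    rw [hu1, norm_neg, hA, ← integral_const_mul]
    refine le_of_le_of_eq ?_ (integral_const_mul (‖k‖ * Real.exp (Q x)) fun t => |V t| / ‖k‖)
    refine norm_integral_le_of_norm_le (((hq x hx).abs.div_const _).const_mul _) ?_
    rw [ae_restrict_iff' measurableSet_Ioi]
    refine Eventually.of_forall fun y hy => ?_
    rw [← mul_assoc, ← Complex.exp_add, norm_mul, norm_mul]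
    have e1 : ‖Complex.exp (-(2 * Complex.I * k) * x + 2 * Complex.I * k * y)‖ ≤ 1 := by
      have := norm_exp_two_mul_le_one hk (le_of_lt (Set.mem_Ioi.1 hy))
      convert this using 3
      ring
    have e2 : ‖u y‖ ≤ Real.exp (Q x) := (hK.norm_sol_le (hx.trans hy)).trans
        (Real.exp_le_exp.2 (hK.majorant_mono x hx y hy))
    rw [Complex.norm_real, Real.norm_eq_abs]
    calc _ ≤ 1 * (|V y| * Real.exp (Q x)) := by gcongr
      _ = _ := by field_simp
  refine ⟨f, isSolution_of_isPrimitiveOn hder hf1p, ?_, ?_⟩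
  · refine hulim.congr fun x => ?_
    rw [hf, ← mul_assoc, ← Complex.exp_add, neg_add_cancel, Complex.exp_zero, one_mul]
  · have h1 := (hulim.const_mul (Complex.I * k)).add hu1lim
    rw [mul_one, add_zero] at h1
    refine h1.congr' ?_
    filter_upwards [eventually_gt_atTop 0] with x hx
    rw [(hder x hx).deriv, hf1, ← mul_assoc, ← Complex.exp_add, neg_add_cancel, Complex.exp_zero,
      one_mul]

/-! ### Construction of the regular solution -/

/-! ### A Hardy-type integral at the origin. -/

section Hardy

variable {𝕜 : Type*} [RCLike 𝕜] {α : ℝ} {h : ℝ → 𝕜}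

lemma isPrimitiveOn_integral_zero (hi : ∀ x > 0, IntegrableOn h (Set.Ioc 0 x)) :
    IsPrimitiveOn (Set.Ioi 0) (fun x => ∫ t in (0 : ℝ)..x, h t) h := by
  intro a ha b hb
  have hii : ∀ x > 0, IntervalIntegrable h volume 0 x := fun x hx =>
    (intervalIntegrable_iff_integrableOn_Ioc_of_le hx.le).2 (hi x hx)
  exact ⟨(hii a ha).symm.trans (hii b hb),
    intervalIntegral.integral_interval_sub_left (hii b hb) (hii a ha)⟩

lemma tendsto_integral_zero {b : ℝ} (hb : 0 < b) (hi : IntegrableOn h (Set.Ioc 0 b)) :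
    Tendsto (fun x => ∫ t in (0 : ℝ)..x, h t) (𝓝[>] 0) (𝓝 0) := by
  have hii : IntervalIntegrable h volume 0 b :=
    (intervalIntegrable_iff_integrableOn_Ioc_of_le hb.le).2 hi
  have hp := isPrimitiveOn_integral hb.le hii
  have hc := hp.continuousOn (Set.left_mem_Icc.2 hb.le) (Set.right_mem_Icc.2 hb.le)
  rw [Set.uIcc_of_le hb.le] at hc
  have h0 := hc 0 (Set.left_mem_Icc.2 hb.le)
  rw [ContinuousWithinAt, intervalIntegral.integral_same] at h0
  refine h0.mono_left ?_
  rw [← nhdsWithin_Ioc_eq_nhdsGT hb]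
  exact nhdsWithin_mono _ Set.Ioc_subset_Icc_self

lemma isPrimitiveOn_rpow (p : ℝ) : IsPrimitiveOn (Set.Ioi 0) (fun x => ((x ^ p : ℝ) : 𝕜))
    (fun x => ((p * x ^ (p - 1) : ℝ) : 𝕜)) := by
  refine IsPrimitiveOn.of_hasDerivAt (fun x hx => ?_) (fun x hx => ?_)
  · exact (RCLike.ofRealCLM (K := 𝕜)).hasFDerivAt.comp_hasDerivAt x
      (Real.hasDerivAt_rpow_const (Or.inl (ne_of_gt hx)))
  · have hx' : x ≠ 0 := ne_of_gt hx
    refine ContinuousAt.continuousWithinAt ?_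
    exact RCLike.continuous_ofReal.continuousAt.comp
      (continuousAt_const.mul (Real.continuousAt_rpow_const _ _ (Or.inl hx')))

lemma isPrimitiveOn_cast_rpow (p : ℝ) : IsPrimitiveOn (Set.Ioi 0) (fun x => ((x ^ p : ℝ) : ℂ))
    (fun x => ((p * x ^ (p - 1) : ℝ) : ℂ)) :=
  isPrimitiveOn_rpow p

lemma norm_rpow_succ_mul_le (hα : 0 < α) {x y : ℝ} (hy : 0 < y) (hyx : y ≤ x) :
    ‖((y ^ (α + 1) : ℝ) : 𝕜) * h y‖ ≤ x ^ α * ‖(y : 𝕜) * h y‖ := by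
  rw [norm_mul, norm_mul, RCLike.norm_ofReal, RCLike.norm_ofReal, Real.rpow_add_one hy.ne', abs_mul,
    mul_assoc, abs_of_nonneg (Real.rpow_nonneg hy.le α)]
  gcongr

lemma integrableOn_rpow_succ_mul (hα : 0 < α)
    (hi : ∀ x > (0 : ℝ), IntegrableOn (fun y : ℝ => (y : 𝕜) * h y) (Set.Ioc 0 x)) {x : ℝ} (hx : 0 < x) :
    IntegrableOn (fun y => ((y ^ (α + 1) : ℝ) : 𝕜) * h y) (Set.Ioc 0 x) := by
  have e : Set.EqOn (fun y => ((y ^ α : ℝ) : 𝕜) * ((y : 𝕜) * h y))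
      (fun y => ((y ^ (α + 1) : ℝ) : 𝕜) * h y) (Set.Ioc 0 x) := by
    intro y hy
    simp only
    rw [Real.rpow_add_one hy.1.ne']
    push_cast
    ring
  refine IntegrableOn.congr_fun ?_ e measurableSet_Ioc
  refine Integrable.bdd_mul (c := x ^ α) (hi x hx) ?_ ?_
  · refine Continuous.aestronglyMeasurable ?_
    exact RCLike.continuous_ofReal.comp (Real.continuous_rpow_const hα.le)
  · rw [ae_restrict_iff' measurableSet_Ioc]
    refine Eventually.of_forall fun y hy => ?_
    rw [RCLike.norm_ofReal, abs_of_nonneg (Real.rpow_nonneg hy.1.le α)]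
    exact Real.rpow_le_rpow hy.1.le hy.2 hα.le

lemma norm_integral_rpow_succ_mul_le (hα : 0 < α)
    (hi : ∀ x > (0 : ℝ), IntegrableOn (fun y : ℝ => (y : 𝕜) * h y) (Set.Ioc 0 x)) {x : ℝ} (hx : 0 < x) :
    ‖∫ y in (0 : ℝ)..x, ((y ^ (α + 1) : ℝ) : 𝕜) * h y‖ ≤
      x ^ α * ∫ y in (0 : ℝ)..x, ‖(y : 𝕜) * h y‖ := by
  rw [intervalIntegral.integral_of_le hx.le, intervalIntegral.integral_of_le hx.le,
    ← integral_const_mul]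
  refine norm_integral_le_of_norm_le ((hi x hx).norm.const_mul _) ?_
  rw [ae_restrict_iff' measurableSet_Ioc]
  exact Eventually.of_forall fun y hy => norm_rpow_succ_mul_le hα hy.1 hy.2

/-- This is the double integral solving x^{-α-1} (x^{α+1} v')' = h with v(0) = 0, after one
integration is carried out. It is applied with α = 2l+1 and h = (q - z) u. -/
lemma isPrimitiveOn_hardy (hα : 0 < α)
    (hi : ∀ x > (0 : ℝ), IntegrableOn (fun y : ℝ => (y : 𝕜) * h y) (Set.Ioc 0 x)) :
    IsPrimitiveOn (Set.Ioi 0)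
      (fun x => ((α⁻¹ : ℝ) : 𝕜) * ((∫ y in (0 : ℝ)..x, (y : 𝕜) * h y) -
        ((x ^ (-α) : ℝ) : 𝕜) * ∫ y in (0 : ℝ)..x, ((y ^ (α + 1) : ℝ) : 𝕜) * h y))
      (fun x => ((x ^ (-α - 1) : ℝ) : 𝕜) * ∫ y in (0 : ℝ)..x, ((y ^ (α + 1) : ℝ) : 𝕜) * h y) := by
  have hA := isPrimitiveOn_integral_zero hi
  have hB := isPrimitiveOn_integral_zero fun x hx => integrableOn_rpow_succ_mul hα hi hx
  refine ((hA.sub ((isPrimitiveOn_rpow (-α)).mul hB)).const_mul ((α⁻¹ : ℝ) : 𝕜)).congr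
    fun x hx => ?_
  have h1 : x ^ (-α) * x ^ (α + 1) = x := by
    rw [← Real.rpow_add hx]; simp
  have h2 : ((x ^ (-α) : ℝ) : 𝕜) * ((x ^ (α + 1) : ℝ) : 𝕜) = (x : 𝕜) := by
    rw [← RCLike.ofReal_mul, h1]
  have h3 : ((α⁻¹ : ℝ) : 𝕜) * (α : 𝕜) = 1 := by
    rw [← RCLike.ofReal_mul, inv_mul_cancel₀ hα.ne', RCLike.ofReal_one]
  push_cast
  push_cast at h2 h3
  linear_combination (((x ^ (-α - 1) : ℝ) : 𝕜) *
    ∫ y in (0 : ℝ)..x, ((y ^ (α + 1) : ℝ) : 𝕜) * h y) * h3 - (α : 𝕜)⁻¹ * h x * h2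

/-- Exchanging the order of integration would bound the norm by α⁻¹ ∫ y‖h‖; the explicit primitive
of the previous lemma, applied to ‖h‖, gives the same bound. It is the source of the W^{1,1}
regularity of the regular solution. -/
lemma integrableOn_hardy (hα : 0 < α)
    (hi : ∀ x > (0 : ℝ), IntegrableOn (fun y : ℝ => (y : 𝕜) * h y) (Set.Ioc 0 x)) :
    IntegrableOn (fun x => ((x ^ (-α - 1) : ℝ) : 𝕜) *
      ∫ y in (0 : ℝ)..x, ((y ^ (α + 1) : ℝ) : 𝕜) * h y) (Set.Ioc 0 1) := by
  have hin : ∀ x > 0, IntegrableOn (fun y => y * ‖h y‖) (Set.Ioc 0 x) := fun x hx => by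
    refine IntegrableOn.congr_fun (hi x hx).norm (fun y hy => ?_) measurableSet_Ioc
    simp only [norm_mul, RCLike.norm_ofReal, abs_of_pos hy.1]
  have hP := isPrimitiveOn_hardy (𝕜 := ℝ) hα (h := fun y => ‖h y‖) hin
  have hP' := isPrimitiveOn_hardy hα hi
  simp only [RCLike.ofReal_real_eq_id, id] at hP
  have hB0 : ∀ x > 0, 0 ≤ ∫ y in (0 : ℝ)..x, y ^ (α + 1) * ‖h y‖ := fun x hx =>
    intervalIntegral.integral_nonneg hx.le fun y hy =>
      mul_nonneg (Real.rpow_nonneg hy.1 _) (norm_nonneg _)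
  have hBle : ∀ x > 0, x ^ (-α) * (∫ y in (0 : ℝ)..x, y ^ (α + 1) * ‖h y‖) ≤
      ∫ y in (0 : ℝ)..x, y * ‖h y‖ := by
    intro x hx
    have h1 := (le_abs_self _).trans
      (norm_integral_rpow_succ_mul_le (𝕜 := ℝ) hα (h := fun y => ‖h y‖) hin hx)
    simp only [RCLike.ofReal_real_eq_id, id] at h1
    have h2 : ∫ y in (0 : ℝ)..x, ‖y * ‖h y‖‖ = ∫ y in (0 : ℝ)..x, y * ‖h y‖ := by
      refine intervalIntegral.integral_congr fun y hy => ?_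
      rw [Set.uIcc_of_le hx.le] at hy
      exact Real.norm_of_nonneg (mul_nonneg hy.1 (norm_nonneg _))
    rw [h2] at h1
    calc _ ≤ x ^ (-α) * (x ^ α * ∫ y in (0 : ℝ)..x, y * ‖h y‖) := by gcongr
      _ = _ := by
        rw [← mul_assoc, ← Real.rpow_add hx]; simp
  have hlim : Tendsto (fun n : ℕ => 1 / ((n : ℝ) + 1)) atTop (𝓝 0) :=
    tendsto_one_div_add_atTop_nhds_zero_nat
  have hn : ∀ n : ℕ, 0 < 1 / ((n : ℝ) + 1) ∧ 1 / ((n : ℝ) + 1) ≤ 1 := fun n =>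
    ⟨by positivity, by rw [div_le_one (by positivity)]; linarith [n.cast_nonneg (α := ℝ)]⟩
  -- The integrals over [1/(n+1), 1] are uniformly bounded: the primitive is nonnegative at the left
  -- endpoint by `hBle`, and the subtracted term at 1 is nonnegative by `hB0`.
  refine integrableOn_Ioc_of_intervalIntegral_norm_bounded_left (l := atTop)
    (I := α⁻¹ * ∫ y in (0 : ℝ)..1, y * ‖h y‖) (fun n => ?_) hlim (Eventually.of_forall fun n => ?_)
  · exact (intervalIntegrable_iff_integrableOn_Ioc_of_le (hn n).2).1
      (hP' _ (hn n).1 1 (Set.mem_Ioi.2 one_pos)).1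
  · set a := 1 / ((n : ℝ) + 1)
    obtain ⟨ha0, ha1⟩ := hn n
    obtain ⟨hi1, he1⟩ := hP a ha0 1 (Set.mem_Ioi.2 one_pos)
    rw [← intervalIntegral.integral_of_le ha1]
    calc _ ≤ ∫ x in a..1, x ^ (-α - 1) * ∫ y in (0 : ℝ)..x, y ^ (α + 1) * ‖h y‖ := by
          refine intervalIntegral.integral_mono_on ha1
            (hP' a ha0 1 (Set.mem_Ioi.2 one_pos)).1.norm hi1 fun x hx => ?_
          have hx0 : 0 < x := ha0.trans_le hx.1
          rw [norm_mul, RCLike.norm_ofReal, abs_of_nonneg (Real.rpow_nonneg hx0.le _)]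
          gcongr
          refine (intervalIntegral.norm_integral_le_integral_norm hx0.le).trans (le_of_eq ?_)
          refine intervalIntegral.integral_congr fun y hy => ?_
          rw [Set.uIcc_of_le hx0.le] at hy
          simp only [norm_mul, RCLike.norm_ofReal, abs_of_nonneg (Real.rpow_nonneg hy.1 _)]
      _ = _ := he1.symm
      _ ≤ α⁻¹ * (∫ y in (0 : ℝ)..1, y * ‖h y‖) - 0 := by
          refine sub_le_sub ?_ (mul_nonneg (by positivity) (sub_nonneg.2 (hBle a ha0)))
          refine mul_le_mul_of_nonneg_left ?_ (by positivity)
          have := hB0 1 one_pos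
          simpa using this
      _ = _ := sub_zero _

end Hardy

/-! ### The Volterra equation for the regular solution. -/

lemma normConst_pos {l : ℝ} (hl : -(1 / 2) < l) : 0 < normConst l := by
  have : 0 < Real.Gamma (l + 3 / 2) := Real.Gamma_pos_of_pos (by linarith)
  have := Real.pi_pos
  unfold normConst
  positivity

/-- The Volterra kernel of the equation for `x^{-l-1} φ(z,x)`. -/
def regKernel (l : ℝ) (q : ℝ → ℝ) (z : ℂ) (x y : ℝ) : ℂ :=
  (Set.Ioc 0 x).indicator
    (fun y => (((2 * l + 1)⁻¹ * (1 - (y / x) ^ (2 * l + 1)) : ℝ) : ℂ) * ((y : ℂ) * (q y - z))) y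

/-- A weight dominating `regKernel l q z` for `‖z‖ ≤ R`. -/
def regWeight (l : ℝ) (q : ℝ → ℝ) (R : ℝ) (y : ℝ) : ℝ := (2 * l + 1)⁻¹ * (y * |q y| + R * y)

/-- The total mass of `regWeight l q R` on `(0,x]`. -/
def regMass (l : ℝ) (q : ℝ → ℝ) (R : ℝ) (x : ℝ) : ℝ := ∫ t in (0 : ℝ)..x, regWeight l q R t

/-- The solution `x^{-l-1} φ(z,x) / C_l` of the Volterra equation. -/
def regProfile (l : ℝ) (q : ℝ → ℝ) (z : ℂ) : ℝ → ℂ := volterraSol (regKernel l q z)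

/-- The derivative of `regProfile`. -/
def regProfileDeriv (l : ℝ) (q : ℝ → ℝ) (z : ℂ) (x : ℝ) : ℂ :=
  ((x ^ (-(2 * l + 1) - 1) : ℝ) : ℂ) * ∫ y in (0 : ℝ)..x, ((y ^ (2 * l + 1 + 1) : ℝ) : ℂ) *
    ((q y - z) * regProfile l q z y)

/-- The regular solution, constructed from the Volterra equation. -/
def regSol (l : ℝ) (q : ℝ → ℝ) (z : ℂ) (x : ℝ) : ℂ :=
  ((normConst l * x ^ (l + 1) : ℝ) : ℂ) * regProfile l q z x

/-- The derivative of `regSol`. -/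
def regSolDeriv (l : ℝ) (q : ℝ → ℝ) (z : ℂ) (x : ℝ) : ℂ :=
  (normConst l : ℂ) * (((l + 1) * x ^ l : ℝ) * regProfile l q z x +
    ((x ^ (l + 1) : ℝ) : ℂ) * regProfileDeriv l q z x)

/-- The standing assumptions on the angular momentum and the potential. -/
structure Admissible (l : ℝ) (q : ℝ → ℝ) : Prop where
  lower : -(1 / 2) < l
  loc : LocallyIntegrableOn q (Set.Ioi 0)
  int : IntegrableOn (fun x => x * |q x|) (Set.Ioi 0)

namespace Admissible

variable {l : ℝ} {q : ℝ → ℝ}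

lemma two_mul_add_one_pos (h : Admissible l q) : 0 < 2 * l + 1 := by linarith [h.lower]

lemma meas (h : Admissible l q) : AEStronglyMeasurable q (volume.restrict (Set.Ioi 0)) :=
  h.loc.aestronglyMeasurable

lemma integrableOn_regWeight (h : Admissible l q) (R x : ℝ) :
    IntegrableOn (regWeight l q R) (Set.Ioc 0 x) := by
  refine Integrable.const_mul (Integrable.add (h.int.mono_set fun _ hy => hy.1) ?_) _
  exact (Continuous.integrableOn_Icc (by fun_prop)).mono_set Set.Ioc_subset_Icc_self

lemma regWeight_nonneg (h : Admissible l q) {R : ℝ} (hR : 0 ≤ R) {y : ℝ} (hy : 0 < y) :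
    0 ≤ regWeight l q R y := by
  have := h.two_mul_add_one_pos
  unfold regWeight
  positivity

lemma norm_sub_mul_le (h : Admissible l q) {R : ℝ} {z : ℂ} (hz : ‖z‖ ≤ R) {y : ℝ} (hy : 0 < y) :
    ‖(y : ℂ) * (q y - z)‖ ≤ (2 * l + 1) * regWeight l q R y := by
  have h3 : ‖(q y : ℂ) - z‖ ≤ |q y| + R := by
    refine (norm_sub_le _ _).trans ?_
    rw [Complex.norm_real, Real.norm_eq_abs]
    linarith
  have hα := h.two_mul_add_one_pos
  rw [norm_mul, Complex.norm_real, Real.norm_of_nonneg hy.le, regWeight,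
    mul_inv_cancel_left₀ hα.ne']
  calc _ ≤ y * (|q y| + R) := by gcongr
    _ = _ := by ring

/-- The factor 1 - (y/x)^{2l+1} lies in [0,1] because 2l+1 > 0. The weight depends on z only through
the bound `R`, which is what holomorphy in z needs. -/
lemma isVolterraKernel (h : Admissible l q) {R : ℝ} {z : ℂ} (hz : ‖z‖ ≤ R) :
    IsVolterraKernel (regKernel l q z) (fun x => Set.Ioc 0 x) (regWeight l q R)
      (regMass l q R) := by
  have hα := h.two_mul_add_one_pos
  have hR : 0 ≤ R := (norm_nonneg z).trans hz
  refine isVolterraKernel_of_Ioc (fun x _ => ?_) (fun x₀ hx₀ => ?_) (fun x hx y hy => ?_)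
    (fun y hy => h.regWeight_nonneg hR hy) (fun x _ => h.integrableOn_regWeight R x)
  · refine AEStronglyMeasurable.indicator ?_ measurableSet_Ioc
    refine AEStronglyMeasurable.mul ?_ ?_
    · refine Complex.continuous_ofReal.comp_aestronglyMeasurable
        (Continuous.aestronglyMeasurable ?_)
      exact continuous_const.mul (continuous_const.sub
        ((Real.continuous_rpow_const hα.le).comp (continuous_id.div_const x)))
    · refine Complex.continuous_ofReal.aestronglyMeasurable.mul ?_
      exact (Complex.continuous_ofReal.comp_aestronglyMeasurable h.meas).sub
        aestronglyMeasurable_const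
  · have hne : ∀ᵐ y ∂(volume.restrict (Set.Ioi (0 : ℝ))), y ≠ x₀ :=
      ae_restrict_of_ae (by simp [ae_iff, measure_singleton])
    filter_upwards [hne, ae_restrict_mem measurableSet_Ioi] with y hy hy0
    rcases lt_or_gt_of_ne hy with h | h
    · have : ContinuousAt (fun x : ℝ => (((2 * l + 1)⁻¹ * (1 - (y / x) ^ (2 * l + 1)) : ℝ) : ℂ) *
          ((y : ℂ) * (q y - z))) x₀ := by
        refine ContinuousAt.mul ?_ continuousAt_const
        refine Complex.continuous_ofReal.continuousAt.comp ?_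
        refine continuousAt_const.mul (continuousAt_const.sub ?_)
        exact (continuousAt_const.div continuousAt_id hx₀.ne').rpow_const (Or.inr hα.le)
      refine this.congr ?_
      filter_upwards [lt_mem_nhds h] with x hx
      rw [regKernel, Set.indicator_of_mem (Set.mem_Ioc.2 ⟨hy0, hx.le⟩)]
    · refine (continuousAt_const (y := (0 : ℂ))).congr ?_
      filter_upwards [gt_mem_nhds h] with x hx
      rw [regKernel, Set.indicator_of_notMem fun hh => absurd hh.2 (not_le.2 hx)]
  · rw [regKernel]
    by_cases hyx : y ∈ Set.Ioc 0 x
    · rw [Set.indicator_of_mem hyx, Set.indicator_of_mem hyx, norm_mul, Complex.norm_real]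
      have h0 : 0 ≤ (y / x) ^ (2 * l + 1) := by positivity
      have h1 : (y / x) ^ (2 * l + 1) ≤ 1 :=
        Real.rpow_le_one (by positivity) ((div_le_one hx).2 hyx.2) hα.le
      have h2 : ‖(2 * l + 1)⁻¹ * (1 - (y / x) ^ (2 * l + 1))‖ ≤ (2 * l + 1)⁻¹ := by
        rw [Real.norm_of_nonneg (mul_nonneg (by positivity) (by linarith))]
        exact mul_le_of_le_one_right (by positivity) (by linarith)
      calc _ ≤ (2 * l + 1)⁻¹ * ((2 * l + 1) * regWeight l q R y) :=
            mul_le_mul h2 (h.norm_sub_mul_le hz hy) (norm_nonneg _) (by positivity)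
        _ = _ := inv_mul_cancel_left₀ hα.ne' _
    · rw [Set.indicator_of_notMem hyx, Set.indicator_of_notMem hyx, norm_zero]

lemma regMass_nonneg (h : Admissible l q) {R : ℝ} (hR : 0 ≤ R) {x : ℝ} (hx : 0 < x) :
    0 ≤ regMass l q R x := by
  rw [regMass, intervalIntegral.integral_of_le hx.le]
  exact setIntegral_nonneg measurableSet_Ioc fun y hy => h.regWeight_nonneg hR hy.1

lemma regMass_le (h : Admissible l q) {R : ℝ} {x : ℝ} (hx : 0 < x) :
    regMass l q R x ≤ (2 * l + 1)⁻¹ * ((∫ y in Set.Ioi 0, y * |q y|) + R * x ^ 2 / 2) := by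
  have hα := h.two_mul_add_one_pos
  have hi : IntervalIntegrable (fun y => y * |q y|) volume 0 x :=
    (intervalIntegrable_iff_integrableOn_Ioc_of_le hx.le).2 (h.int.mono_set fun _ hy => hy.1)
  simp only [regMass, regWeight]
  rw [intervalIntegral.integral_const_mul, intervalIntegral.integral_add hi
    (Continuous.intervalIntegrable (by fun_prop) _ _), intervalIntegral.integral_const_mul,
    integral_id]
  gcongr
  · rw [intervalIntegral.integral_of_le hx.le]
    refine setIntegral_mono_set h.int ?_ (Eventually.of_forall fun y hy => hy.1)
    rw [EventuallyLE, ae_restrict_iff' measurableSet_Ioi]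
    exact Eventually.of_forall fun t (ht : 0 < t) => by positivity
  · exact le_of_eq (by ring)

lemma tendsto_regMass (h : Admissible l q) (R : ℝ) :
    Tendsto (regMass l q R) (𝓝[>] 0) (𝓝 0) :=
  tendsto_integral_zero one_pos (h.integrableOn_regWeight R 1)

lemma norm_regProfile_le (h : Admissible l q) {R : ℝ} {z : ℂ} (hz : ‖z‖ ≤ R) {x : ℝ}
    (hx : 0 < x) : ‖regProfile l q z x‖ ≤ Real.exp (regMass l q R x) :=
  (h.isVolterraKernel hz).norm_sol_le hx

lemma norm_source_le (h : Admissible l q) {R : ℝ} {z : ℂ} (hz : ‖z‖ ≤ R) {x y : ℝ} (hy : 0 < y)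
    (hyx : y ≤ x) : ‖(y : ℂ) * ((q y - z) * regProfile l q z y)‖ ≤
      (2 * l + 1) * regWeight l q R y * Real.exp (regMass l q R x) := by
  have hα := h.two_mul_add_one_pos
  have := h.regWeight_nonneg ((norm_nonneg z).trans hz) hy
  rw [← mul_assoc, norm_mul]
  gcongr
  · exact h.norm_sub_mul_le hz hy
  · refine (h.norm_regProfile_le hz hy).trans (Real.exp_le_exp.2 ?_)
    exact (h.isVolterraKernel hz).majorant_mono x (hy.trans_le hyx) y ⟨hy, hyx⟩

lemma integrableOn_source (h : Admissible l q) (z : ℂ) (x : ℝ) (_ : 0 < x) :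
    IntegrableOn (fun y : ℝ => (y : ℂ) * ((q y - z) * regProfile l q z y)) (Set.Ioc 0 x) := by
  refine Integrable.mono' (g := fun y => (2 * l + 1) * regWeight l q ‖z‖ y *
    Real.exp (regMass l q ‖z‖ x)) (((h.integrableOn_regWeight ‖z‖ x).const_mul _).mul_const _) ?_ ?_
  · refine Complex.continuous_ofReal.aestronglyMeasurable.mul (AEStronglyMeasurable.mul ?_ ?_)
    · exact ((Complex.continuous_ofReal.comp_aestronglyMeasurable h.meas).sub
        aestronglyMeasurable_const).mono_measure (Measure.restrict_mono (fun _ hy => hy.1) le_rfl)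
    · exact ((h.isVolterraKernel (z := z) le_rfl).sol_continuousOn.mono
        fun _ hy => hy.1).aestronglyMeasurable measurableSet_Ioc
  · rw [ae_restrict_iff' measurableSet_Ioc]
    exact Eventually.of_forall fun y hy => h.norm_source_le le_rfl hy.1 hy.2

/-- Splitting the kernel brings the Volterra equation to the form of `isPrimitiveOn_hardy`, from
which the derivatives of the profile are read off. -/
lemma regProfile_eq (h : Admissible l q) (z : ℂ) {x : ℝ} (hx : 0 < x) :
    regProfile l q z x = 1 + (((2 * l + 1)⁻¹ : ℝ) : ℂ) *
      ((∫ y in (0 : ℝ)..x, (y : ℂ) * ((q y - z) * regProfile l q z y)) -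
        ((x ^ (-(2 * l + 1)) : ℝ) : ℂ) * ∫ y in (0 : ℝ)..x, ((y ^ (2 * l + 1 + 1) : ℝ) : ℂ) *
          ((q y - z) * regProfile l q z y)) := by
  have hα := h.two_mul_add_one_pos
  rw [regProfile, (h.isVolterraKernel le_rfl).sol_eq hx, ← regProfile]
  congr 1
  have e : ∀ y, regKernel l q z x y * regProfile l q z y = (Set.Ioc 0 x).indicator (fun y : ℝ =>
      (((2 * l + 1)⁻¹ : ℝ) : ℂ) * ((y : ℂ) * ((q y - z) * regProfile l q z y) -
        ((x ^ (-(2 * l + 1)) : ℝ) : ℂ) * (((y ^ (2 * l + 1 + 1) : ℝ) : ℂ) *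
          ((q y - z) * regProfile l q z y)))) y := by
    intro y
    rw [regKernel]
    by_cases hy : y ∈ Set.Ioc 0 x
    · rw [Set.indicator_of_mem hy, Set.indicator_of_mem hy, Real.div_rpow hy.1.le hx.le,
        Real.rpow_neg hx.le, Real.rpow_add_one hy.1.ne' (2 * l + 1)]
      push_cast
      ring
    · rw [Set.indicator_of_notMem hy, Set.indicator_of_notMem hy, zero_mul]
  simp_rw [e]
  have hi := h.integrableOn_source z
  have hi2 : IntegrableOn (fun y : ℝ => ((y ^ (2 * l + 1 + 1) : ℝ) : ℂ) *
      ((q y - z) * regProfile l q z y)) (Set.Ioc 0 x) := integrableOn_rpow_succ_mul hα hi hx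
  rw [setIntegral_indicator measurableSet_Ioc, Set.inter_eq_self_of_subset_right
    (show Set.Ioc 0 x ⊆ Set.Ioi 0 from fun _ hy => hy.1), integral_const_mul, integral_sub (hi x hx)
    (hi2.const_mul _), integral_const_mul,
    intervalIntegral.integral_of_le hx.le, intervalIntegral.integral_of_le hx.le]

lemma isPrimitiveOn_regProfile (h : Admissible l q) (z : ℂ) :
    IsPrimitiveOn (Set.Ioi 0) (regProfile l q z) (regProfileDeriv l q z) :=
  ((isPrimitiveOn_hardy h.two_mul_add_one_pos (h.integrableOn_source z)).const_add 1).congr_left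
    fun _ hx => (h.regProfile_eq z hx).symm

lemma isPrimitiveOn_regProfileDeriv (h : Admissible l q) (z : ℂ) :
    IsPrimitiveOn (Set.Ioi 0) (regProfileDeriv l q z) (fun x => (q x - z) * regProfile l q z x -
      (((2 * l + 2) / x : ℝ) : ℂ) * regProfileDeriv l q z x) := by
  have hα := h.two_mul_add_one_pos
  have hB := isPrimitiveOn_integral_zero
    fun x hx => integrableOn_rpow_succ_mul hα (h.integrableOn_source z) hx
  refine ((isPrimitiveOn_cast_rpow (-(2 * l + 1) - 1)).mul hB).congr fun x hx => ?_
  have hx' : (0 : ℝ) < x := hx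
  have h1 : x ^ (-(2 * l + 1) - 1) * x ^ (2 * l + 1 + 1) = 1 := by
    rw [← Real.rpow_add hx']
    convert Real.rpow_zero x using 2
    ring
  have h2 : ((x ^ (-(2 * l + 1) - 1) : ℝ) : ℂ) * ((x ^ (2 * l + 1 + 1) : ℝ) : ℂ) = 1 := by
    rw [← Complex.ofReal_mul, h1, Complex.ofReal_one]
  have hxc : (x : ℂ) ≠ 0 := by exact_mod_cast hx'.ne'
  rw [Real.rpow_sub_one hx'.ne' (-(2 * l + 1) - 1), regProfileDeriv]
  push_cast at h2 ⊢
  linear_combination (q x - z) * regProfile l q z x * h2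

lemma norm_mul_regProfileDeriv_le (h : Admissible l q) {R : ℝ} {z : ℂ} (hz : ‖z‖ ≤ R) {x : ℝ}
    (hx : 0 < x) : x * ‖regProfileDeriv l q z x‖ ≤
      (2 * l + 1) * regMass l q R x * Real.exp (regMass l q R x) := by
  have hα := h.two_mul_add_one_pos
  have h1 := norm_integral_rpow_succ_mul_le hα (h.integrableOn_source z) hx
  have h2 : ∫ y in (0 : ℝ)..x, ‖(y : ℂ) * ((q y - z) * regProfile l q z y)‖ ≤
      (2 * l + 1) * regMass l q R x * Real.exp (regMass l q R x) := by
    rw [regMass, ← intervalIntegral.integral_const_mul, ← intervalIntegral.integral_mul_const,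
      intervalIntegral.integral_of_le hx.le, intervalIntegral.integral_of_le hx.le]
    refine setIntegral_mono_on (h.integrableOn_source z x hx).norm
      (((h.integrableOn_regWeight R x).const_mul _).mul_const _) measurableSet_Ioc fun y hy => ?_
    exact h.norm_source_le hz hy.1 hy.2
  rw [regProfileDeriv, norm_mul, Complex.norm_real,
    Real.norm_of_nonneg (Real.rpow_nonneg hx.le _)]
  calc _ ≤ x * (x ^ (-(2 * l + 1) - 1) * (x ^ (2 * l + 1) *
        ((2 * l + 1) * regMass l q R x * Real.exp (regMass l q R x)))) := by
        gcongr
        exact h1.trans (mul_le_mul_of_nonneg_left h2 (by positivity))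
    _ = (x * (x ^ (-(2 * l + 1) - 1) * x ^ (2 * l + 1))) *
        ((2 * l + 1) * regMass l q R x * Real.exp (regMass l q R x)) := by ring
    _ = _ := by
        rw [← Real.rpow_add hx]
        have : -(2 * l + 1) - 1 + (2 * l + 1) = -1 := by ring
        rw [this, Real.rpow_neg_one, mul_inv_cancel₀ hx.ne', one_mul]

lemma isPrimitiveOn_regSol (h : Admissible l q) (z : ℂ) :
    IsPrimitiveOn (Set.Ioi 0) (regSol l q z) (regSolDeriv l q z) := by
  refine ((((isPrimitiveOn_cast_rpow (l + 1)).mul (h.isPrimitiveOn_regProfile z)).const_mul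
    (normConst l : ℂ)).congr_left fun x _ => ?_).congr fun x _ => ?_
  · simp only [regSol]
    push_cast
    ring
  · rw [regSolDeriv, add_sub_cancel_right]

lemma isPrimitiveOn_regSolDeriv (h : Admissible l q) (z : ℂ) :
    IsPrimitiveOn (Set.Ioi 0) (regSolDeriv l q z)
      (fun x => ((effPotential l q x : ℂ) - z) * regSol l q z x) := by
  refine ((((((isPrimitiveOn_cast_rpow l).const_mul ((l + 1 : ℝ) : ℂ)).mul
    (h.isPrimitiveOn_regProfile z)).add ((isPrimitiveOn_cast_rpow (l + 1)).mul
    (h.isPrimitiveOn_regProfileDeriv z))).const_mul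
    (normConst l : ℂ)).congr_left fun x _ => ?_).congr fun x hx => ?_
  · simp only [regSolDeriv]
    push_cast
    ring
  · have hx' : (0 : ℝ) < x := hx
    have hxc : (x : ℂ) ≠ 0 := by exact_mod_cast hx'.ne'
    have e1 : x ^ l = x ^ (l - 1) * x := by
      rw [← Real.rpow_add_one hx'.ne', sub_add_cancel]
    have e2 : x ^ (l + 1) = x ^ (l - 1) * x * x := by
      rw [Real.rpow_add_one hx'.ne', e1]
    rw [add_sub_cancel_right, regSol, effPotential, e2, e1]
    push_cast
    field_simp
    ring

lemma hasDerivAt_regSol (h : Admissible l q) (z : ℂ) {x : ℝ} (hx : 0 < x) :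
    HasDerivAt (regSol l q z) (regSolDeriv l q z x) x :=
  (h.isPrimitiveOn_regSol z).hasDerivAt isOpen_Ioi (fun _ hy =>
    ((h.isPrimitiveOn_regSolDeriv z).continuousAt isOpen_Ioi hy).continuousWithinAt) hx

lemma isSolution_regSol (h : Admissible l q) (z : ℂ) : IsSolution l q z (regSol l q z) :=
  isSolution_of_isPrimitiveOn (fun _ hx => h.hasDerivAt_regSol z hx)
    (h.isPrimitiveOn_regSolDeriv z)

lemma tendsto_regProfile (h : Admissible l q) (z : ℂ) :
    Tendsto (regProfile l q z) (𝓝[>] 0) (𝓝 1) := by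
  rw [tendsto_iff_norm_sub_tendsto_zero]
  have hQ := h.tendsto_regMass ‖z‖
  have hb : Tendsto (fun x => regMass l q ‖z‖ x * Real.exp (regMass l q ‖z‖ x)) (𝓝[>] 0)
      (𝓝 (0 * Real.exp 0)) := hQ.mul ((Real.continuous_exp.tendsto 0).comp hQ)
  rw [zero_mul] at hb
  refine squeeze_zero' (Eventually.of_forall fun _ => norm_nonneg _) ?_ hb
  filter_upwards [self_mem_nhdsWithin] with x hx
  exact (h.isVolterraKernel le_rfl).norm_sol_sub_one_le hx

lemma tendsto_mul_regProfileDeriv (h : Admissible l q) (z : ℂ) :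
    Tendsto (fun x : ℝ => (x : ℂ) * regProfileDeriv l q z x) (𝓝[>] 0) (𝓝 0) := by
  have hQ := h.tendsto_regMass ‖z‖
  have hb : Tendsto (fun x => (2 * l + 1) * regMass l q ‖z‖ x * Real.exp (regMass l q ‖z‖ x))
      (𝓝[>] 0) (𝓝 ((2 * l + 1) * 0 * Real.exp 0)) :=
    (hQ.const_mul _).mul ((Real.continuous_exp.tendsto 0).comp hQ)
  rw [mul_zero, zero_mul] at hb
  refine squeeze_zero_norm' ?_ hb
  filter_upwards [self_mem_nhdsWithin] with x hx
  rw [norm_mul, Complex.norm_real, Real.norm_of_nonneg (le_of_lt hx)]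
  exact h.norm_mul_regProfileDeriv_le le_rfl hx

/-- The required density is the derivative of the profile, integrable by `integrableOn_hardy`; the
value 1 at the origin comes from the limit of the profile. -/
lemma isRegularSolution_regSol (h : Admissible l q) (z : ℂ) :
    IsRegularSolution l q z (regSol l q z) := by
  have hi : IntegrableOn (regProfileDeriv l q z) (Set.Ioc 0 1) :=
    integrableOn_hardy h.two_mul_add_one_pos (h.integrableOn_source z)
  refine ⟨h.isSolution_regSol z, regProfileDeriv l q z, hi, fun x hx => ?_⟩
  rw [regSol]
  congr 1
  have hii : IntervalIntegrable (regProfileDeriv l q z) volume 0 x :=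
    (intervalIntegrable_iff_integrableOn_Ioc_of_le hx.1.le).2
      (hi.mono_set (Set.Ioc_subset_Ioc_right hx.2))
  have hp := isPrimitiveOn_integral hx.1.le hii
  have h0' := tendsto_integral_zero one_pos hi
  have hl := (h.tendsto_regProfile z).add (h0'.const_sub (∫ t in (0 : ℝ)..x, regProfileDeriv l q z t))
  rw [sub_zero] at hl
  refine tendsto_nhds_unique (tendsto_const_nhds.congr' ?_) hl
  filter_upwards [Ioc_mem_nhdsGT hx.1] with a ha
  have e1 := (h.isPrimitiveOn_regProfile z a ha.1 x hx.1).2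
  have e2 := (hp a ⟨ha.1.le, ha.2⟩ x ⟨hx.1.le, le_rfl⟩).2
  rw [e2, ← e1]; ring

/-- For fixed `x`, the regular solution is an entire function of the energy. -/
lemma differentiable_regSol (h : Admissible l q) {x : ℝ} (hx : 0 < x) :
    Differentiable ℂ (fun z => regSol l q z x) := by
  intro z₀
  have hd : DifferentiableOn ℂ (fun z => volterraSol (regKernel l q z) x)
      (Metric.ball 0 (‖z₀‖ + 1)) := by
    refine IsVolterraKernel.differentiableOn_sol Metric.isOpen_ball
      (fun z hz => h.isVolterraKernel (R := ‖z₀‖ + 1) ?_) (fun x _ y _ => ?_) hx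
    · rw [mem_ball_zero_iff] at hz
      exact hz.le
    · by_cases hy : y ∈ Set.Ioc 0 x
      · simp only [regKernel, Set.indicator_of_mem hy]
        fun_prop
      · simp only [regKernel, Set.indicator_of_notMem hy]
        fun_prop
  have := hd.differentiableAt (Metric.isOpen_ball.mem_nhds (by simp : z₀ ∈ Metric.ball 0 (‖z₀‖ + 1)))
  exact this.const_mul _

end Admissible

/-! ### Uniqueness of the regular solution -/

/-- Gronwall's inequality for |d| + |d'| with initial value 0. -/
lemma eq_zero_of_initial {d d' V : ℝ → ℂ} (hd : IsPrimitiveOn (Set.Ioi 0) d d')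
    (hd' : IsPrimitiveOn (Set.Ioi 0) d' (fun x => V x * d x))
    (hV : ∀ a > 0, ∀ b > 0, IntervalIntegrable V volume a b) {a x : ℝ} (ha : 0 < a) (hax : a ≤ x)
    (h0 : d a = 0) (h0' : d' a = 0) : d x = 0 := by
  have hx : 0 < x := ha.trans_le hax
  have hc := hd.continuousOn ha hx
  have hc' := hd'.continuousOn ha hx
  rw [Set.uIcc_of_le hax] at hc hc'
  have hw : IntervalIntegrable (fun t => 1 + ‖V t‖) volume a x :=
    intervalIntegrable_const.add (hV a ha x hx).norm
  have key := gronwall (v := fun t => ‖d t‖ + ‖d' t‖) (w := fun t => 1 + ‖V t‖) (A := 0) hax le_rfl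
    hw (fun t _ => by positivity) (hc.norm.add hc'.norm) ?_ x ⟨hax, le_rfl⟩
  · rw [zero_mul] at key
    exact norm_le_zero_iff.1 (by linarith [norm_nonneg (d' x)])
  · intro t ht
    have ht0 : 0 < t := ha.trans_le ht.1
    have hsub : Set.Icc a t ⊆ Set.Icc a x := Set.Icc_subset_Icc_right ht.2
    obtain ⟨i1, e1⟩ := hd a ha t ht0
    obtain ⟨i2, e2⟩ := hd' a ha t ht0
    rw [h0, sub_zero] at e1
    rw [h0', sub_zero] at e2
    have hi : IntervalIntegrable (fun s => (1 + ‖V s‖) * (‖d s‖ + ‖d' s‖)) volume a t := by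
      refine IntervalIntegrable.mul_continuousOn (hw.mono_set ?_) ?_
      · rw [Set.uIcc_of_le hax, Set.uIcc_of_le ht.1]; exact hsub
      · rw [Set.uIcc_of_le ht.1]; exact (hc.norm.add hc'.norm).mono hsub
    rw [zero_add, e1, e2]
    calc _ ≤ (∫ s in a..t, ‖d' s‖) + ∫ s in a..t, ‖V s * d s‖ :=
          add_le_add (intervalIntegral.norm_integral_le_integral_norm ht.1)
            (intervalIntegral.norm_integral_le_integral_norm ht.1)
      _ = ∫ s in a..t, (‖d' s‖ + ‖V s * d s‖) := (intervalIntegral.integral_add i1.norm i2.norm).symm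
      _ ≤ _ := by
          refine intervalIntegral.integral_mono_on ht.1 (i1.norm.add i2.norm) hi fun s _ => ?_
          rw [norm_mul]
          nlinarith [norm_nonneg (d s), norm_nonneg (d' s), norm_nonneg (V s),
            mul_nonneg (norm_nonneg (V s)) (norm_nonneg (d' s))]

/-- A derivative of at least c/x makes ρ - c log x increasing near 0, hence bounded above there,
whereas a finite limit of ρ would send it to +∞. -/
lemma log_unbounded_below_of_deriv_ge {ρ ρ' : ℝ → ℝ} {c δ : ℝ} (hc : 0 < c) (hδ : 0 < δ)
    (hd : ∀ x ∈ Set.Ioo 0 δ, HasDerivAt ρ (ρ' x) x) (hρ : ∀ x ∈ Set.Ioo 0 δ, c * x⁻¹ ≤ ρ' x)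
    {L : ℝ} (hL : Tendsto ρ (𝓝[>] 0) (𝓝 L)) : False := by
  have hd2 : ∀ x ∈ Set.Ioo 0 δ, HasDerivAt (fun x => ρ x - c * Real.log x) (ρ' x - c * x⁻¹) x :=
    fun x hx => (hd x hx).sub ((Real.hasDerivAt_log hx.1.ne').const_mul c)
  have hmono : MonotoneOn (fun x => ρ x - c * Real.log x) (Set.Ioo 0 δ) := by
    refine monotoneOn_of_deriv_nonneg (convex_Ioo 0 δ)
      (fun x hx => (hd2 x hx).continuousAt.continuousWithinAt)
      (fun x hx => ?_) fun x hx => ?_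
    · rw [interior_Ioo] at hx
      exact (hd2 x hx).differentiableAt.differentiableWithinAt
    · rw [interior_Ioo] at hx
      rw [(hd2 x hx).deriv]
      linarith [hρ x hx]
  have hlog : Tendsto (fun x => ρ x - c * Real.log x) (𝓝[>] 0) atTop := by
    have h1 : Tendsto (fun x => -(c * Real.log x)) (𝓝[>] 0) atTop :=
      tendsto_neg_atBot_atTop.comp (Real.tendsto_log_nhdsGT_zero.const_mul_atBot hc)
    simpa [sub_eq_add_neg] using hL.add_atTop h1
  have hbd : ∀ᶠ x in 𝓝[>] (0 : ℝ), ρ x - c * Real.log x ≤ ρ (δ / 2) - c * Real.log (δ / 2) := by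
    filter_upwards [Ioo_mem_nhdsGT (half_pos hδ)] with x hx
    exact hmono ⟨hx.1, hx.2.trans (half_lt_self hδ)⟩ ⟨half_pos hδ, half_lt_self hδ⟩ hx.2.le
  obtain ⟨x, h1, h2⟩ := (hbd.and (hlog.eventually_gt_atTop _)).exists
  exact absurd h2 (not_lt.2 h1)

namespace Admissible

variable {l : ℝ} {q : ℝ → ℝ}

/-- The regular solution is unique on the half-line. -/
lemma eq_regSol (h : Admissible l q) {z : ℂ} {y : ℝ → ℂ} (hy : IsRegularSolution l q z y) {x : ℝ}
    (hx : 0 < x) : y x = regSol l q z x := by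
  obtain ⟨hys, g, hg, hyg⟩ := hy
  have hC := normConst_pos h.lower
  have hφs := h.isSolution_regSol z
  set W := wronskian (regSol l q z) y 1 with hW
  have hWc : ∀ x > 0, wronskian (regSol l q z) y x = W := fun x hx =>
    hφs.wronskian_eq hys h.loc one_pos hx
  have hvlim : Tendsto (fun x => 1 + ∫ t in (0 : ℝ)..x, g t) (𝓝[>] 0) (𝓝 1) := by
    have h0' := tendsto_integral_zero one_pos hg
    simpa using h0'.const_add 1
  have hulim := h.tendsto_regProfile z
  have hinv : Tendsto (fun x => ((regProfile l q z x ^ 2)⁻¹).re) (𝓝[>] 0) (𝓝 1) := by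
    have := (hulim.pow 2).inv₀ (by simp)
    have := (Complex.continuous_re.tendsto _).comp this
    rwa [one_pow, inv_one, Complex.one_re] at this
  have hev : ∀ᶠ x in 𝓝[>] (0 : ℝ), regProfile l q z x ≠ 0 ∧
      1 / 2 < ((regProfile l q z x ^ 2)⁻¹).re ∧ x < 1 := by
    filter_upwards [hulim.eventually_ne one_ne_zero, hinv.eventually (lt_mem_nhds one_half_lt_one),
      Ioo_mem_nhdsGT zero_lt_one] with x h1 h2 h3 using ⟨h1, h2, h3.2⟩
  obtain ⟨δ, hδ, hδs⟩ := mem_nhdsGT_iff_exists_Ioo_subset.1 hev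
  have hδ0 : 0 < δ := hδ
  have hφne : ∀ x ∈ Set.Ioo 0 δ, regSol l q z x ≠ 0 := by
    intro x hx
    refine mul_ne_zero ?_ (hδs hx).1
    exact_mod_cast (mul_pos hC (Real.rpow_pos_of_pos hx.1 _)).ne'
  have hrd : ∀ x ∈ Set.Ioo 0 δ, HasDerivAt (fun x => y x / regSol l q z x)
      (W / regSol l q z x ^ 2) x := by
    intro x hx
    have h1 := ((hys.1 x hx.1).hasDerivAt).div (h.hasDerivAt_regSol z hx.1) (hφne x hx)
    refine h1.congr_deriv ?_
    rw [← hWc x hx.1, wronskian, (h.hasDerivAt_regSol z hx.1).deriv]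
    ring
  have hrlim : Tendsto (fun x => y x / regSol l q z x) (𝓝[>] 0) (𝓝 1) := by
    have h1 := hvlim.div hulim one_ne_zero
    rw [div_one] at h1
    refine h1.congr' ?_
    filter_upwards [Ioo_mem_nhdsGT hδ0] with x hx
    have hne : ((normConst l * x ^ (l + 1) : ℝ) : ℂ) ≠ 0 := by
      exact_mod_cast (mul_pos hC (Real.rpow_pos_of_pos hx.1 _)).ne'
    simp only [Pi.div_apply]
    rw [hyg x ⟨hx.1, (hδs hx).2.2.le⟩, regSol, mul_div_mul_left _ _ hne]
  -- The quotient y/φ has derivative W/φ² and a finite limit at 0. Near 0 the real part of φ^{-2} is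
  -- at least a constant times x^{-2(l+1)}, which exceeds 1/x since 2(l+1) ≥ 1, so a nonzero W would
  -- force logarithmic divergence. The factor 1/2 in `c` is the lower bound for Re u^{-2} built into
  -- `δ`.
  have hW0 : W = 0 := by
    by_contra hne
    refine log_unbounded_below_of_deriv_ge (ρ := fun x => (y x / regSol l q z x / W).re)
      (ρ' := fun x => (W / regSol l q z x ^ 2 / W).re) (c := (normConst l ^ 2)⁻¹ * (1 / 2))
      (L := ((1 : ℂ) / W).re) (by positivity) hδ0 (fun x hx => ?_) (fun x hx => ?_) ?_
    · have := Complex.reCLM.hasFDerivAt.comp_hasDerivAt x ((hrd x hx).div_const W)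
      exact this
    · obtain ⟨_, h2, h3⟩ := hδs hx
      have e : W / regSol l q z x ^ 2 / W =
          (((normConst l ^ 2)⁻¹ * (x ^ (l + 1)) ^ (-2 : ℤ) : ℝ) : ℂ) * (regProfile l q z x ^ 2)⁻¹ := by
        rw [div_div, mul_comm, ← div_div, div_self hne, regSol]
        push_cast
        simp only [mul_pow, mul_inv, one_div, zpow_neg]
        norm_cast
      rw [e, Complex.re_ofReal_mul]
      have e3 : x⁻¹ ≤ (x ^ (l + 1)) ^ (-2 : ℤ) := by
        rw [← Real.rpow_intCast, ← Real.rpow_mul hx.1.le, ← Real.rpow_neg_one]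
        refine Real.rpow_le_rpow_of_exponent_ge hx.1 h3.le ?_
        push_cast
        linarith [h.lower]
      have hxp : 0 < (x ^ (l + 1)) ^ (-2 : ℤ) := zpow_pos (Real.rpow_pos_of_pos hx.1 _) _
      calc _ = (normConst l ^ 2)⁻¹ * x⁻¹ * (1 / 2) := by ring
        _ ≤ (normConst l ^ 2)⁻¹ * (x ^ (l + 1)) ^ (-2 : ℤ) * ((regProfile l q z x ^ 2)⁻¹).re := by
          have := hx.1
          gcongr
    · exact (Complex.continuous_re.tendsto _).comp (hrlim.div_const W)
  have heq : ∀ x ∈ Set.Ioo 0 δ, y x = regSol l q z x := by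
    intro x hx
    have hconst : ∀ᶠ t in 𝓝[>] (0 : ℝ), y x / regSol l q z x = y t / regSol l q z t := by
      filter_upwards [Ioo_mem_nhdsGT hδ0] with t ht
      have := (convex_Ioo 0 δ).norm_image_sub_le_of_norm_hasDerivWithin_le (C := 0)
        (fun s hs => (hrd s hs).hasDerivWithinAt) (fun s _ => by simp [hW0]) ht hx
      rw [zero_mul] at this
      exact sub_eq_zero.1 (norm_le_zero_iff.1 this)
    have h1 := tendsto_nhds_unique (tendsto_const_nhds.congr' hconst) hrlim
    exact (div_eq_one_iff_eq (hφne x hx)).1 h1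
  -- Beyond `δ` the difference vanishes because its Cauchy data at δ/2 vanish.
  by_cases hxδ : x < δ
  · exact heq x ⟨hx, hxδ⟩
  · have ha : δ / 2 ∈ Set.Ioo 0 δ := ⟨half_pos hδ0, half_lt_self hδ0⟩
    have hdd : deriv y (δ / 2) = regSolDeriv l q z (δ / 2) := by
      rw [← (h.hasDerivAt_regSol z ha.1).deriv]
      refine EventuallyEq.deriv_eq ?_
      filter_upwards [isOpen_Ioo.mem_nhds ha] with t ht using heq t ht
    refine sub_eq_zero.1 (eq_zero_of_initial (d := fun x => y x - regSol l q z x)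
      (d' := fun x => deriv y x - regSolDeriv l q z x) (V := fun x => (effPotential l q x : ℂ) - z)
      ((hys.isPrimitiveOn h.loc).sub (h.isPrimitiveOn_regSol z))
      (((hys.isPrimitiveOn_deriv h.loc).sub (h.isPrimitiveOn_regSolDeriv z)).congr
        fun x _ => by ring) (fun a ha b hb => ?_) ha.1 (ha.2.le.trans (not_lt.1 hxδ)) ?_ ?_)
    · have := intervalIntegrable_effPotential (l := l) h.loc ha hb
      exact IntervalIntegrable.sub ⟨this.1.ofReal, this.2.ofReal⟩ (by simp)
    · simp [heq _ ha]
    · simp [hdd]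

end Admissible

/-! ### Growth of solutions -/

/-- Variation of constants for p' = c p + F, with the largest admissible exponential growth
e^{η(x-a)} divided out so that Gronwall's inequality applies to the result. -/
lemma norm_le_of_linear {p F : ℝ → ℂ} {c : ℂ} {η : ℝ}
    (hp : IsPrimitiveOn (Set.Ioi 0) p (fun x => c * p x + F x))
    (hF : ∀ a > 0, ∀ b > 0, IntervalIntegrable F volume a b) (hη : c.re ≤ η) {a x : ℝ}
    (ha : 0 < a) (hax : a ≤ x) :
    Real.exp (-η * (x - a)) * ‖p x‖ ≤
      ‖p a‖ + ∫ t in a..x, Real.exp (-η * (t - a)) * ‖F t‖ := by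
  have hx : 0 < x := ha.trans_le hax
  have hE : IsPrimitiveOn (Set.Ioi 0) (fun t : ℝ => Complex.exp (-c * (t - a)))
      (fun t : ℝ => -c * Complex.exp (-c * (t - a))) := by
    refine IsPrimitiveOn.of_hasDerivAt (fun t _ => ?_) (by fun_prop)
    have := (((hasDerivAt_id (t : ℂ)).sub_const (a : ℂ)).const_mul (-c)).cexp.comp_ofReal
    simpa [mul_comm] using this
  have h1 := ((hE.mul hp).congr (g := fun t => Complex.exp (-c * (t - a)) * F t)
    fun t _ => by ring) a ha x hx
  have h2 : p x = Complex.exp (c * (x - a)) * p a +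
      ∫ t in a..x, Complex.exp (c * (x - t)) * F t := by
    have h3 := h1.2
    beta_reduce at h3
    rw [sub_self (a : ℂ), mul_zero, Complex.exp_zero, one_mul] at h3
    have h4 : ∫ t in a..x, Complex.exp (c * (x - t)) * F t =
        Complex.exp (c * (x - a)) * ∫ t in a..x, Complex.exp (-c * (t - a)) * F t := by
      rw [← intervalIntegral.integral_const_mul]
      congr 1
      ext t
      rw [← mul_assoc, ← Complex.exp_add]
      ring_nf
    have h5 : Complex.exp (c * (x - a)) * Complex.exp (-c * (x - a)) = 1 := by
      rw [← Complex.exp_add]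
      simp
    rw [h4, ← h3]
    linear_combination -(p x) * h5
  have hexp : ∀ t ≤ x, ‖Complex.exp (c * (x - t))‖ ≤ Real.exp (η * (x - t)) := by
    intro t ht
    rw [Complex.norm_exp]
    have : (c * ((x : ℂ) - t)).re = c.re * (x - t) := by simp
    rw [this]
    exact Real.exp_le_exp.2 (mul_le_mul_of_nonneg_right hη (by linarith))
  have hi : IntervalIntegrable (fun t => Real.exp (η * (x - t)) * ‖F t‖) volume a x :=
    (hF a ha x hx).norm.continuousOn_mul (by fun_prop)
  have h5 : ‖p x‖ ≤ Real.exp (η * (x - a)) * ‖p a‖ +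
      ∫ t in a..x, Real.exp (η * (x - t)) * ‖F t‖ := by
    rw [h2]
    refine (norm_add_le _ _).trans (add_le_add ?_ ?_)
    · rw [norm_mul]
      gcongr
      exact hexp a hax
    · refine intervalIntegral.norm_integral_le_of_norm_le hax ?_ hi
      refine Eventually.of_forall fun t ht => ?_
      rw [norm_mul]
      gcongr
      exact hexp t ht.2
  calc _ ≤ Real.exp (-η * (x - a)) * (Real.exp (η * (x - a)) * ‖p a‖ +
      ∫ t in a..x, Real.exp (η * (x - t)) * ‖F t‖) := by gcongr
    _ = _ := by
      rw [mul_add, ← mul_assoc, ← Real.exp_add, ← intervalIntegral.integral_const_mul]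
      congr 1
      · have : -η * (x - a) + η * (x - a) = 0 := by ring
        rw [this, Real.exp_zero, one_mul]
      · congr 1
        ext t
        rw [← mul_assoc, ← Real.exp_add]
        ring_nf

/-- Growth of solutions of `y'' = (V - k²) y`, measured by `y' ± i k y`. -/
lemma norm_solution_le {V : ℝ → ℝ} {y y' : ℝ → ℂ} {k : ℂ} (hk : k ≠ 0)
    (hV : ∀ a > 0, ∀ b > 0, IntervalIntegrable V volume a b)
    (hy : IsPrimitiveOn (Set.Ioi 0) y y')
    (hy' : IsPrimitiveOn (Set.Ioi 0) y' (fun x => ((V x : ℂ) - k ^ 2) * y x)) {a x : ℝ}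
    (ha : 0 < a) (hax : a ≤ x) :
    ‖y' x‖ + ‖k‖ * ‖y x‖ ≤ Real.exp (|k.im| * (x - a)) * (2 * (‖y' a‖ + ‖k‖ * ‖y a‖)) *
      Real.exp (∫ t in a..x, |V t| / ‖k‖) := by
  have hx : 0 < x := ha.trans_le hax
  have hk1 : 0 < ‖k‖ := norm_pos_iff.2 hk
  have hFi : ∀ a > 0, ∀ b > 0, IntervalIntegrable (fun t => (V t : ℂ) * y t) volume a b := by
    intro a ha b hb
    refine IntervalIntegrable.mul_continuousOn ?_ (hy.continuousOn ha hb)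
    exact ⟨(hV a ha b hb).1.ofReal, (hV a ha b hb).2.ofReal⟩
  -- These combinations diagonalise the constant coefficient part: each satisfies a first order
  -- equation with coefficient ±ik and source V y. Moreover y = (p - m)/(2ik), so the source is at
  -- most |V|/|k| times (|p| + |m|)/2, and adding the two equations removes the 1/2.
  set p : ℝ → ℂ := fun x => y' x + Complex.I * k * y x with hp
  set m : ℝ → ℂ := fun x => y' x - Complex.I * k * y x with hm
  have hpp : IsPrimitiveOn (Set.Ioi 0) p (fun x => Complex.I * k * p x + V x * y x) :=
    (hy'.add (hy.const_mul (Complex.I * k))).congr fun x _ => by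
      rw [hp]; linear_combination (-k ^ 2 * y x) * Complex.I_sq
  have hmp : IsPrimitiveOn (Set.Ioi 0) m (fun x => -(Complex.I * k) * m x + V x * y x) :=
    (hy'.sub (hy.const_mul (Complex.I * k))).congr fun x _ => by
      rw [hm]; linear_combination (-k ^ 2 * y x) * Complex.I_sq
  set η := |k.im| with hη
  have hηp : (Complex.I * k).re ≤ η := by simp [hη, neg_le_abs]
  have hηm : (-(Complex.I * k)).re ≤ η := by simp [hη, le_abs_self]
  have hyN : ∀ t, ‖y t‖ ≤ (‖p t‖ + ‖m t‖) / (2 * ‖k‖) := by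
    intro t
    have e : 2 * Complex.I * k * y t = p t - m t := by rw [hp, hm]; ring
    have : 2 * ‖k‖ * ‖y t‖ = ‖p t - m t‖ := by rw [← e]; simp
    rw [le_div_iff₀ (by positivity)]
    calc _ = 2 * ‖k‖ * ‖y t‖ := by ring
      _ ≤ _ := by rw [this]; exact norm_sub_le _ _
  have hy'N : ‖y' x‖ ≤ (‖p x‖ + ‖m x‖) / 2 := by
    have e : 2 * y' x = p x + m x := by rw [hp, hm]; ring
    have : 2 * ‖y' x‖ = ‖p x + m x‖ := by rw [← e]; simp
    linarith [norm_add_le (p x) (m x)]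
  have hpc := hpp.continuousOn ha hx
  have hmc := hmp.continuousOn ha hx
  rw [Set.uIcc_of_le hax] at hpc hmc
  have hvc : ContinuousOn (fun t => Real.exp (-η * (t - a)) * (‖p t‖ + ‖m t‖)) (Set.Icc a x) :=
    ContinuousOn.mul (by fun_prop) (hpc.norm.add hmc.norm)
  have hwi : IntervalIntegrable (fun t => |V t| / ‖k‖) volume a x := (hV a ha x hx).abs.div_const _
  have key := gronwall (v := fun t => Real.exp (-η * (t - a)) * (‖p t‖ + ‖m t‖))
    (w := fun t => |V t| / ‖k‖) (A := ‖p a‖ + ‖m a‖) hax (by positivity) hwi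
    (fun t _ => by positivity) hvc ?_ x ⟨hax, le_rfl⟩
  · have hpa : ‖p a‖ ≤ ‖y' a‖ + ‖k‖ * ‖y a‖ := (norm_add_le _ _).trans (by simp)
    have hma : ‖m a‖ ≤ ‖y' a‖ + ‖k‖ * ‖y a‖ := (norm_sub_le _ _).trans (by simp)
    have h1 : ‖k‖ * ‖y x‖ ≤ (‖p x‖ + ‖m x‖) / 2 := by
      calc _ ≤ ‖k‖ * ((‖p x‖ + ‖m x‖) / (2 * ‖k‖)) := by gcongr; exact hyN x
        _ = _ := by field_simp
    calc _ ≤ ‖p x‖ + ‖m x‖ := by linarith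
      _ = Real.exp (η * (x - a)) * (Real.exp (-η * (x - a)) * (‖p x‖ + ‖m x‖)) := by
        rw [← mul_assoc, ← Real.exp_add]
        have : η * (x - a) + -η * (x - a) = 0 := by ring
        rw [this, Real.exp_zero, one_mul]
      _ ≤ Real.exp (η * (x - a)) * ((‖p a‖ + ‖m a‖) * Real.exp (∫ t in a..x, |V t| / ‖k‖)) := by
        gcongr
      _ ≤ _ := by
        rw [mul_assoc]
        gcongr
        linarith
  · intro t ht
    have ht0 : 0 < t := ha.trans_le ht.1
    have hsub : Set.Icc a t ⊆ Set.Icc a x := Set.Icc_subset_Icc_right ht.2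
    have h1 := norm_le_of_linear hpp hFi hηp ha ht.1
    have h2 := norm_le_of_linear hmp hFi hηm ha ht.1
    have hi1 : IntervalIntegrable (fun t => Real.exp (-η * (t - a)) * ‖(V t : ℂ) * y t‖) volume a t :=
      (hFi a ha t ht0).norm.continuousOn_mul (by fun_prop)
    have hi2 : IntervalIntegrable (fun t => |V t| / ‖k‖ *
        (Real.exp (-η * (t - a)) * (‖p t‖ + ‖m t‖))) volume a t := by
      refine IntervalIntegrable.mul_continuousOn (hwi.mono_set ?_) ?_
      · rw [Set.uIcc_of_le hax, Set.uIcc_of_le ht.1]; exact hsub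
      · rw [Set.uIcc_of_le ht.1]; exact hvc.mono hsub
    have h3 : 2 * ∫ s in a..t, Real.exp (-η * (s - a)) * ‖(V s : ℂ) * y s‖ ≤
        ∫ s in a..t, |V s| / ‖k‖ * (Real.exp (-η * (s - a)) * (‖p s‖ + ‖m s‖)) := by
      rw [← intervalIntegral.integral_const_mul]
      refine intervalIntegral.integral_mono_on ht.1 (hi1.const_mul 2) hi2 fun s _ => ?_
      rw [norm_mul, Complex.norm_real, Real.norm_eq_abs]
      calc _ ≤ 2 * (Real.exp (-η * (s - a)) * (|V s| * ((‖p s‖ + ‖m s‖) / (2 * ‖k‖)))) := by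
            gcongr
            exact hyN s
        _ = _ := by field_simp
    rw [mul_add]
    linarith

/-! ### Estimates for the regular solution -/

lemma rpow_le_two_rpow_mul {a b p : ℝ} (ha : 0 < a) (hab : a ≤ 2 * b) (hp : 0 ≤ p) :
    a ^ p ≤ 2 ^ p * b ^ p := by
  rw [← Real.mul_rpow (by norm_num) (by linarith)]
  exact Real.rpow_le_rpow ha.le hab hp

namespace Admissible

variable {l : ℝ} {q : ℝ → ℝ}

/-- For |k|x ≤ 1 the energy contributes at most |k|²x²/2 ≤ 1/2 to the weight, so the Volterra bounds
are uniform in k. -/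
lemma exists_bound_near (h : Admissible l q) : ∃ C > 0, ∀ (k : ℂ) (x : ℝ), 0 < x → ‖k‖ * x ≤ 1 →
    ‖regSol l q (k ^ 2) x‖ ≤ C * x ^ (l + 1) ∧ ‖regSolDeriv l q (k ^ 2) x‖ ≤ C * x ^ l := by
  have hα := h.two_mul_add_one_pos
  have hC := normConst_pos h.lower
  have hl := h.lower
  set N := ∫ y in Set.Ioi 0, y * |q y|
  have hN : 0 ≤ N := setIntegral_nonneg measurableSet_Ioi fun t (ht : 0 < t) => by positivity
  set M := (2 * l + 1)⁻¹ * (N + 1 / 2)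
  have hM : 0 < M := by positivity
  refine ⟨normConst l * ((l + 2) * Real.exp M + (2 * l + 1) * M * Real.exp M), ?_,
    fun k x hx hkx => ?_⟩
  · have : 0 < l + 2 := by linarith
    positivity
  have hmass : regMass l q ‖k ^ 2‖ x ≤ M := by
    refine (h.regMass_le hx).trans ?_
    have : ‖k ^ 2‖ * x ^ 2 ≤ 1 := by
      rw [norm_pow, ← mul_pow]
      exact pow_le_one₀ (by positivity) hkx
    exact mul_le_mul_of_nonneg_left (by linarith) (by positivity)
  have hm0 := h.regMass_nonneg (norm_nonneg (k ^ 2)) hx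
  have hu : ‖regProfile l q (k ^ 2) x‖ ≤ Real.exp M :=
    (h.norm_regProfile_le le_rfl hx).trans (Real.exp_le_exp.2 hmass)
  have hu1 : x * ‖regProfileDeriv l q (k ^ 2) x‖ ≤ (2 * l + 1) * M * Real.exp M :=
    (h.norm_mul_regProfileDeriv_le le_rfl hx).trans (by gcongr)
  have hMe : 0 ≤ (2 * l + 1) * M * Real.exp M := by positivity
  have he : 0 < Real.exp M := Real.exp_pos M
  constructor
  · rw [regSol, norm_mul, Complex.norm_real, Real.norm_of_nonneg (by positivity)]
    calc _ ≤ normConst l * x ^ (l + 1) * Real.exp M := by gcongr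
      _ = normConst l * Real.exp M * x ^ (l + 1) := by ring
      _ ≤ _ := by
        gcongr
        nlinarith
  · rw [regSolDeriv, norm_mul, Complex.norm_real, Real.norm_of_nonneg hC.le]
    have hl1 : 0 < l + 1 := by linarith
    calc _ ≤ normConst l * (((l + 1) * x ^ l) * Real.exp M +
          x ^ l * (x * ‖regProfileDeriv l q (k ^ 2) x‖)) := by
          gcongr
          refine (norm_add_le _ _).trans (add_le_add ?_ (le_of_eq ?_))
          · rw [norm_mul, Complex.norm_real, Real.norm_of_nonneg (by positivity)]
            gcongr
          · rw [norm_mul, Complex.norm_real, Real.norm_of_nonneg (by positivity),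
              Real.rpow_add_one hx.ne', mul_assoc]
      _ ≤ normConst l * (((l + 1) * x ^ l) * Real.exp M +
          x ^ l * ((2 * l + 1) * M * Real.exp M)) := by gcongr
      _ = normConst l * ((l + 1) * Real.exp M + (2 * l + 1) * M * Real.exp M) * x ^ l := by ring
      _ ≤ _ := by
        gcongr
        linarith

/-- The Gronwall exponent stays bounded when started at 1/κ: there |q|/κ ≤ t|q|, and the integral of
t^{-2}/κ from 1/κ on is at most 1. -/
lemma integral_abs_effPotential_le (h : Admissible l q) {κ x : ℝ} (hκ : 0 < κ) (hx : κ⁻¹ ≤ x) :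
    ∫ t in κ⁻¹..x, |effPotential l q t| / κ ≤
      |l * (l + 1)| + ∫ y in Set.Ioi 0, y * |q y| := by
  have ha : 0 < κ⁻¹ := inv_pos.2 hκ
  have hx0 : 0 < x := ha.trans_le hx
  have hp : IsPrimitiveOn (Set.Ioi 0) (fun t : ℝ => -t⁻¹) (fun t : ℝ => (t ^ 2)⁻¹) := by
    refine IsPrimitiveOn.of_hasDerivAt (fun t ht => ?_) (fun t ht => ?_)
    · exact ((hasDerivAt_inv (ne_of_gt ht)).neg).congr_deriv (neg_neg _)
    · have : t ≠ 0 := ne_of_gt ht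
      exact ContinuousAt.continuousWithinAt (by fun_prop (disch := positivity))
  obtain ⟨i1, e1⟩ := hp κ⁻¹ ha x hx0
  beta_reduce at e1
  have i2 : IntervalIntegrable (fun t => t * |q t|) volume κ⁻¹ x := by
    rw [intervalIntegrable_iff_integrableOn_Ioc_of_le hx]
    exact h.int.mono_set fun y hy => ha.trans hy.1
  calc _ ≤ ∫ t in κ⁻¹..x, (|l * (l + 1)| / κ * (t ^ 2)⁻¹ + t * |q t|) := by
        refine intervalIntegral.integral_mono_on hx
          ((intervalIntegrable_effPotential h.loc ha hx0).abs.div_const _)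
          ((i1.const_mul _).add i2) fun t ht => ?_
        have ht0 : 0 < t := ha.trans_le ht.1
        have h1 : |effPotential l q t| ≤ |l * (l + 1)| * (t ^ 2)⁻¹ + |q t| := by
          refine (abs_add_le _ _).trans (le_of_eq ?_)
          rw [abs_div, abs_of_pos (by positivity : 0 < t ^ 2), div_eq_mul_inv]
        have h2 : |q t| / κ ≤ t * |q t| := by
          rw [div_eq_inv_mul]
          exact mul_le_mul_of_nonneg_right ht.1 (abs_nonneg _)
        calc _ ≤ (|l * (l + 1)| * (t ^ 2)⁻¹ + |q t|) / κ := by gcongr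
          _ = |l * (l + 1)| / κ * (t ^ 2)⁻¹ + |q t| / κ := by ring
          _ ≤ _ := by gcongr
    _ = |l * (l + 1)| / κ * (κ - x⁻¹) + ∫ t in κ⁻¹..x, t * |q t| := by
        rw [intervalIntegral.integral_add (i1.const_mul _) i2, intervalIntegral.integral_const_mul,
          ← e1, inv_inv]
        ring
    _ ≤ _ := by
        have hxi : 0 < x⁻¹ := inv_pos.2 hx0
        refine add_le_add ?_ ?_
        · calc _ ≤ |l * (l + 1)| / κ * κ := by gcongr; linarith
            _ = _ := by field_simp
        · rw [intervalIntegral.integral_of_le hx]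
          refine setIntegral_mono_set h.int ?_ (Eventually.of_forall fun y hy => ha.trans hy.1)
          rw [EventuallyLE, ae_restrict_iff' measurableSet_Ioi]
          exact Eventually.of_forall fun t (ht : 0 < t) => by positivity

/-- The near estimate at x = 1/|k| gives Cauchy data of size |k|^{-l}, which `norm_solution_le`
propagates to larger x. -/
lemma exists_bound_far (h : Admissible l q) : ∃ C > 0, ∀ (k : ℂ) (x : ℝ), k ≠ 0 → ‖k‖⁻¹ ≤ x →
    ‖regSolDeriv l q (k ^ 2) x‖ + ‖k‖ * ‖regSol l q (k ^ 2) x‖ ≤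
      C * (‖k‖⁻¹) ^ l * Real.exp (|k.im| * x) := by
  obtain ⟨C, hC, hb⟩ := h.exists_bound_near
  refine ⟨4 * C * Real.exp (|l * (l + 1)| + ∫ y in Set.Ioi 0, y * |q y|), by positivity,
    fun k x hk hx => ?_⟩
  have hk1 : 0 < ‖k‖ := norm_pos_iff.2 hk
  have ha : 0 < ‖k‖⁻¹ := inv_pos.2 hk1
  obtain ⟨b1, b2⟩ := hb k ‖k‖⁻¹ ha (mul_inv_cancel₀ hk1.ne').le
  refine (norm_solution_le hk (fun a ha b hb => intervalIntegrable_effPotential h.loc ha hb)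
    (h.isPrimitiveOn_regSol _) (h.isPrimitiveOn_regSolDeriv _) ha hx).trans ?_
  have e : ‖k‖ * (C * ‖k‖⁻¹ ^ (l + 1)) = C * ‖k‖⁻¹ ^ l := by
    rw [Real.rpow_add_one ha.ne']
    field_simp
  calc _ ≤ Real.exp (|k.im| * x) * (2 * (C * ‖k‖⁻¹ ^ l + C * ‖k‖⁻¹ ^ l)) *
        Real.exp (|l * (l + 1)| + ∫ y in Set.Ioi 0, y * |q y|) := by
        have b1' : ‖k‖ * ‖regSol l q (k ^ 2) ‖k‖⁻¹‖ ≤ C * ‖k‖⁻¹ ^ l := by rw [← e]; gcongr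
        refine mul_le_mul (mul_le_mul ?_ ?_ (by positivity) (by positivity))
          (Real.exp_le_exp.2 (h.integral_abs_effPotential_le hk1 hx)) (by positivity)
          (by positivity)
        · gcongr
          linarith
        · linarith
    _ = _ := by ring

/-- The basic estimate for the regular solution, uniform in the complex momentum. -/
lemma exists_norm_regSol_le (h : Admissible l q) : ∃ C > 0, ∀ (k : ℂ) (x : ℝ), 0 < x →
    ‖regSol l q (k ^ 2) x‖ ≤ C * (x / (1 + ‖k‖ * x)) ^ (l + 1) * Real.exp (|k.im| * x) := by
  obtain ⟨C₁, hC₁, hb₁⟩ := h.exists_bound_near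
  obtain ⟨C₂, hC₂, hb₂⟩ := h.exists_bound_far
  have hl1 : 0 ≤ l + 1 := by linarith [h.lower]
  refine ⟨(C₁ + C₂) * 2 ^ (l + 1), by positivity, fun k x hx => ?_⟩
  have hs : 0 ≤ ‖k‖ * x := by positivity
  rcases le_or_gt (‖k‖ * x) 1 with hkx | hkx
  · have h1 : x ^ (l + 1) ≤ 2 ^ (l + 1) * (x / (1 + ‖k‖ * x)) ^ (l + 1) := by
      refine rpow_le_two_rpow_mul hx ?_ hl1
      rw [← mul_div_assoc, le_div_iff₀ (by positivity)]
      nlinarith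
    have h2 : 1 ≤ Real.exp (|k.im| * x) := Real.one_le_exp (by positivity)
    calc _ ≤ C₁ * x ^ (l + 1) := (hb₁ k x hx hkx).1
      _ ≤ (C₁ + C₂) * (2 ^ (l + 1) * (x / (1 + ‖k‖ * x)) ^ (l + 1)) := by
        gcongr
        linarith
      _ = (C₁ + C₂) * 2 ^ (l + 1) * (x / (1 + ‖k‖ * x)) ^ (l + 1) * 1 := by ring
      _ ≤ _ := by gcongr
  · have hk : k ≠ 0 := by
      rintro rfl
      simp at hkx
      linarith
    have hk1 : 0 < ‖k‖ := norm_pos_iff.2 hk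
    have ha : 0 < ‖k‖⁻¹ := inv_pos.2 hk1
    have hxa : ‖k‖⁻¹ ≤ x := by
      rw [inv_le_iff_one_le_mul₀ hk1]
      linarith
    have h1 : (‖k‖⁻¹) ^ (l + 1) ≤ 2 ^ (l + 1) * (x / (1 + ‖k‖ * x)) ^ (l + 1) := by
      refine rpow_le_two_rpow_mul ha ?_ hl1
      rw [← mul_div_assoc, le_div_iff₀ (by positivity), mul_add, mul_one,
        inv_mul_cancel_left₀ hk1.ne']
      linarith
    have h2 : ‖regSol l q (k ^ 2) x‖ ≤ C₂ * ‖k‖⁻¹ ^ (l + 1) * Real.exp (|k.im| * x) := by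
      have h3 := hb₂ k x hk hxa
      have h4 : ‖k‖ * ‖regSol l q (k ^ 2) x‖ ≤ C₂ * ‖k‖⁻¹ ^ l * Real.exp (|k.im| * x) := by
        linarith [norm_nonneg (regSolDeriv l q (k ^ 2) x)]
      calc _ = ‖k‖⁻¹ * (‖k‖ * ‖regSol l q (k ^ 2) x‖) := (inv_mul_cancel_left₀ hk1.ne' _).symm
        _ ≤ ‖k‖⁻¹ * (C₂ * ‖k‖⁻¹ ^ l * Real.exp (|k.im| * x)) := by gcongr
        _ = _ := by rw [Real.rpow_add_one ha.ne']; ring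
    calc _ ≤ _ := h2
      _ ≤ (C₁ + C₂) * (2 ^ (l + 1) * (x / (1 + ‖k‖ * x)) ^ (l + 1)) * Real.exp (|k.im| * x) := by
        gcongr
        linarith
      _ = _ := by ring

lemma differentiable_regSol_sq (h : Admissible l q) {x : ℝ} (hx : 0 < x) :
    Differentiable ℂ (fun k => regSol l q (k ^ 2) x) :=
  (h.differentiable_regSol hx).comp (differentiable_id.pow 2)

/-- The estimate for the derivative with respect to the momentum, by Cauchy's inequality on the
disc of radius `1/x`. -/
lemma exists_norm_deriv_regSol_le (h : Admissible l q) : ∃ C > 0, ∀ (k : ℂ) (x : ℝ), 0 < x →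
    ‖deriv (fun k => regSol l q (k ^ 2) x) k‖ ≤
      C * x * (x / (1 + ‖k‖ * x)) ^ (l + 1) * Real.exp (|k.im| * x) := by
  obtain ⟨C, hC, hb⟩ := h.exists_norm_regSol_le
  have hl1 : 0 ≤ l + 1 := by linarith [h.lower]
  -- On the circle of radius 1/x both |k|x and |Im k|x change by at most 1: the first costs the
  -- factor 2^{l+1}, the second the factor e.
  refine ⟨C * 2 ^ (l + 1) * Real.exp 1, by positivity, fun k x hx => ?_⟩
  have hxi : 0 < x⁻¹ := inv_pos.2 hx
  refine (Complex.norm_deriv_le_of_forall_mem_sphere_norm_le hxi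
    (h.differentiable_regSol_sq hx).diffContOnCl (C := C * (2 ^ (l + 1) *
      (x / (1 + ‖k‖ * x)) ^ (l + 1)) * Real.exp (1 + |k.im| * x)) fun κ hκ => ?_).trans ?_
  · refine (hb κ x hx).trans ?_
    have hκ' : ‖κ - k‖ = x⁻¹ := mem_sphere_iff_norm.1 hκ
    have hn : ‖k‖ * x ≤ ‖κ‖ * x + 1 := by
      have : ‖k‖ ≤ ‖κ‖ + x⁻¹ := by
        rw [← hκ', norm_sub_rev]
        linarith [norm_sub_norm_le k κ]
      calc _ ≤ (‖κ‖ + x⁻¹) * x := by gcongr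
        _ = _ := by field_simp
    have him : |κ.im| * x ≤ 1 + |k.im| * x := by
      have h1 : |κ.im - k.im| ≤ x⁻¹ := by
        rw [← hκ', ← Complex.sub_im]
        exact Complex.abs_im_le_norm _
      have h2 : |κ.im| ≤ x⁻¹ + |k.im| := by
        linarith [abs_sub_abs_le_abs_sub κ.im k.im]
      calc _ ≤ (x⁻¹ + |k.im|) * x := by gcongr
        _ = _ := by field_simp
    have hs : 0 ≤ ‖κ‖ * x := by positivity
    gcongr
    refine rpow_le_two_rpow_mul (by positivity) ?_ hl1
    rw [← mul_div_assoc, div_le_div_iff₀ (by positivity) (by positivity)]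
    nlinarith
  · rw [Real.exp_add, div_inv_eq_mul]
    exact le_of_eq (by ring)

end Admissible

/-! ### Integrals of Hankel type in the closed upper half plane -/

lemma convex_closedUpperHalfPlane : Convex ℝ closedUpperHalfPlane :=
  convex_halfSpace_im_ge 0

/-- The point `ξ + i t / 2`. -/
def upShift (ξ : ℂ) (t : ℝ) : ℂ := ξ + Complex.I * (t / 2)

/-- The integral `∫_0^∞ e^{-t} t^l (ξ + i t / 2)^p dt`. -/
def hankelInt (l p : ℝ) (ξ : ℂ) : ℂ :=
  ∫ t in Set.Ioi (0 : ℝ), ((Real.exp (-t) * t ^ l : ℝ) : ℂ) * upShift ξ t ^ (p : ℂ)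

lemma upShift_im (ξ : ℂ) (t : ℝ) : (upShift ξ t).im = ξ.im + t / 2 := by
  have : (t / 2 : ℂ) = ((t / 2 : ℝ) : ℂ) := by push_cast; rfl
  rw [upShift, this]
  simp

lemma upShift_mem_slitPlane {ξ : ℂ} (hξ : 0 ≤ ξ.im) {t : ℝ} (ht : 0 < t) :
    upShift ξ t ∈ Complex.slitPlane := by
  refine Complex.mem_slitPlane_iff.2 (Or.inr ?_)
  rw [upShift_im]
  positivity

lemma norm_upShift_le (ξ : ℂ) {t : ℝ} (ht : 0 ≤ t) : ‖upShift ξ t‖ ≤ ‖ξ‖ + t := by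
  refine (norm_add_le _ _).trans ?_
  have : (t / 2 : ℂ) = ((t / 2 : ℝ) : ℂ) := by push_cast; rfl
  rw [norm_mul, Complex.norm_I, one_mul, this, Complex.norm_real, Real.norm_of_nonneg (by positivity)]
  linarith

/-- For Im ξ ≥ 0 the cross term in |ξ + it/2|² is nonnegative, so there is no cancellation between ξ
and it/2. -/
lemma le_norm_upShift {ξ : ℂ} (hξ : 0 ≤ ξ.im) {t : ℝ} (ht : 0 ≤ t) :
    (‖ξ‖ + t) / 4 ≤ ‖upShift ξ t‖ := by
  refine le_of_sq_le_sq ?_ (norm_nonneg _)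
  have hre : (upShift ξ t).re = ξ.re := by
    have : (t / 2 : ℂ) = ((t / 2 : ℝ) : ℂ) := by push_cast; rfl
    rw [upShift, this]
    simp
  rw [← Complex.normSq_eq_norm_sq, Complex.normSq_apply, upShift_im, hre]
  have h1 : ‖ξ‖ ^ 2 = ξ.re * ξ.re + ξ.im * ξ.im := by
    rw [← Complex.normSq_eq_norm_sq, Complex.normSq_apply]
  nlinarith [mul_nonneg hξ ht, sq_nonneg (‖ξ‖ - t), sq_nonneg ‖ξ‖, sq_nonneg t]

lemma norm_upShift_cpow_le {ξ : ℂ} (hξ : 0 ≤ ξ.im) {t : ℝ} (ht : 0 < t) (p : ℝ) :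
    ‖upShift ξ t ^ (p : ℂ)‖ ≤ 4 ^ |p| * (‖ξ‖ + t) ^ p := by
  rw [Complex.norm_cpow_real]
  have hs : 0 < ‖ξ‖ + t := by positivity
  rcases le_or_gt 0 p with hp | hp
  · calc _ ≤ (‖ξ‖ + t) ^ p := Real.rpow_le_rpow (norm_nonneg _) (norm_upShift_le ξ ht.le) hp
      _ ≤ _ := le_mul_of_one_le_left (by positivity)
        (Real.one_le_rpow (by norm_num) (abs_nonneg p))
  · rw [abs_of_neg hp, Real.rpow_neg (by norm_num), ← Real.inv_rpow (by norm_num),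
      ← Real.mul_rpow (by norm_num) hs.le]
    refine Real.rpow_le_rpow_of_nonpos (by positivity) ?_ hp.le
    have := le_norm_upShift hξ ht.le
    linarith

lemma continuousOn_upShift_cpow {ξ : ℂ} (hξ : 0 ≤ ξ.im) (p : ℝ) :
    ContinuousOn (fun t : ℝ => upShift ξ t ^ (p : ℂ)) (Set.Ioi 0) := by
  intro t ht
  refine ContinuousAt.continuousWithinAt ?_
  refine ContinuousAt.comp (f := upShift ξ) (continuousAt_cpow_const (upShift_mem_slitPlane hξ ht)) ?_
  unfold upShift
  fun_prop

lemma aestronglyMeasurable_hankel {l : ℝ} {ξ : ℂ} (hξ : 0 ≤ ξ.im) (p : ℝ) :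
    AEStronglyMeasurable (fun t : ℝ => ((Real.exp (-t) * t ^ l : ℝ) : ℂ) * upShift ξ t ^ (p : ℂ))
      (volume.restrict (Set.Ioi 0)) := by
  refine ContinuousOn.aestronglyMeasurable (ContinuousOn.mul ?_ (continuousOn_upShift_cpow hξ p))
    measurableSet_Ioi
  intro t ht
  refine (Complex.continuous_ofReal.continuousAt.comp ?_).continuousWithinAt
  exact ContinuousAt.mul (by fun_prop) (Real.continuousAt_rpow_const _ _ (Or.inl (ne_of_gt ht)))

lemma norm_hankel_integrand_le {l : ℝ} {ξ : ℂ} (hξ : 0 ≤ ξ.im) (p : ℝ) {t : ℝ} (ht : 0 < t) :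
    ‖((Real.exp (-t) * t ^ l : ℝ) : ℂ) * upShift ξ t ^ (p : ℂ)‖ ≤
      4 ^ |p| * (Real.exp (-t) * t ^ l * (‖ξ‖ + t) ^ p) := by
  rw [norm_mul, Complex.norm_real, Real.norm_of_nonneg (by positivity)]
  calc _ ≤ Real.exp (-t) * t ^ l * (4 ^ |p| * (‖ξ‖ + t) ^ p) := by
        gcongr
        exact norm_upShift_cpow_le hξ ht p
    _ = _ := by ring

lemma integrableOn_exp_rpow {a : ℝ} (ha : -1 < a) :
    IntegrableOn (fun t => Real.exp (-t) * t ^ a) (Set.Ioi 0) := by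
  have := Real.GammaIntegral_convergent (s := a + 1) (by linarith)
  simpa using this

lemma integrableOn_exp_rpow_mul {l c : ℝ} (hl : -1 < l) (hc : 0 < c) (r : ℝ) :
    IntegrableOn (fun t => Real.exp (-t) * t ^ l * (c + t) ^ r) (Set.Ioi 0) := by
  have hm : AEStronglyMeasurable (fun t => Real.exp (-t) * t ^ l * (c + t) ^ r)
      (volume.restrict (Set.Ioi 0)) := by
    refine ContinuousOn.aestronglyMeasurable (fun t ht => ?_) measurableSet_Ioi
    have ht' : (0 : ℝ) < t := ht
    refine ContinuousAt.continuousWithinAt (ContinuousAt.mul (ContinuousAt.mul (by fun_prop) ?_) ?_)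
    · exact Real.continuousAt_rpow_const _ _ (Or.inl ht'.ne')
    · exact ContinuousAt.rpow_const (by fun_prop) (Or.inl (by positivity))
  rcases le_or_gt 0 r with hr | hr
  · refine Integrable.mono' (g := fun t => (2 * c) ^ r * (Real.exp (-t) * t ^ l) +
      2 ^ r * (Real.exp (-t) * t ^ (l + r)))
      (((integrableOn_exp_rpow hl).const_mul _).add
        ((integrableOn_exp_rpow (by linarith)).const_mul _)) hm ?_
    rw [ae_restrict_iff' measurableSet_Ioi]
    refine Eventually.of_forall fun t (ht : 0 < t) => ?_
    rw [Real.norm_of_nonneg (by positivity)]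
    have h1 : (c + t) ^ r ≤ (2 * c) ^ r + (2 * t) ^ r := by
      rcases le_total c t with h | h
      · exact (Real.rpow_le_rpow (by positivity) (by linarith) hr).trans
          (le_add_of_nonneg_left (by positivity))
      · exact (Real.rpow_le_rpow (by positivity) (by linarith) hr).trans
          (le_add_of_nonneg_right (by positivity))
    calc _ ≤ Real.exp (-t) * t ^ l * ((2 * c) ^ r + (2 * t) ^ r) := by gcongr
      _ = _ := by
        rw [Real.mul_rpow (by norm_num) ht.le, Real.rpow_add ht]
        ring
  · refine Integrable.mono' (g := fun t => c ^ r * (Real.exp (-t) * t ^ l))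
      ((integrableOn_exp_rpow hl).const_mul _) hm ?_
    rw [ae_restrict_iff' measurableSet_Ioi]
    refine Eventually.of_forall fun t (ht : 0 < t) => ?_
    rw [Real.norm_of_nonneg (by positivity), mul_comm]
    exact mul_le_mul_of_nonneg_right (Real.rpow_le_rpow_of_nonpos hc (by linarith) hr.le)
      (by positivity)

lemma rpow_add_le_of_mem_Icc {c d s t : ℝ} (hc : 0 < c) (hs : s ∈ Set.Icc c d) (ht : 0 ≤ t)
    (r : ℝ) : (s + t) ^ r ≤ (c + t) ^ r + (d + t) ^ r := by
  have h1 : 0 < s := hc.trans_le hs.1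
  have h2 : 0 < d := h1.trans_le hs.2
  rcases le_or_gt 0 r with hr | hr
  · exact (Real.rpow_le_rpow (by positivity) (by linarith [hs.2]) hr).trans
      (le_add_of_nonneg_left (by positivity))
  · exact (Real.rpow_le_rpow_of_nonpos (by positivity) (by linarith [hs.1]) hr.le).trans
      (le_add_of_nonneg_right (by positivity))

lemma integrableOn_hankel {l : ℝ} (hl : -1 < l) {ξ : ℂ} (hξ : 0 ≤ ξ.im) (hξ0 : ξ ≠ 0) (p : ℝ) :
    IntegrableOn (fun t : ℝ => ((Real.exp (-t) * t ^ l : ℝ) : ℂ) * upShift ξ t ^ (p : ℂ))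
      (Set.Ioi 0) := by
  refine Integrable.mono' ((integrableOn_exp_rpow_mul hl (norm_pos_iff.2 hξ0) p).const_mul (4 ^ |p|))
    (aestronglyMeasurable_hankel hξ p) ?_
  rw [ae_restrict_iff' measurableSet_Ioi]
  exact Eventually.of_forall fun t ht => norm_hankel_integrand_le hξ p ht

lemma hasDerivWithinAt_hankelInt {l : ℝ} (hl : -1 < l) (p : ℝ) {ξ : ℂ} (hξ : 0 ≤ ξ.im)
    (hξ0 : ξ ≠ 0) :
    HasDerivWithinAt (hankelInt l p) (p * hankelInt l (p - 1) ξ) closedUpperHalfPlane ξ := by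
  have hn : 0 < ‖ξ‖ := norm_pos_iff.2 hξ0
  have hball : ∀ k ∈ closedUpperHalfPlane ∩ Metric.ball ξ (‖ξ‖ / 2),
      0 ≤ k.im ∧ k ≠ 0 ∧ ‖k‖ ∈ Set.Icc (‖ξ‖ / 2) (2 * ‖ξ‖) := by
    rintro k ⟨hk, hkb⟩
    rw [Metric.mem_ball, dist_eq_norm] at hkb
    have h1 : ‖ξ‖ / 2 < ‖k‖ := by
      have := norm_sub_norm_le ξ k
      rw [norm_sub_rev] at this
      linarith
    have h2 := norm_sub_norm_le k ξ
    refine ⟨hk, ?_, h1.le, by linarith⟩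
    rw [← norm_pos_iff]
    linarith
  have := hasDerivWithinAt_integral_of_dominated (μ := volume.restrict (Set.Ioi (0 : ℝ)))
    convex_closedUpperHalfPlane
    (F := fun ξ t => ((Real.exp (-t) * t ^ l : ℝ) : ℂ) * upShift ξ t ^ (p : ℂ))
    (F' := fun ξ t => p * (((Real.exp (-t) * t ^ l : ℝ) : ℂ) * upShift ξ t ^ ((p - 1 : ℝ) : ℂ)))
    (k₀ := ξ) hξ (half_pos hn)
    (bound := fun t => |p| * (4 ^ |p - 1| * (Real.exp (-t) * t ^ l * (‖ξ‖ / 2 + t) ^ (p - 1) +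
      Real.exp (-t) * t ^ l * (2 * ‖ξ‖ + t) ^ (p - 1)))) ?_ ?_ ?_ ?_
  · rw [integral_const_mul] at this
    exact this
  · exact fun k hk => integrableOn_hankel hl (hball k hk).1 (hball k hk).2.1 p
  · exact (((integrableOn_exp_rpow_mul hl (half_pos hn) (p - 1)).add
      (integrableOn_exp_rpow_mul hl (by positivity) (p - 1))).const_mul _).const_mul _
  · rw [ae_restrict_iff' measurableSet_Ioi]
    refine Eventually.of_forall fun t (ht : 0 < t) k hk => ?_
    obtain ⟨h1, _, h3⟩ := hball k hk
    rw [norm_mul, Complex.norm_real, Real.norm_eq_abs]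
    refine mul_le_mul_of_nonneg_left ((norm_hankel_integrand_le h1 (p - 1) ht).trans ?_)
      (abs_nonneg p)
    rw [← mul_add]
    gcongr
    exact rpow_add_le_of_mem_Icc (half_pos hn) h3 ht.le _
  · rw [ae_restrict_iff' measurableSet_Ioi]
    refine Eventually.of_forall fun t (ht : 0 < t) k hk => ?_
    have h1 : HasDerivAt (fun ξ => upShift ξ t) 1 k := (hasDerivAt_id k).add_const _
    have h2 := ((h1.cpow_const (c := (p : ℂ)) (upShift_mem_slitPlane (hball k hk).1 ht)).const_mul
      ((Real.exp (-t) * t ^ l : ℝ) : ℂ)).hasDerivWithinAt (s := closedUpperHalfPlane)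
    refine h2.congr_deriv ?_
    push_cast
    ring

/-- The differential equation satisfied by the Hankel integral. -/
lemma hankelInt_ode {l : ℝ} (hl : -1 < l) {ξ : ℂ} (hξ : 0 ≤ ξ.im) (hξ0 : ξ ≠ 0) :
    2 * Complex.I * hankelInt l l ξ + (2 * l - 2 * Complex.I * ξ) * hankelInt l (l - 1) ξ
      - (l - 1) * ξ * hankelInt l (l - 2) ξ = 0 := by
  -- The identity is the vanishing of the integral of f'. Factors of t in f' are eliminated through
  -- t = -2i((ξ + it/2) - ξ), and the extra power t^{l+1} makes f vanish at 0.
  set f : ℝ → ℂ := fun t => ((Real.exp (-t) * t ^ (l + 1) : ℝ) : ℂ) * upShift ξ t ^ ((l - 1 : ℝ) : ℂ)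
  set e : ℝ → ℝ → ℂ := fun p t => ((Real.exp (-t) * t ^ l : ℝ) : ℂ) * upShift ξ t ^ (p : ℂ) with he
  set f' : ℝ → ℂ := fun t => 2 * Complex.I * e l t + (2 * l - 2 * Complex.I * ξ) * e (l - 1) t
      - (l - 1) * ξ * e (l - 2) t with hf'
  have hi : ∀ p, IntegrableOn (e p) (Set.Ioi 0) := fun p => integrableOn_hankel hl hξ hξ0 p
  have hi' : IntegrableOn f' (Set.Ioi 0) :=
    (((hi l).const_mul _).add ((hi (l - 1)).const_mul _)).sub ((hi (l - 2)).const_mul _)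
  have hd : ∀ t ∈ Set.Ioi (0 : ℝ), HasDerivAt f (f' t) t := by
    intro t ht
    have ht' : (0 : ℝ) < t := ht
    have hne : upShift ξ t ≠ 0 := Complex.slitPlane_ne_zero (upShift_mem_slitPlane hξ ht')
    have h1 : HasDerivAt (fun t : ℝ => Real.exp (-t) * t ^ (l + 1))
        (-Real.exp (-t) * t ^ (l + 1) + Real.exp (-t) * ((l + 1) * t ^ l)) t := by
      have h2 := (hasDerivAt_neg t).exp
      have h3 := Real.hasDerivAt_rpow_const (x := t) (p := l + 1) (Or.inl ht'.ne')
      rw [add_sub_cancel_right] at h3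
      exact (h2.mul h3).congr_deriv (by ring)
    have h4 : HasDerivAt (fun t : ℂ => (ξ + Complex.I * (t / 2)) ^ ((l - 1 : ℝ) : ℂ))
        (((l - 1 : ℝ) : ℂ) * upShift ξ t ^ (((l - 1 : ℝ) : ℂ) - 1) * (Complex.I * (1 / 2))) (t : ℂ) :=
      HasDerivAt.cpow_const ((((hasDerivAt_id (t : ℂ)).div_const 2).const_mul Complex.I).const_add ξ)
        (upShift_mem_slitPlane hξ ht')
    refine ((h1.ofReal_comp).mul h4.comp_ofReal).congr_deriv ?_
    have e0 : ∀ s : ℂ, upShift ξ t ^ (s + 1) = upShift ξ t ^ s * upShift ξ t := fun s => by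
      rw [Complex.cpow_add _ _ hne, Complex.cpow_one]
    have c1 : (((l - 1 : ℝ) : ℂ) - 1) = ((l - 2 : ℝ) : ℂ) := by push_cast; ring
    have c2 : upShift ξ t ^ ((l - 1 : ℝ) : ℂ) = upShift ξ t ^ ((l - 2 : ℝ) : ℂ) * upShift ξ t := by
      rw [← e0]; congr 1; push_cast; ring
    have c3 : upShift ξ t ^ (l : ℂ) =
        upShift ξ t ^ ((l - 2 : ℝ) : ℂ) * upShift ξ t * upShift ξ t := by
      rw [← c2, ← e0]; congr 1; push_cast; ring
    have c4 : (ξ + Complex.I * ((t : ℂ) / 2)) = upShift ξ t := rfl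
    rw [hf', he]
    simp only [c4]
    rw [c1, c3, c2, Real.rpow_add_one ht'.ne']
    have hu : upShift ξ t = ξ + Complex.I * (t / 2) := rfl
    push_cast
    generalize upShift ξ t ^ ((l : ℂ) - 2) = U
    rw [hu]
    linear_combination (Complex.exp (-t) * (t ^ l : ℝ) * U * (-ξ * t - Complex.I * t ^ 2 / 2)) *
      Complex.I_sq
  have hfi : IntegrableOn f (Set.Ioi 0) := integrableOn_hankel (by linarith) hξ hξ0 (l - 1)
  have hlim := tendsto_zero_of_hasDerivAt_of_integrableOn_Ioi hd hi' hfi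
  have hf0 : f 0 = 0 := by
    simp only [f]
    rw [Real.zero_rpow (by linarith)]
    simp
  have hc : ContinuousWithinAt f (Set.Ici 0) 0 := by
    rw [← continuousWithinAt_Ioi_iff_Ici, ContinuousWithinAt, hf0]
    have hb : Tendsto (fun t : ℝ => 4 ^ |l - 1| * (Real.exp (-t) * t ^ (l + 1) *
        (‖ξ‖ + t) ^ (l - 1))) (𝓝[>] 0) (𝓝 (4 ^ |l - 1| * (Real.exp (-0) * 0 ^ (l + 1) *
        (‖ξ‖ + 0) ^ (l - 1)))) := by
      refine ContinuousAt.continuousWithinAt ?_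
      refine continuousAt_const.mul (ContinuousAt.mul (ContinuousAt.mul (by fun_prop) ?_) ?_)
      · exact Real.continuousAt_rpow_const _ _ (Or.inr (by linarith))
      · refine ContinuousAt.rpow_const (by fun_prop) (Or.inl ?_)
        simpa using hξ0
    rw [Real.zero_rpow (by linarith : l + 1 ≠ 0), mul_zero, zero_mul, mul_zero] at hb
    refine squeeze_zero_norm' ?_ hb
    filter_upwards [self_mem_nhdsWithin] with t ht
    exact norm_hankel_integrand_le hξ (l - 1) ht
  have key := integral_Ioi_of_hasDerivAt_of_tendsto hc hd hi' hlim
  rw [hf0, sub_zero] at key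
  rw [← key]
  have i1 := (hi l).const_mul (2 * Complex.I)
  have i2 := (hi (l - 1)).const_mul (2 * l - 2 * Complex.I * ξ)
  have i3 := (hi (l - 2)).const_mul ((l - 1) * ξ)
  have i12 : Integrable (fun t => 2 * Complex.I * e l t + (2 * l - 2 * Complex.I * ξ) * e (l - 1) t)
    (volume.restrict (Set.Ioi 0)) := i1.add i2
  have e1 : ∫ t in Set.Ioi 0, f' t = 2 * Complex.I * (∫ t in Set.Ioi 0, e l t) +
      (2 * l - 2 * Complex.I * ξ) * (∫ t in Set.Ioi 0, e (l - 1) t)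
      - (l - 1) * ξ * ∫ t in Set.Ioi 0, e (l - 2) t := by
    simp only [hf']
    rw [integral_sub i12 i3, integral_add i1 i2, integral_const_mul, integral_const_mul,
      integral_const_mul]
  rw [e1]
  rfl

/-! ### Estimates and asymptotics of the Hankel integrals -/

/-- One function Φ works for all ξ, so it serves both the growth bound and dominated convergence at
ξ = 0. Its term t^{2l} is integrable at 0 because 2l > -1. -/
lemma exists_norm_hankelInt_le {l : ℝ} (hl : -(1 / 2) < l) :
    ∃ Φ : ℝ → ℝ, IntegrableOn Φ (Set.Ioi 0) ∧ (∀ t > 0, 0 ≤ Φ t) ∧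
      ∀ ξ : ℂ, 0 ≤ ξ.im → ∀ t > 0,
        ‖((Real.exp (-t) * t ^ l : ℝ) : ℂ) * upShift ξ t ^ (l : ℂ)‖ ≤ (1 + ‖ξ‖) ^ l * Φ t := by
  refine ⟨fun t => 4 ^ |l| * (Real.exp (-t) * t ^ l * (1 + t) ^ l +
    (Real.exp (-t) * t ^ l + Real.exp (-t) * t ^ (2 * l))), ?_, fun t ht => by positivity,
    fun ξ hξ t ht => ?_⟩
  · exact ((integrableOn_exp_rpow_mul (by linarith) one_pos l).add
      ((integrableOn_exp_rpow (by linarith)).add (integrableOn_exp_rpow (by linarith)))).const_mul _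
  · refine (norm_hankel_integrand_le hξ l ht).trans ?_
    have hs := norm_nonneg ξ
    have h1 : (‖ξ‖ + t) ^ l ≤ (1 + ‖ξ‖) ^ l * ((1 + t) ^ l + (1 + t ^ l)) := by
      rcases le_or_gt 0 l with hl0 | hl0
      · calc (‖ξ‖ + t) ^ l ≤ ((1 + ‖ξ‖) * (1 + t)) ^ l :=
              Real.rpow_le_rpow (by positivity) (by nlinarith) hl0
          _ = (1 + ‖ξ‖) ^ l * (1 + t) ^ l := Real.mul_rpow (by positivity) (by positivity)
          _ ≤ _ := by
              gcongr
              exact le_add_of_nonneg_right (by positivity)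
      · rcases le_total 1 t with h | h
        · calc (‖ξ‖ + t) ^ l ≤ (1 + ‖ξ‖) ^ l :=
                Real.rpow_le_rpow_of_nonpos (by positivity) (by linarith) hl0.le
            _ ≤ _ := le_mul_of_one_le_right (by positivity) (by
                have : 0 ≤ (1 + t) ^ l := by positivity
                have : 0 ≤ t ^ l := by positivity
                linarith)
        · calc (‖ξ‖ + t) ^ l ≤ ((1 + ‖ξ‖) * t) ^ l :=
                Real.rpow_le_rpow_of_nonpos (by positivity) (by nlinarith) hl0.le
            _ = (1 + ‖ξ‖) ^ l * t ^ l := Real.mul_rpow (by positivity) (by positivity)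
            _ ≤ _ := by
                gcongr
                have : 0 ≤ (1 + t) ^ l := by positivity
                linarith
    calc _ ≤ 4 ^ |l| * (Real.exp (-t) * t ^ l *
          ((1 + ‖ξ‖) ^ l * ((1 + t) ^ l + (1 + t ^ l)))) := by gcongr
      _ = _ := by
        have : t ^ (2 * l) = t ^ l * t ^ l := by rw [← Real.rpow_add ht]; ring_nf
        beta_reduce
        rw [this]
        ring

/-- At 0 the integrand behaves like t^l with l > -1, at infinity like t^{2l-1} with l < 0. -/
lemma integrableOn_rpow_mul_one_add_rpow {l : ℝ} (hl : -1 < l) (hl0 : l < 0) :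
    IntegrableOn (fun t : ℝ => t ^ l * (1 + t) ^ (l - 1)) (Set.Ioi 0) := by
  have hm : AEStronglyMeasurable (fun t : ℝ => t ^ l * (1 + t) ^ (l - 1))
      (volume.restrict (Set.Ioi 0)) := by
    refine ContinuousOn.aestronglyMeasurable (fun t ht => ?_) measurableSet_Ioi
    have ht' : (0 : ℝ) < t := ht
    refine ContinuousAt.continuousWithinAt (ContinuousAt.mul ?_ ?_)
    · exact Real.continuousAt_rpow_const _ _ (Or.inl ht'.ne')
    · exact ContinuousAt.rpow_const (by fun_prop) (Or.inl (by positivity))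
  rw [← Set.Ioc_union_Ioi_eq_Ioi zero_le_one]
  refine IntegrableOn.union ?_ ?_
  · have h1 : IntegrableOn (fun t : ℝ => t ^ l) (Set.Ioc 0 1) :=
      (intervalIntegrable_iff_integrableOn_Ioc_of_le zero_le_one).1
        (intervalIntegral.intervalIntegrable_rpow' hl)
    refine Integrable.mono' h1 (hm.mono_measure (Measure.restrict_mono (fun _ hy => hy.1) le_rfl)) ?_
    rw [ae_restrict_iff' measurableSet_Ioc]
    refine Eventually.of_forall fun t ht => ?_
    have := ht.1
    rw [Real.norm_of_nonneg (by positivity)]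
    exact mul_le_of_le_one_right (by positivity)
      (Real.rpow_le_one_of_one_le_of_nonpos (by linarith) (by linarith))
  · refine Integrable.mono' (integrableOn_Ioi_rpow_of_lt (by linarith : 2 * l - 1 < -1) one_pos)
      (hm.mono_measure (Measure.restrict_mono (Set.Ioi_subset_Ioi zero_le_one) le_rfl)) ?_
    rw [ae_restrict_iff' measurableSet_Ioi]
    refine Eventually.of_forall fun t (ht : 1 < t) => ?_
    have ht0 : 0 < t := by linarith
    rw [Real.norm_of_nonneg (by positivity)]
    calc _ ≤ t ^ l * t ^ (l - 1) := by
          refine mul_le_mul_of_nonneg_left ?_ (by positivity)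
          exact Real.rpow_le_rpow_of_nonpos ht0 (by linarith) (by linarith)
      _ = _ := by rw [← Real.rpow_add ht0]; ring_nf

lemma rpow_mul_add_rpow_scaling {l s t : ℝ} (hs : 0 < s) (ht : 0 < t) :
    (s * t) ^ l * (s + s * t) ^ (l - 1) = s ^ (2 * l - 1) * (t ^ l * (1 + t) ^ (l - 1)) := by
  have h1 : s + s * t = s * (1 + t) := by ring
  have h2 : s ^ (2 * l - 1) = s ^ l * s ^ (l - 1) := by rw [← Real.rpow_add hs]; ring_nf
  rw [h1, Real.mul_rpow hs.le ht.le, Real.mul_rpow hs.le (by positivity), h2]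
  ring

lemma integral_rpow_mul_add_rpow {l : ℝ} (hl : -1 < l) (hl0 : l < 0) {s : ℝ} (hs : 0 < s) :
    IntegrableOn (fun t : ℝ => t ^ l * (s + t) ^ (l - 1)) (Set.Ioi 0) ∧
    ∫ t in Set.Ioi (0 : ℝ), t ^ l * (s + t) ^ (l - 1) =
      s ^ (2 * l) * ∫ t in Set.Ioi (0 : ℝ), t ^ l * (1 + t) ^ (l - 1) := by
  have he : Set.EqOn (fun t => s ^ (2 * l - 1) * (t ^ l * (1 + t) ^ (l - 1)))
      (fun t => (s * t) ^ l * (s + s * t) ^ (l - 1)) (Set.Ioi 0) :=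
    fun t ht => (rpow_mul_add_rpow_scaling hs ht).symm
  have hi := IntegrableOn.congr_fun ((integrableOn_rpow_mul_one_add_rpow hl hl0).const_mul
    (s ^ (2 * l - 1))) he measurableSet_Ioi
  have hi2 := (integrableOn_Ioi_comp_mul_left_iff (fun t => t ^ l * (s + t) ^ (l - 1)) 0 hs).1 hi
  rw [mul_zero] at hi2
  refine ⟨hi2, ?_⟩
  have h2 := integral_comp_mul_left_Ioi (fun t => t ^ l * (s + t) ^ (l - 1)) 0 hs
  rw [← setIntegral_congr_fun measurableSet_Ioi he, integral_const_mul, mul_zero, smul_eq_mul,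
    eq_inv_mul_iff_mul_eq₀ hs.ne'] at h2
  rw [← h2, ← mul_assoc]
  congr 1
  rw [Real.rpow_sub_one hs.ne']
  field_simp

/-- The behaviour at ξ = 0 depends on the sign of l. For l < 0 dropping e^{-t} and rescaling gives
|ξ|^{2l}; for l > 0 the integral stays bounded since t^{2l-1} is integrable at 0. For l = 0 absolute
values would give a logarithmic divergence, but the prefactor l vanishes, which is why it is kept
inside the norm. -/
lemma exists_norm_mul_hankelInt_pred_le {l : ℝ} (hl : -(1 / 2) < l) :
    ∃ C > 0, ∀ ξ : ℂ, 0 ≤ ξ.im → ξ ≠ 0 → ‖(l : ℂ) * hankelInt l (l - 1) ξ‖ ≤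
      C * (‖ξ‖ ^ (min 0 (2 * l)) * (1 + ‖ξ‖) ^ (l - min 0 (2 * l))) := by
  have hgen : ∀ ξ : ℂ, 0 ≤ ξ.im → ∀ {Φ : ℝ → ℝ}, IntegrableOn Φ (Set.Ioi 0) →
      (∀ t > 0, Real.exp (-t) * t ^ l * (‖ξ‖ + t) ^ (l - 1) ≤ Φ t) →
      ‖(l : ℂ) * hankelInt l (l - 1) ξ‖ ≤ |l| * (4 ^ |l - 1| * ∫ t in Set.Ioi 0, Φ t) := by
    intro ξ hξ Φ hΦ hle
    rw [norm_mul, Complex.norm_real, Real.norm_eq_abs, ← integral_const_mul]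
    refine mul_le_mul_of_nonneg_left ?_ (abs_nonneg l)
    refine norm_integral_le_of_norm_le (hΦ.const_mul _) ?_
    rw [ae_restrict_iff' measurableSet_Ioi]
    refine Eventually.of_forall fun t ht => (norm_hankel_integrand_le hξ (l - 1) ht).trans ?_
    exact mul_le_mul_of_nonneg_left (hle t ht) (by positivity)
  rcases lt_trichotomy l 0 with hl0 | hl0 | hl0
  · have hJ : 0 ≤ ∫ t in Set.Ioi (0 : ℝ), t ^ l * (1 + t) ^ (l - 1) :=
      setIntegral_nonneg measurableSet_Ioi fun t (ht : 0 < t) => by positivity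
    refine ⟨|l| * (4 ^ |l - 1| * ∫ t in Set.Ioi (0 : ℝ), t ^ l * (1 + t) ^ (l - 1)) + 1,
      by positivity, fun ξ hξ hξ0 => ?_⟩
    have hs : 0 < ‖ξ‖ := norm_pos_iff.2 hξ0
    obtain ⟨hi, he⟩ := integral_rpow_mul_add_rpow (by linarith : -1 < l) hl0 hs
    have h1 := hgen ξ hξ hi fun t ht => by
      rw [mul_assoc]
      exact mul_le_of_le_one_left (by positivity) (Real.exp_le_one_iff.2 (by linarith))
    rw [he] at h1
    rw [min_eq_right (by linarith)]
    have h2 : 1 ≤ (1 + ‖ξ‖) ^ (l - 2 * l) := Real.one_le_rpow (by linarith) (by linarith)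
    calc _ ≤ _ := h1
      _ = |l| * (4 ^ |l - 1| * ∫ t in Set.Ioi (0 : ℝ), t ^ l * (1 + t) ^ (l - 1)) *
          (‖ξ‖ ^ (2 * l) * 1) := by ring
      _ ≤ _ := by
        gcongr
        linarith
  · refine ⟨1, one_pos, fun ξ _ _ => ?_⟩
    rw [hl0, Complex.ofReal_zero, zero_mul, norm_zero]
    positivity
  · have hint : IntegrableOn (fun t => Real.exp (-t) * t ^ l * (1 + t) ^ l +
        Real.exp (-t) * t ^ (2 * l - 1)) (Set.Ioi 0) :=
      (integrableOn_exp_rpow_mul (by linarith) one_pos l).add (integrableOn_exp_rpow (by linarith))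
    have hnn : 0 ≤ ∫ t in Set.Ioi (0 : ℝ), (Real.exp (-t) * t ^ l * (1 + t) ^ l +
        Real.exp (-t) * t ^ (2 * l - 1)) :=
      setIntegral_nonneg measurableSet_Ioi fun t (ht : 0 < t) => by positivity
    refine ⟨|l| * (4 ^ |l - 1| * ∫ t in Set.Ioi (0 : ℝ), (Real.exp (-t) * t ^ l * (1 + t) ^ l +
        Real.exp (-t) * t ^ (2 * l - 1))) + 1, by positivity, fun ξ hξ hξ0 => ?_⟩
    rw [min_eq_left (by linarith), Real.rpow_zero, one_mul, sub_zero]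
    have hs := norm_nonneg ξ
    have h1 := hgen ξ hξ (hint.const_mul ((1 + ‖ξ‖) ^ l)) fun t ht => by
      have h2 : (‖ξ‖ + t) ^ (l - 1) ≤ (1 + ‖ξ‖) ^ l * ((1 + t) ^ l + t ^ (l - 1)) := by
        rcases le_or_gt 1 l with hl1 | hl1
        · calc (‖ξ‖ + t) ^ (l - 1) ≤ ((1 + ‖ξ‖) * (1 + t)) ^ (l - 1) :=
                Real.rpow_le_rpow (by positivity) (by nlinarith) (by linarith)
            _ ≤ ((1 + ‖ξ‖) * (1 + t)) ^ l :=
                Real.rpow_le_rpow_of_exponent_le (by nlinarith) (by linarith)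
            _ = (1 + ‖ξ‖) ^ l * (1 + t) ^ l := Real.mul_rpow (by positivity) (by positivity)
            _ ≤ _ := by
                gcongr
                exact le_add_of_nonneg_right (by positivity)
        · calc (‖ξ‖ + t) ^ (l - 1) ≤ t ^ (l - 1) :=
                Real.rpow_le_rpow_of_nonpos ht (by linarith) (by linarith)
            _ ≤ (1 + t) ^ l + t ^ (l - 1) := le_add_of_nonneg_left (by positivity)
            _ ≤ _ := le_mul_of_one_le_left (by positivity)
                (Real.one_le_rpow (by linarith) (by linarith))
      calc _ ≤ Real.exp (-t) * t ^ l * ((1 + ‖ξ‖) ^ l * ((1 + t) ^ l + t ^ (l - 1))) := by gcongr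
        _ = _ := by
          have : t ^ (2 * l - 1) = t ^ l * t ^ (l - 1) := by rw [← Real.rpow_add ht]; ring_nf
          rw [this]
          ring
    rw [integral_const_mul] at h1
    calc _ ≤ _ := h1
      _ = |l| * (4 ^ |l - 1| * ∫ t in Set.Ioi (0 : ℝ), (Real.exp (-t) * t ^ l * (1 + t) ^ l +
          Real.exp (-t) * t ^ (2 * l - 1))) * (1 + ‖ξ‖) ^ l := by ring
      _ ≤ _ := by
        gcongr
        linarith

/-- On the negative axis the principal logarithm is continuous from above; this covers negative real
momenta. -/
lemma continuousWithinAt_cpow_closedUpperHalfPlane {k : ℂ} (hk0 : k ≠ 0) (c : ℂ) :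
    ContinuousWithinAt (fun z : ℂ => z ^ c) closedUpperHalfPlane k := by
  by_cases hs : k ∈ Complex.slitPlane
  · exact (continuousAt_cpow_const hs).continuousWithinAt
  · rw [Complex.mem_slitPlane_iff, not_or, not_lt, not_not] at hs
    have hre : k.re < 0 := lt_of_le_of_ne hs.1 fun h0 => hk0 (Complex.ext h0 hs.2)
    have hlog := Complex.continuousWithinAt_log_of_re_neg_of_im_zero hre hs.2
    have h1 : ContinuousWithinAt (fun z : ℂ => Complex.exp (Complex.log z * c))
        closedUpperHalfPlane k :=
      Complex.continuous_exp.continuousAt.comp_continuousWithinAt (hlog.mul continuousWithinAt_const)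
    refine h1.congr_of_eventuallyEq ?_ (Complex.cpow_def_of_ne_zero hk0 c)
    filter_upwards [mem_nhdsWithin_of_mem_nhds (isOpen_ne.mem_nhds hk0)] with z hz
    exact Complex.cpow_def_of_ne_zero hz c

lemma ofReal_mul_cpow {x : ℝ} (hx : 0 < x) {w : ℂ} (hw : w ≠ 0) (p : ℝ) :
    ((x : ℂ) * w) ^ (p : ℂ) = ((x ^ p : ℝ) : ℂ) * w ^ (p : ℂ) := by
  have hxc : (x : ℂ) ≠ 0 := by exact_mod_cast hx.ne'
  rw [Complex.cpow_def_of_ne_zero (mul_ne_zero hxc hw), Complex.cpow_def_of_ne_zero hw,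
    Complex.log_ofReal_mul hx hw, add_mul, Complex.exp_add, Real.rpow_def_of_pos hx]
  push_cast
  rfl

lemma ofReal_mul_im_nonneg {k : ℂ} (hk : 0 ≤ k.im) {x : ℝ} (hx : 0 < x) :
    0 ≤ ((x : ℂ) * k).im := by
  rw [Complex.im_ofReal_mul]
  positivity

/-- By homogeneity the expression equals ∫ e^{-t} t^l (k + it/(2x))^p dt, and dominated convergence
replaces the power by k^p. -/
lemma tendsto_hankelInt_atTop {l : ℝ} (hl : -1 < l) (p : ℝ) {k : ℂ} (hk : 0 ≤ k.im) (hk0 : k ≠ 0) :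
    Tendsto (fun x : ℝ => ((x ^ (-p) : ℝ) : ℂ) * hankelInt l p (x * k)) atTop
      (𝓝 (k ^ (p : ℂ) * Real.Gamma (l + 1))) := by
  have hn : 0 < ‖k‖ := norm_pos_iff.2 hk0
  have e1 : ∀ x > 0, ((x ^ (-p) : ℝ) : ℂ) * hankelInt l p (x * k) =
      ∫ t in Set.Ioi (0 : ℝ), ((Real.exp (-t) * t ^ l : ℝ) : ℂ) * upShift k (t / x) ^ (p : ℂ) := by
    intro x hx
    have hxc : (x : ℂ) ≠ 0 := by exact_mod_cast hx.ne'
    rw [hankelInt, ← integral_const_mul]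
    refine setIntegral_congr_fun measurableSet_Ioi fun t (ht : 0 < t) => ?_
    have h1 : upShift (x * k) t = x * upShift k (t / x) := by
      simp only [upShift]
      push_cast
      field_simp
    have h2 : upShift k (t / x) ≠ 0 :=
      Complex.slitPlane_ne_zero (upShift_mem_slitPlane hk (by positivity))
    have h3 : ((x ^ (-p) : ℝ) : ℂ) * ((x ^ p : ℝ) : ℂ) = 1 := by
      rw [← Complex.ofReal_mul, ← Real.rpow_add hx, neg_add_cancel, Real.rpow_zero,
        Complex.ofReal_one]
    rw [h1, ofReal_mul_cpow hx h2]
    linear_combination (((Real.exp (-t) * t ^ l : ℝ) : ℂ) * upShift k (t / x) ^ (p : ℂ)) * h3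
  have e2 : k ^ (p : ℂ) * Real.Gamma (l + 1) =
      ∫ t in Set.Ioi (0 : ℝ), ((Real.exp (-t) * t ^ l : ℝ) : ℂ) * k ^ (p : ℂ) := by
    rw [integral_mul_const, integral_complex_ofReal, Real.Gamma_eq_integral (by linarith)]
    simp only [add_sub_cancel_right]
    ring
  rw [e2]
  have hmain : Tendsto (fun x : ℝ => ∫ t in Set.Ioi (0 : ℝ),
      ((Real.exp (-t) * t ^ l : ℝ) : ℂ) * upShift k (t / x) ^ (p : ℂ)) atTop
      (𝓝 (∫ t in Set.Ioi (0 : ℝ), ((Real.exp (-t) * t ^ l : ℝ) : ℂ) * k ^ (p : ℂ))) := by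
    refine tendsto_integral_filter_of_dominated_convergence
      (fun t => 4 ^ |p| * (‖k‖ ^ p * (Real.exp (-t) * t ^ l) +
        Real.exp (-t) * t ^ l * (‖k‖ + t) ^ p)) ?_ ?_ ?_ ?_
    · filter_upwards [eventually_gt_atTop 0] with x hx
      refine ContinuousOn.aestronglyMeasurable (ContinuousOn.mul ?_ ?_) measurableSet_Ioi
      · intro t ht
        refine (Complex.continuous_ofReal.continuousAt.comp ?_).continuousWithinAt
        exact ContinuousAt.mul (by fun_prop)
          (Real.continuousAt_rpow_const _ _ (Or.inl (ne_of_gt ht)))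
      · exact (continuousOn_upShift_cpow hk p).comp (continuous_id.div_const x).continuousOn
          fun t (ht : 0 < t) => div_pos ht hx
    · filter_upwards [eventually_ge_atTop 1] with x hx
      have hx0 : 0 < x := by linarith
      rw [ae_restrict_iff' measurableSet_Ioi]
      refine Eventually.of_forall fun t (ht : 0 < t) => ?_
      rw [norm_mul, Complex.norm_real, Real.norm_of_nonneg (by positivity)]
      have h1 : ‖upShift k (t / x) ^ (p : ℂ)‖ ≤ 4 ^ |p| * (‖k‖ ^ p + (‖k‖ + t) ^ p) := by
        refine (norm_upShift_cpow_le hk (by positivity) p).trans ?_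
        gcongr
        have h2 : t / x ≤ t := div_le_self ht.le hx
        have h3 : 0 < t / x := by positivity
        simpa using rpow_add_le_of_mem_Icc (c := ‖k‖) (d := ‖k‖ + t) (s := ‖k‖ + t / x) (t := 0) hn
          ⟨by linarith, by linarith⟩ le_rfl p
      calc _ ≤ Real.exp (-t) * t ^ l * (4 ^ |p| * (‖k‖ ^ p + (‖k‖ + t) ^ p)) := by gcongr
        _ = _ := by ring
    · exact (((integrableOn_exp_rpow hl).const_mul _).add
        (integrableOn_exp_rpow_mul hl hn p)).const_mul _
    · rw [ae_restrict_iff' measurableSet_Ioi]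
      refine Eventually.of_forall fun t (ht : 0 < t) => ?_
      refine Tendsto.const_mul _ ?_
      have h1 : Tendsto (fun x : ℝ => upShift k (t / x)) atTop (𝓝[closedUpperHalfPlane] k) := by
        refine tendsto_nhdsWithin_iff.2 ⟨?_, ?_⟩
        · have h2 : Tendsto (fun x : ℝ => t / x) atTop (𝓝 0) := tendsto_const_nhds.div_atTop tendsto_id
          have h3 : Continuous (upShift k) := by unfold upShift; fun_prop
          have h4 := (h3.tendsto 0).comp h2
          have h5 : upShift k 0 = k := by simp [upShift]
          rwa [h5] at h4
        · filter_upwards [eventually_gt_atTop 0] with x hx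
          have : 0 ≤ (upShift k (t / x)).im := by rw [upShift_im]; positivity
          exact this
      exact (continuousWithinAt_cpow_closedUpperHalfPlane hk0 p).tendsto.comp h1
  refine hmain.congr' ?_
  filter_upwards [eventually_gt_atTop 0] with x hx using (e1 x hx).symm

/-! ### The free Jost solution -/

/-- The function `g` for which `x^{-l} g(kx)` is the free Jost solution, multiplied by `k^l`. -/
def freeJost (l : ℝ) (ξ : ℂ) : ℂ :=
  ((Real.Gamma (l + 1))⁻¹ : ℝ) * (Complex.exp (Complex.I * ξ) * hankelInt l l ξ)

/-- The derivative of `freeJost`. -/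
def freeJostDeriv (l : ℝ) (ξ : ℂ) : ℂ :=
  ((Real.Gamma (l + 1))⁻¹ : ℝ) * (Complex.exp (Complex.I * ξ) *
    (Complex.I * hankelInt l l ξ + l * hankelInt l (l - 1) ξ))

section FreeJost

variable {l : ℝ}

lemma hasDerivWithinAt_cexp_I_mul (ξ : ℂ) (s : Set ℂ) :
    HasDerivWithinAt (fun ξ => Complex.exp (Complex.I * ξ))
      (Complex.exp (Complex.I * ξ) * Complex.I) s ξ := by
  have := ((hasDerivAt_id ξ).const_mul Complex.I).cexp.hasDerivWithinAt (s := s)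
  simpa using this

lemma hasDerivWithinAt_freeJost (hl : -1 < l) {ξ : ℂ} (hξ : 0 ≤ ξ.im) (hξ0 : ξ ≠ 0) :
    HasDerivWithinAt (freeJost l) (freeJostDeriv l ξ) closedUpperHalfPlane ξ := by
  have := ((hasDerivWithinAt_cexp_I_mul ξ closedUpperHalfPlane).mul
    (hasDerivWithinAt_hankelInt hl l hξ hξ0)).const_mul (((Real.Gamma (l + 1))⁻¹ : ℝ) : ℂ)
  refine this.congr_deriv ?_
  rw [freeJostDeriv]
  ring

/-- The second order equation for g is l times the identity `hankelInt_ode`, multiplied by e^{iξ}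
and divided by ξ. -/
lemma hasDerivWithinAt_freeJostDeriv (hl : -1 < l) {ξ : ℂ} (hξ : 0 ≤ ξ.im) (hξ0 : ξ ≠ 0) :
    HasDerivWithinAt (freeJostDeriv l) (2 * l / ξ * freeJostDeriv l ξ - freeJost l ξ)
      closedUpperHalfPlane ξ := by
  have := ((hasDerivWithinAt_cexp_I_mul ξ closedUpperHalfPlane).mul
    (((hasDerivWithinAt_hankelInt hl l hξ hξ0).const_mul Complex.I).add
    ((hasDerivWithinAt_hankelInt hl (l - 1) hξ hξ0).const_mul (l : ℂ)))).const_mul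
    (((Real.Gamma (l + 1))⁻¹ : ℝ) : ℂ)
  refine this.congr_deriv ?_
  have hode := hankelInt_ode hl hξ hξ0
  have e : l - 1 - 1 = l - 2 := by ring
  rw [freeJostDeriv, freeJost, e]
  simp only [Pi.add_apply]
  push_cast
  field_simp
  linear_combination ((Real.Gamma (l + 1) : ℂ))⁻¹ * ((ξ * hankelInt l l ξ) * Complex.I_sq - (l : ℂ) * hode)

lemma norm_cexp_I_mul (ξ : ℂ) : ‖Complex.exp (Complex.I * ξ)‖ = Real.exp (-ξ.im) := by
  rw [Complex.norm_exp]
  simp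

/-- In the derivative the bound (1+|ξ|)^l for the first term is absorbed into the second one,
because m ≤ 0 gives (1+|ξ|)^m ≤ |ξ|^m. -/
lemma exists_norm_freeJost_le (hl : -(1 / 2) < l) : ∃ C > 0, ∀ ξ : ℂ, 0 ≤ ξ.im → ξ ≠ 0 →
    ‖freeJost l ξ‖ ≤ C * (1 + ‖ξ‖) ^ l * Real.exp (-ξ.im) ∧
    ‖freeJostDeriv l ξ‖ ≤ C * (‖ξ‖ ^ (min 0 (2 * l)) * (1 + ‖ξ‖) ^ (l - min 0 (2 * l))) *
      Real.exp (-ξ.im) := by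
  obtain ⟨Φ, hΦ, hΦ0, hb⟩ := exists_norm_hankelInt_le hl
  obtain ⟨C₂, hC₂, hb₂⟩ := exists_norm_mul_hankelInt_pred_le hl
  have hG : 0 < Real.Gamma (l + 1) := Real.Gamma_pos_of_pos (by linarith)
  set C₁ := ∫ t in Set.Ioi 0, Φ t
  have hC₁ : 0 ≤ C₁ := setIntegral_nonneg measurableSet_Ioi hΦ0
  refine ⟨(Real.Gamma (l + 1))⁻¹ * (C₁ + C₂), by positivity, fun ξ hξ hξ0 => ?_⟩
  have hs : 0 < ‖ξ‖ := norm_pos_iff.2 hξ0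
  have h1 : ‖hankelInt l l ξ‖ ≤ C₁ * (1 + ‖ξ‖) ^ l := by
    rw [mul_comm, ← integral_const_mul]
    refine norm_integral_le_of_norm_le (hΦ.const_mul _) ?_
    rw [ae_restrict_iff' measurableSet_Ioi]
    exact Eventually.of_forall fun t ht => hb ξ hξ t ht
  have h2 := hb₂ ξ hξ hξ0
  set m := min 0 (2 * l)
  have hm : m ≤ 0 := min_le_left _ _
  have h3 : (1 + ‖ξ‖) ^ l ≤ ‖ξ‖ ^ m * (1 + ‖ξ‖) ^ (l - m) := by
    calc (1 + ‖ξ‖) ^ l = (1 + ‖ξ‖) ^ m * (1 + ‖ξ‖) ^ (l - m) := by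
          rw [← Real.rpow_add (by positivity)]; ring_nf
      _ ≤ _ := by
          refine mul_le_mul_of_nonneg_right ?_ (by positivity)
          exact Real.rpow_le_rpow_of_nonpos hs (by linarith) hm
  constructor
  · rw [freeJost, norm_mul, norm_mul, norm_cexp_I_mul, Complex.norm_real,
      Real.norm_of_nonneg (by positivity)]
    calc _ ≤ (Real.Gamma (l + 1))⁻¹ * (Real.exp (-ξ.im) * (C₁ * (1 + ‖ξ‖) ^ l)) := by gcongr
      _ ≤ (Real.Gamma (l + 1))⁻¹ * (Real.exp (-ξ.im) * ((C₁ + C₂) * (1 + ‖ξ‖) ^ l)) := by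
        gcongr
        linarith
      _ = _ := by ring
  · rw [freeJostDeriv, norm_mul, norm_mul, norm_cexp_I_mul, Complex.norm_real,
      Real.norm_of_nonneg (by positivity)]
    have h4 : ‖Complex.I * hankelInt l l ξ + l * hankelInt l (l - 1) ξ‖ ≤
        (C₁ + C₂) * (‖ξ‖ ^ m * (1 + ‖ξ‖) ^ (l - m)) := by
      refine (norm_add_le _ _).trans ?_
      rw [norm_mul Complex.I, Complex.norm_I, one_mul, add_mul]
      exact add_le_add (h1.trans (by gcongr)) h2
    calc _ ≤ (Real.Gamma (l + 1))⁻¹ * (Real.exp (-ξ.im) *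
          ((C₁ + C₂) * (‖ξ‖ ^ m * (1 + ‖ξ‖) ^ (l - m)))) := by gcongr
      _ = _ := by ring

lemma continuousWithinAt_freeJost_zero (hl : -(1 / 2) < l) :
    ContinuousWithinAt (freeJost l) closedUpperHalfPlane 0 := by
  obtain ⟨Φ, hΦ, hΦ0, hb⟩ := exists_norm_hankelInt_le hl
  have h1 : ContinuousWithinAt (hankelInt l l) closedUpperHalfPlane 0 := by
    refine continuousWithinAt_of_dominated (bound := fun t => (1 + 2 ^ l) * Φ t) ?_ ?_
      (hΦ.const_mul _) ?_
    · filter_upwards [self_mem_nhdsWithin] with ξ hξ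
      exact aestronglyMeasurable_hankel hξ l
    · filter_upwards [self_mem_nhdsWithin,
        mem_nhdsWithin_of_mem_nhds (Metric.ball_mem_nhds 0 one_pos)] with ξ hξ hξ1
      rw [mem_ball_zero_iff] at hξ1
      rw [ae_restrict_iff' measurableSet_Ioi]
      refine Eventually.of_forall fun t ht => (hb ξ hξ t ht).trans ?_
      refine mul_le_mul_of_nonneg_right ?_ (hΦ0 t ht)
      have := rpow_add_le_of_mem_Icc (c := 1) (d := 2) (s := 1 + ‖ξ‖) (t := 0) one_pos
        ⟨by linarith [norm_nonneg ξ], by linarith⟩ le_rfl l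
      simpa using this
    · rw [ae_restrict_iff' measurableSet_Ioi]
      refine Eventually.of_forall fun t (ht : 0 < t) => ContinuousAt.continuousWithinAt ?_
      refine continuousAt_const.mul ?_
      refine ContinuousAt.comp (f := fun ξ => upShift ξ t)
        (continuousAt_cpow_const (upShift_mem_slitPlane (by simp) ht)) ?_
      unfold upShift
      fun_prop
  refine continuousWithinAt_const.mul (ContinuousWithinAt.mul ?_ h1)
  exact (by fun_prop : Continuous fun ξ => Complex.exp (Complex.I * ξ)).continuousWithinAt

end FreeJost

/-! ### The free solution x^{-l} g(kx) and its behaviour at 0 and at infinity. -/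

section FreeJostSolution

variable {l : ℝ} {k : ℂ}

/-- The Jost solution of the free equation, multiplied by `k^l`. -/
def freeJostSol (l : ℝ) (k : ℂ) (x : ℝ) : ℂ := ((x ^ (-l) : ℝ) : ℂ) * freeJost l (x * k)

/-- The derivative of `freeJostSol` in `x`. -/
def freeJostSolDeriv (l : ℝ) (k : ℂ) (x : ℝ) : ℂ :=
  ((-l * x ^ (-l - 1) : ℝ) : ℂ) * freeJost l (x * k) +
    ((x ^ (-l) : ℝ) : ℂ) * (k * freeJostDeriv l (x * k))

lemma hasDerivAt_comp_ofReal_mul {g : ℂ → ℂ} {g' : ℂ} (hk : 0 ≤ k.im) {x : ℝ} (hx : 0 < x)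
    (hg : HasDerivWithinAt g g' closedUpperHalfPlane (x * k)) :
    HasDerivAt (fun x : ℝ => g (x * k)) (k * g') x := by
  have h1 : HasDerivWithinAt (fun x : ℝ => (x : ℂ) * k) k (Set.Ioi 0) x := by
    simpa using ((hasDerivAt_id x).ofReal_comp.mul_const k).hasDerivWithinAt
  have h2 := HasDerivWithinAt.scomp (h := fun x : ℝ => (x : ℂ) * k) x hg h1
    fun y hy => ofReal_mul_im_nonneg hk hy
  exact h2.hasDerivAt (Ioi_mem_nhds hx)

lemma ofReal_mul_ne_zero (hk0 : k ≠ 0) {x : ℝ} (hx : 0 < x) : (x : ℂ) * k ≠ 0 :=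
  mul_ne_zero (by exact_mod_cast hx.ne') hk0

lemma hasDerivAt_freeJostSol (hl : -1 < l) (hk : 0 ≤ k.im) (hk0 : k ≠ 0) {x : ℝ} (hx : 0 < x) :
    HasDerivAt (freeJostSol l k) (freeJostSolDeriv l k x) x := by
  have h1 := (Real.hasDerivAt_rpow_const (p := -l) (Or.inl hx.ne')).ofReal_comp
  exact h1.mul (hasDerivAt_comp_ofReal_mul hk hx
    (hasDerivWithinAt_freeJost hl (ofReal_mul_im_nonneg hk hx) (ofReal_mul_ne_zero hk0 hx)))

lemma hasDerivAt_freeJostSolDeriv (hl : -1 < l) (hk : 0 ≤ k.im) (hk0 : k ≠ 0) {x : ℝ}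
    (hx : 0 < x) : HasDerivAt (freeJostSolDeriv l k)
      ((((l * (l + 1) / x ^ 2 : ℝ) : ℂ) - k ^ 2) * freeJostSol l k x) x := by
  have h1 := (Real.hasDerivAt_rpow_const (p := -l) (Or.inl hx.ne')).ofReal_comp
  have h2 := ((Real.hasDerivAt_rpow_const (p := -l - 1) (Or.inl hx.ne')).const_mul (-l)).ofReal_comp
  have hi := ofReal_mul_im_nonneg hk hx
  have hn := ofReal_mul_ne_zero hk0 hx
  have hxc : (x : ℂ) ≠ 0 := by exact_mod_cast hx.ne'
  have h3 := (h2.mul (hasDerivAt_comp_ofReal_mul hk hx (hasDerivWithinAt_freeJost hl hi hn))).add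
    (h1.mul ((hasDerivAt_comp_ofReal_mul hk hx (hasDerivWithinAt_freeJostDeriv hl hi hn)).const_mul
      k))
  refine h3.congr_deriv ?_
  rw [freeJostSol, Real.rpow_sub_one hx.ne', Real.rpow_sub_one hx.ne']
  push_cast
  field_simp
  ring

lemma isPrimitiveOn_freeJostSol (hl : -1 < l) (hk : 0 ≤ k.im) (hk0 : k ≠ 0) :
    IsPrimitiveOn (Set.Ioi 0) (freeJostSol l k) (freeJostSolDeriv l k) :=
  .of_hasDerivAt (fun _ hx => hasDerivAt_freeJostSol hl hk hk0 hx) fun _ hx =>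
    (hasDerivAt_freeJostSolDeriv hl hk hk0 hx).continuousAt.continuousWithinAt

lemma isPrimitiveOn_freeJostSolDeriv (hl : -1 < l) (hk : 0 ≤ k.im) (hk0 : k ≠ 0) :
    IsPrimitiveOn (Set.Ioi 0) (freeJostSolDeriv l k)
      (fun x => (((l * (l + 1) / x ^ 2 : ℝ) : ℂ) - k ^ 2) * freeJostSol l k x) := by
  refine .of_hasDerivAt (fun _ hx => hasDerivAt_freeJostSolDeriv hl hk hk0 hx) fun x hx => ?_
  have hx0 : x ≠ 0 := ne_of_gt hx
  refine ContinuousAt.continuousWithinAt (ContinuousAt.mul ?_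
    (hasDerivAt_freeJostSol hl hk hk0 hx).continuousAt)
  refine ContinuousAt.sub (Complex.continuous_ofReal.continuousAt.comp ?_) continuousAt_const
  fun_prop (disch := positivity)

lemma cexp_neg_mul_cexp (x : ℝ) :
    Complex.exp (-(Complex.I * k * x)) * Complex.exp (Complex.I * (x * k)) = 1 := by
  rw [← Complex.exp_add, ← Complex.exp_zero]
  ring_nf

lemma tendsto_freeJostSol_atTop (hl : -1 < l) (hk : 0 ≤ k.im) (hk0 : k ≠ 0) :
    Tendsto (fun x : ℝ => Complex.exp (-(Complex.I * k * x)) * freeJostSol l k x) atTop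
      (𝓝 (k ^ (l : ℂ))) := by
  have hG : (Real.Gamma (l + 1) : ℂ) ≠ 0 := by
    exact_mod_cast (Real.Gamma_pos_of_pos (by linarith)).ne'
  have h := (tendsto_hankelInt_atTop hl l hk hk0).const_mul ((Real.Gamma (l + 1) : ℂ))⁻¹
  rw [mul_comm (k ^ (l : ℂ)), inv_mul_cancel_left₀ hG] at h
  refine h.congr fun x => ?_
  rw [freeJostSol, freeJost]
  push_cast
  linear_combination (-((Real.Gamma (l + 1) : ℂ))⁻¹ * ((x ^ (-l) : ℝ) : ℂ) *
    hankelInt l l (x * k)) * cexp_neg_mul_cexp (k := k) x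

lemma tendsto_freeJostSolDeriv_atTop (hl : -1 < l) (hk : 0 ≤ k.im) (hk0 : k ≠ 0) :
    Tendsto (fun x : ℝ => Complex.exp (-(Complex.I * k * x)) * freeJostSolDeriv l k x) atTop
      (𝓝 (k ^ (l : ℂ) * (Complex.I * k))) := by
  have hG : (Real.Gamma (l + 1) : ℂ) ≠ 0 := by
    exact_mod_cast (Real.Gamma_pos_of_pos (by linarith)).ne'
  have hinv : Tendsto (fun x : ℝ => ((x⁻¹ : ℝ) : ℂ)) atTop (𝓝 ((0 : ℝ) : ℂ)) :=
    (Complex.continuous_ofReal.tendsto 0).comp tendsto_inv_atTop_zero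
  have h := ((hinv.const_mul (-(l : ℂ))).mul (tendsto_freeJostSol_atTop hl hk hk0)).add
    (((tendsto_freeJostSol_atTop hl hk hk0).const_mul (Complex.I * k)).add
      ((hinv.mul (tendsto_hankelInt_atTop hl (l - 1) hk hk0)).const_mul
        (k * l * ((Real.Gamma (l + 1) : ℂ))⁻¹)))
  simp only [Complex.ofReal_zero, mul_zero, zero_mul, zero_add, add_zero] at h
  rw [mul_comm (k ^ (l : ℂ))]
  refine h.congr' ?_
  filter_upwards [eventually_gt_atTop 0] with x hx
  have hxc : (x : ℂ) ≠ 0 := by exact_mod_cast hx.ne'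
  have e1 : x ^ (-l - 1) = x ^ (-l) * x⁻¹ := by rw [Real.rpow_sub_one hx.ne']; rfl
  have e2 : x ^ (-(l - 1)) = x ^ (-l) * x := by rw [← Real.rpow_add_one hx.ne']; ring_nf
  rw [freeJostSol, freeJostSolDeriv, freeJost, freeJostDeriv, e1, e2]
  push_cast
  have e3 : (x : ℂ)⁻¹ * x = 1 := inv_mul_cancel₀ hxc
  linear_combination (k * l * ((Real.Gamma (l + 1) : ℂ))⁻¹ * ((x ^ (-l) : ℝ) : ℂ) *
    hankelInt l (l - 1) (x * k)) * (e3 - cexp_neg_mul_cexp (k := k) x)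

lemma tendsto_ofReal_mul_zero (hk : 0 ≤ k.im) :
    Tendsto (fun x : ℝ => (x : ℂ) * k) (𝓝[>] 0) (𝓝[closedUpperHalfPlane] 0) := by
  refine tendsto_nhdsWithin_iff.2 ⟨?_, ?_⟩
  · have : Tendsto (fun x : ℝ => (x : ℂ) * k) (𝓝 0) (𝓝 (((0 : ℝ) : ℂ) * k)) :=
      (by fun_prop : Continuous fun x : ℝ => (x : ℂ) * k).tendsto 0
    rw [Complex.ofReal_zero, zero_mul] at this
    exact this.mono_left nhdsWithin_le_nhds
  · filter_upwards [self_mem_nhdsWithin] with x hx using ofReal_mul_im_nonneg hk hx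

/-- By the derivative bound the product is of order |ξ|^{1+m}, and 1+m > 0 because l > -1/2. -/
lemma tendsto_mul_freeJostDeriv_zero (hl : -(1 / 2) < l) (hk : 0 ≤ k.im) (hk0 : k ≠ 0) :
    Tendsto (fun x : ℝ => (x : ℂ) * k * freeJostDeriv l (x * k)) (𝓝[>] 0) (𝓝 0) := by
  obtain ⟨C, hC, hb⟩ := exists_norm_freeJost_le hl
  have hk1 : 0 < ‖k‖ := norm_pos_iff.2 hk0
  set m := min 0 (2 * l) with hm
  have hm1 : 0 < 1 + m := by
    have : -1 < m := lt_min (by norm_num) (by linarith)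
    linarith
  have hlim : Tendsto (fun x : ℝ => C * ((‖k‖ * x) ^ (1 + m) * (1 + ‖k‖ * x) ^ (l - m))) (𝓝[>] 0)
      (𝓝 (C * ((‖k‖ * 0) ^ (1 + m) * (1 + ‖k‖ * 0) ^ (l - m)))) := by
    have hc : ContinuousAt (fun x : ℝ => C * ((‖k‖ * x) ^ (1 + m) * (1 + ‖k‖ * x) ^ (l - m))) 0 := by
      refine continuousAt_const.mul (ContinuousAt.mul ?_ ?_)
      · exact ContinuousAt.rpow_const (by fun_prop) (Or.inr hm1.le)
      · exact ContinuousAt.rpow_const (by fun_prop) (Or.inl (by simp))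
    exact hc.tendsto.mono_left nhdsWithin_le_nhds
  rw [mul_zero, Real.zero_rpow hm1.ne', zero_mul, mul_zero] at hlim
  refine squeeze_zero_norm' ?_ hlim
  filter_upwards [self_mem_nhdsWithin] with x (hx : 0 < x)
  have hn : ‖(x : ℂ) * k‖ = ‖k‖ * x := by
    rw [norm_mul, Complex.norm_real, Real.norm_of_nonneg hx.le, mul_comm]
  have h1 := (hb _ (ofReal_mul_im_nonneg hk hx) (ofReal_mul_ne_zero hk0 hx)).2
  rw [norm_mul, hn]
  rw [hn] at h1
  have h2 : Real.exp (-((x : ℂ) * k).im) ≤ 1 :=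
    Real.exp_le_one_iff.2 (neg_nonpos.2 (ofReal_mul_im_nonneg hk hx))
  have hs : 0 < ‖k‖ * x := by positivity
  calc _ ≤ ‖k‖ * x * (C * ((‖k‖ * x) ^ m * (1 + ‖k‖ * x) ^ (l - m)) * 1) := by
        refine mul_le_mul_of_nonneg_left (h1.trans ?_) hs.le
        gcongr
    _ = _ := by
        rw [Real.rpow_add hs, Real.rpow_one]
        ring

end FreeJostSolution

/-! ### The integral representation of the Jost function and its derivative. -/

lemma integral_Ioi_eq_sub_of_isPrimitiveOn {F f : ℝ → ℂ} {a b : ℂ}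
    (hF : IsPrimitiveOn (Set.Ioi 0) F f) (hf : IntegrableOn f (Set.Ioi 0))
    (ha : Tendsto F (𝓝[>] 0) (𝓝 a)) (hb : Tendsto F atTop (𝓝 b)) :
    ∫ x in Set.Ioi 0, f x = b - a := by
  have h1 : Tendsto (fun x => F x - F 1) atTop (𝓝 (∫ x in Set.Ioi 1, f x)) := by
    refine (intervalIntegral_tendsto_integral_Ioi 1
      (hf.mono_set (Set.Ioi_subset_Ioi zero_le_one)) tendsto_id).congr' ?_
    filter_upwards [eventually_gt_atTop 0] with x hx
    exact (hF 1 (Set.mem_Ioi.2 one_pos) x hx).2.symm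
  have hi : IntegrableOn f (Set.Ioc 0 1) := hf.mono_set fun x hx => hx.1
  have h2 : Tendsto (fun x => F 1 - F x) (𝓝[>] 0) (𝓝 (∫ x in Set.Ioc 0 1, f x)) := by
    have h3 : Tendsto (fun x => (∫ t in (0 : ℝ)..1, f t) - ∫ t in (0 : ℝ)..x, f t) (𝓝[>] 0)
        (𝓝 ((∫ t in (0 : ℝ)..1, f t) - 0)) := tendsto_const_nhds.sub (by
      refine squeeze_zero_norm' ?_ (tendsto_integral_zero one_pos hi.norm)
      filter_upwards [self_mem_nhdsWithin] with x (hx : 0 < x)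
      exact intervalIntegral.norm_integral_le_integral_norm hx.le)
    rw [sub_zero, intervalIntegral.integral_of_le zero_le_one] at h3
    refine h3.congr' ?_
    filter_upwards [self_mem_nhdsWithin, mem_nhdsWithin_of_mem_nhds (Iio_mem_nhds one_pos)] with
      x (hx : 0 < x) (hx1 : x < 1)
    rw [(hF x hx 1 (Set.mem_Ioi.2 one_pos)).2,
      ← intervalIntegral.integral_of_le (μ := volume) (f := f) zero_le_one]
    refine intervalIntegral.integral_interval_sub_left ?_ ?_
    · exact (intervalIntegrable_iff_integrableOn_Ioc_of_le zero_le_one).2 hi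
    · exact (intervalIntegrable_iff_integrableOn_Ioc_of_le hx.le).2
        (hi.mono_set (Set.Ioc_subset_Ioc_right hx1.le))
  have e1 := tendsto_nhds_unique h1 (hb.sub_const _)
  have e2 := tendsto_nhds_unique h2 (ha.const_sub _)
  rw [← Set.Ioc_union_Ioi_eq_Ioi zero_le_one, setIntegral_union (Set.Ioc_disjoint_Ioi le_rfl)
    measurableSet_Ioi hi (hf.mono_set (Set.Ioi_subset_Ioi zero_le_one)), e1, e2]
  ring

/-- The integrand in the representation of the Jost function. -/
def jostIntegrand (l : ℝ) (q : ℝ → ℝ) (k : ℂ) (x : ℝ) : ℂ :=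
  (q x : ℂ) * (freeJostSol l k x * regSol l q (k ^ 2) x)

/-- The derivative of `jostIntegrand` in `k`. -/
def jostIntegrandDeriv (l : ℝ) (q : ℝ → ℝ) (k : ℂ) (x : ℝ) : ℂ :=
  (q x : ℂ) * (((x ^ (-l) : ℝ) : ℂ) * (x * freeJostDeriv l (x * k)) * regSol l q (k ^ 2) x +
        freeJostSol l k x * deriv (fun k => regSol l q (k ^ 2) x) k)

namespace Admissible

variable {l : ℝ} {q : ℝ → ℝ}

lemma aestronglyMeasurable_effPotential (h : Admissible l q) :
    AEStronglyMeasurable (effPotential l q) (volume.restrict (Set.Ioi 0)) :=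
  AEStronglyMeasurable.add (by
    refine ContinuousOn.aestronglyMeasurable (fun x hx => ?_) measurableSet_Ioi
    have hx0 : x ≠ 0 := ne_of_gt hx
    exact ContinuousAt.continuousWithinAt (by fun_prop (disch := positivity))) h.meas

lemma integrableOn_effPotential (h : Admissible l q) {a : ℝ} (ha : 0 < a) :
    IntegrableOn (effPotential l q) (Set.Ioi a) := by
  have hsub : Set.Ioi a ⊆ Set.Ioi 0 := Set.Ioi_subset_Ioi ha.le
  have hm := h.meas.mono_measure (Measure.restrict_mono hsub le_rfl)
  refine Integrable.add ?_ ?_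
  · refine IntegrableOn.congr_fun ((integrableOn_Ioi_rpow_of_lt (by norm_num : (-2 : ℝ) < -1)
      ha).const_mul (l * (l + 1))) (fun x (hx : a < x) => ?_) measurableSet_Ioi
    have hx0 : 0 < x := ha.trans hx
    rw [Real.rpow_neg hx0.le, div_eq_mul_inv]
    norm_num
  · refine Integrable.mono' ((h.int.mono_set hsub).const_mul a⁻¹) hm ?_
    rw [ae_restrict_iff' measurableSet_Ioi]
    refine Eventually.of_forall fun x (hx : a < x) => ?_
    rw [Real.norm_eq_abs, ← mul_assoc]
    refine le_mul_of_one_le_left (abs_nonneg _) ?_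
    rw [inv_mul_eq_div, one_le_div ha]
    exact hx.le

lemma isJostSolution_jostSolution (h : Admissible l q) {k : ℂ} (hk : 0 ≤ k.im) (hk0 : k ≠ 0) :
    IsJostSolution l q k (jostSolution l q k) :=
  Classical.epsilon_spec (exists_isJostSolution (fun _ hx => h.integrableOn_effPotential hx)
    h.aestronglyMeasurable_effPotential hk hk0)

lemma isRegularSolution_regularSolution (h : Admissible l q) (z : ℂ) :
    IsRegularSolution l q z (regularSolution l q z) :=
  Classical.epsilon_spec ⟨_, h.isRegularSolution_regSol z⟩

/-- The chosen regular solution agrees with `regSol` for x > 0, hence near 1, so that the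
derivatives at 1 agree as well. -/
lemma jostFunction_eq (h : Admissible l q) (k : ℂ) :
    jostFunction l q k = wronskian (jostSolution l q k) (regSol l q (k ^ 2)) 1 := by
  have heq : ∀ x > 0, regularSolution l q (k ^ 2) x = regSol l q (k ^ 2) x := fun x hx =>
    h.eq_regSol (h.isRegularSolution_regularSolution _) hx
  have hev : regularSolution l q (k ^ 2) =ᶠ[𝓝 1] regSol l q (k ^ 2) := by
    filter_upwards [Ioi_mem_nhds one_pos] with x hx using heq x hx
  rw [jostFunction, wronskian, wronskian, hev.deriv_eq, heq 1 one_pos]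

/-- The differences between the free solution and k^l times the Jost solution, and between their
derivatives, are o(e^{ikx}). The regular solution and its derivative are O(e^{x Im k}), so the
Wronskian of the difference tends to 0. -/
lemma tendsto_wronskian_atTop (h : Admissible l q) {k : ℂ} (hk : 0 ≤ k.im) (hk0 : k ≠ 0) :
    Tendsto (fun x => freeJostSol l k x * regSolDeriv l q (k ^ 2) x -
      freeJostSolDeriv l k x * regSol l q (k ^ 2) x) atTop
      (𝓝 (k ^ (l : ℂ) * jostFunction l q k)) := by
  have hl : -1 < l := by linarith [h.lower]
  have hk1 : 0 < ‖k‖ := norm_pos_iff.2 hk0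
  obtain ⟨hs, hf, hf'⟩ := h.isJostSolution_jostSolution hk hk0
  set f := jostSolution l q k
  set φ := regSol l q (k ^ 2)
  set φ' := regSolDeriv l q (k ^ 2)
  have d1 := (tendsto_freeJostSol_atTop hl hk hk0).sub (hf.const_mul (k ^ (l : ℂ)))
  have d2 := (tendsto_freeJostSolDeriv_atTop hl hk hk0).sub (hf'.const_mul (k ^ (l : ℂ)))
  rw [mul_one, sub_self] at d1
  rw [sub_self] at d2
  obtain ⟨C, hC, hb⟩ := h.exists_bound_far
  have hexp : ∀ x : ℝ, ‖Complex.exp (Complex.I * (x * k))‖ = Real.exp (-(k.im * x)) := fun x => by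
    rw [norm_cexp_I_mul, Complex.im_ofReal_mul, mul_comm]
  have hbd : ∀ x ≥ ‖k‖⁻¹, ‖Complex.exp (Complex.I * (x * k)) * φ' x‖ ≤ C * ‖k‖⁻¹ ^ l ∧
      ‖Complex.exp (Complex.I * (x * k)) * φ x‖ ≤ ‖k‖⁻¹ * (C * ‖k‖⁻¹ ^ l) := by
    intro x hx
    have h1 := hb k x hk0 hx
    rw [abs_of_nonneg hk] at h1
    have h2 : Real.exp (-(k.im * x)) * Real.exp (k.im * x) = 1 := by
      rw [← Real.exp_add, neg_add_cancel, Real.exp_zero]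
    have h3 : Real.exp (-(k.im * x)) * (‖φ' x‖ + ‖k‖ * ‖φ x‖) ≤ C * ‖k‖⁻¹ ^ l := by
      calc _ ≤ Real.exp (-(k.im * x)) * (C * ‖k‖⁻¹ ^ l * Real.exp (k.im * x)) := by gcongr
        _ = C * ‖k‖⁻¹ ^ l * (Real.exp (-(k.im * x)) * Real.exp (k.im * x)) := by ring
        _ = _ := by rw [h2, mul_one]
    have p1 : 0 ≤ Real.exp (-(k.im * x)) * ‖φ' x‖ := by positivity
    have p2 : 0 ≤ Real.exp (-(k.im * x)) * ‖φ x‖ := by positivity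
    rw [norm_mul, norm_mul, hexp]
    constructor
    · nlinarith
    · rw [inv_mul_eq_div, le_div_iff₀ hk1]
      linarith
  have b1 : IsBoundedUnder (· ≤ ·) atTop
      (norm ∘ fun x : ℝ => Complex.exp (Complex.I * (x * k)) * φ' x) := by
    refine isBoundedUnder_of_eventually_le (a := C * ‖k‖⁻¹ ^ l) ?_
    filter_upwards [eventually_ge_atTop ‖k‖⁻¹] with x hx using (hbd x hx).1
  have b2 : IsBoundedUnder (· ≤ ·) atTop
      (norm ∘ fun x : ℝ => Complex.exp (Complex.I * (x * k)) * φ x) := by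
    refine isBoundedUnder_of_eventually_le (a := ‖k‖⁻¹ * (C * ‖k‖⁻¹ ^ l)) ?_
    filter_upwards [eventually_ge_atTop ‖k‖⁻¹] with x hx using (hbd x hx).2
  have hlim := ((d1.zero_mul_isBoundedUnder_le b1).sub
    (d2.zero_mul_isBoundedUnder_le b2)).add_const (k ^ (l : ℂ) * jostFunction l q k)
  rw [sub_self, zero_add] at hlim
  refine hlim.congr' ?_
  filter_upwards [eventually_gt_atTop 0] with x hx
  have hW : jostFunction l q k = f x * φ' x - deriv f x * φ x := by
    rw [h.jostFunction_eq, ← hs.wronskian_eq (h.isSolution_regSol _) h.loc one_pos hx, wronskian,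
      (h.hasDerivAt_regSol _ hx).deriv]
  rw [hW]
  linear_combination ((freeJostSol l k x - k ^ (l : ℂ) * f x) * φ' x -
    (freeJostSolDeriv l k x - k ^ (l : ℂ) * deriv f x) * φ x) * cexp_neg_mul_cexp (k := k) x

/-- With u the profile of φ and ξ = xk, the powers of x cancel and the Wronskian is C_l((2l+1) g u +
g x u' - ξ g'(ξ) u). The last two terms vanish in the limit and u → 1. -/
lemma tendsto_wronskian_zero (h : Admissible l q) {k : ℂ} (hk : 0 ≤ k.im) (hk0 : k ≠ 0) :
    Tendsto (fun x => freeJostSol l k x * regSolDeriv l q (k ^ 2) x -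
      freeJostSolDeriv l k x * regSol l q (k ^ 2) x) (𝓝[>] 0)
      (𝓝 (normConst l * ((2 * l + 1) * freeJost l 0))) := by
  have hg : Tendsto (fun x : ℝ => freeJost l (x * k)) (𝓝[>] 0) (𝓝 (freeJost l 0)) :=
    (continuousWithinAt_freeJost_zero h.lower).tendsto.comp (tendsto_ofReal_mul_zero hk)
  have hg' := tendsto_mul_freeJostDeriv_zero h.lower hk hk0
  have hu := h.tendsto_regProfile (k ^ 2)
  have hu' := h.tendsto_mul_regProfileDeriv (k ^ 2)
  have hlim := ((((hg.const_mul (2 * (l : ℂ) + 1)).mul hu).add (hg.mul hu')).sub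
    (hg'.mul hu)).const_mul (normConst l : ℂ)
  rw [mul_one, mul_zero, zero_mul, add_zero, sub_zero] at hlim
  refine hlim.congr' ?_
  filter_upwards [self_mem_nhdsWithin] with x (hx : 0 < x)
  have hxc : (x : ℂ) ≠ 0 := by exact_mod_cast hx.ne'
  rw [freeJostSol, freeJostSolDeriv, regSol, regSolDeriv, Real.rpow_sub_one hx.ne',
    Real.rpow_add_one hx.ne']
  have e1 : ((x ^ (-l) : ℝ) : ℂ) * ((x ^ l : ℝ) : ℂ) = 1 := by
    rw [← Complex.ofReal_mul, ← Real.rpow_add hx, neg_add_cancel, Real.rpow_zero,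
      Complex.ofReal_one]
  push_cast
  have e2 : (x : ℂ) / x = 1 := div_self hxc
  linear_combination (-(normConst l * ((2 * l + 1) * freeJost l (x * k) * regProfile l q (k ^ 2) x +
    freeJost l (x * k) * (x * regProfileDeriv l q (k ^ 2) x) -
    x * k * freeJostDeriv l (x * k) * regProfile l q (k ^ 2) x)) : ℂ) * e1 -
    (((x ^ (-l) : ℝ) : ℂ) * ((x ^ l : ℝ) : ℂ) * (l * normConst l * freeJost l (x * k) *
      regProfile l q (k ^ 2) x)) * e2

/-- The products of free Jost and regular solutions are bounded uniformly in the momentum. -/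
lemma exists_norm_freeJostSol_mul_regSol_le (h : Admissible l q) : ∃ C > 0, ∀ (k : ℂ) (x : ℝ),
    0 ≤ k.im → k ≠ 0 → 0 < x → ‖freeJostSol l k x * regSol l q (k ^ 2) x‖ ≤ C * x ∧
      ‖((x ^ (-l) : ℝ) : ℂ) * (x * freeJostDeriv l (x * k)) * regSol l q (k ^ 2) x +
        freeJostSol l k x * deriv (fun k => regSol l q (k ^ 2) x) k‖ ≤
      C * x ^ 2 * ((‖k‖ * x) ^ min 0 (2 * l) * (1 + ‖k‖ * x) ^ (-1 - min 0 (2 * l))) := by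
  obtain ⟨C₁, hC₁, b₁⟩ := exists_norm_freeJost_le h.lower
  obtain ⟨C₂, hC₂, b₂⟩ := h.exists_norm_regSol_le
  obtain ⟨C₃, hC₃, b₃⟩ := h.exists_norm_deriv_regSol_le
  refine ⟨C₁ * (C₂ + C₃), by positivity, fun k x hk hk0 hx => ?_⟩
  have hk1 : 0 < ‖k‖ := norm_pos_iff.2 hk0
  obtain ⟨g, g'⟩ := b₁ _ (ofReal_mul_im_nonneg hk hx) (ofReal_mul_ne_zero hk0 hx)
  have φ := b₂ k x hx
  have φ' := b₃ k x hx
  rw [abs_of_nonneg hk] at φ φ'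
  have hn : ‖(x : ℂ) * k‖ = ‖k‖ * x := by
    rw [norm_mul, Complex.norm_real, Real.norm_of_nonneg hx.le, mul_comm]
  rw [hn, Complex.im_ofReal_mul, mul_comm x] at g g'
  set m := min 0 (2 * l)
  have hm : m ≤ 0 := min_le_left _ _
  have hs : 0 < ‖k‖ * x := by positivity
  set s := ‖k‖ * x
  have hexp : Real.exp (-(k.im * x)) * Real.exp (k.im * x) = 1 := by
    rw [← Real.exp_add, neg_add_cancel, Real.exp_zero]
  set E := Real.exp (k.im * x)
  set E' := Real.exp (-(k.im * x))
  have hE : 0 < E := Real.exp_pos _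
  have hE' : 0 < E' := Real.exp_pos _
  -- With s = |k|x this reduces each product to powers of x, s and 1+s: the growth (1+s)^l of g
  -- combines with (1+s)^{-l-1} to (1+s)^{-1}.
  have hX : x ^ (-l) * (x / (1 + s)) ^ (l + 1) = x * (1 + s) ^ (-l - 1) := by
    have e1 : x ^ (-l) * x ^ (l + 1) = x := by
      rw [← Real.rpow_add hx]
      ring_nf
      exact Real.rpow_one x
    have e2 : (1 + s) ^ (-l - 1) = ((1 + s) ^ (l + 1))⁻¹ := by
      rw [← Real.rpow_neg (by positivity)]; ring_nf
    rw [Real.div_rpow hx.le (by positivity), e2, ← mul_div_assoc, e1, div_eq_mul_inv]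
  have hp : ∀ p, (1 + s) ^ p * (1 + s) ^ (-l - 1) = (1 + s) ^ (p - l - 1) := fun p => by
    rw [← Real.rpow_add (by positivity)]; ring_nf
  have hψ : ‖freeJostSol l k x‖ ≤ x ^ (-l) * (C₁ * (1 + s) ^ l * E') := by
    rw [freeJostSol, norm_mul, Complex.norm_real, Real.norm_of_nonneg (by positivity)]
    gcongr
  have hψ' : ‖((x ^ (-l) : ℝ) : ℂ) * (x * freeJostDeriv l (x * k))‖ ≤
      x ^ (-l) * (x * (C₁ * (s ^ m * (1 + s) ^ (l - m)) * E')) := by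
    rw [norm_mul, norm_mul, Complex.norm_real, Complex.norm_real,
      Real.norm_of_nonneg (by positivity), Real.norm_of_nonneg hx.le]
    gcongr
  have hs1 : (1 + s) ^ (-1 : ℝ) ≤ 1 := Real.rpow_le_one_of_one_le_of_nonpos (by linarith) (by norm_num)
  have hs2 : (1 + s) ^ (-1 : ℝ) ≤ s ^ m * (1 + s) ^ (-1 - m) := by
    calc (1 + s) ^ (-1 : ℝ) = (1 + s) ^ m * (1 + s) ^ (-1 - m) := by
          rw [← Real.rpow_add (by positivity)]; ring_nf
      _ ≤ _ := by
          refine mul_le_mul_of_nonneg_right ?_ (by positivity)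
          exact Real.rpow_le_rpow_of_nonpos hs (by linarith) hm
  have hpl : (1 + s) ^ l * (1 + s) ^ (-l - 1) = (1 + s) ^ (-1 : ℝ) := by rw [hp]; ring_nf
  have hpm : (1 + s) ^ (l - m) * (1 + s) ^ (-l - 1) = (1 + s) ^ (-1 - m) := by rw [hp]; ring_nf
  have a1 : ‖freeJostSol l k x * regSol l q (k ^ 2) x‖ ≤ C₁ * C₂ * x * (1 + s) ^ (-1 : ℝ) := by
    rw [norm_mul]
    calc _ ≤ x ^ (-l) * (C₁ * (1 + s) ^ l * E') * (C₂ * (x / (1 + s)) ^ (l + 1) * E) := by gcongr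
      _ = C₁ * C₂ * (x ^ (-l) * (x / (1 + s)) ^ (l + 1)) * (1 + s) ^ l * (E' * E) := by ring
      _ = C₁ * C₂ * x * ((1 + s) ^ l * (1 + s) ^ (-l - 1)) := by rw [hX, hexp]; ring
      _ = _ := by rw [hpl]
  have a2 : ‖freeJostSol l k x * deriv (fun k => regSol l q (k ^ 2) x) k‖ ≤
      C₁ * C₃ * x ^ 2 * (1 + s) ^ (-1 : ℝ) := by
    rw [norm_mul]
    calc _ ≤ x ^ (-l) * (C₁ * (1 + s) ^ l * E') * (C₃ * x * (x / (1 + s)) ^ (l + 1) * E) := by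
          gcongr
      _ = C₁ * C₃ * x * (x ^ (-l) * (x / (1 + s)) ^ (l + 1)) * (1 + s) ^ l * (E' * E) := by ring
      _ = C₁ * C₃ * x ^ 2 * ((1 + s) ^ l * (1 + s) ^ (-l - 1)) := by rw [hX, hexp]; ring
      _ = _ := by rw [hpl]
  have a3 : ‖((x ^ (-l) : ℝ) : ℂ) * (x * freeJostDeriv l (x * k)) * regSol l q (k ^ 2) x‖ ≤
      C₁ * C₂ * x ^ 2 * (s ^ m * (1 + s) ^ (-1 - m)) := by
    rw [norm_mul]
    calc _ ≤ x ^ (-l) * (x * (C₁ * (s ^ m * (1 + s) ^ (l - m)) * E')) *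
          (C₂ * (x / (1 + s)) ^ (l + 1) * E) := by gcongr
      _ = C₁ * C₂ * x * (x ^ (-l) * (x / (1 + s)) ^ (l + 1)) * (s ^ m * (1 + s) ^ (l - m)) *
          (E' * E) := by ring
      _ = C₁ * C₂ * x ^ 2 * (s ^ m * ((1 + s) ^ (l - m) * (1 + s) ^ (-l - 1))) := by
          rw [hX, hexp]; ring
      _ = _ := by rw [hpm]
  constructor
  · calc _ ≤ _ := a1
      _ ≤ C₁ * C₂ * x * 1 := by gcongr
      _ ≤ C₁ * (C₂ + C₃) * x := by
        rw [mul_one]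
        gcongr
        linarith
  · calc _ ≤ _ := norm_add_le _ _
      _ ≤ C₁ * C₂ * x ^ 2 * (s ^ m * (1 + s) ^ (-1 - m)) +
          C₁ * C₃ * x ^ 2 * (s ^ m * (1 + s) ^ (-1 - m)) := by
        refine add_le_add a3 (a2.trans ?_)
        gcongr
      _ = _ := by ring

lemma hasDerivWithinAt_jostIntegrand (h : Admissible l q) {k : ℂ} (hk : 0 ≤ k.im) (hk0 : k ≠ 0)
    {x : ℝ} (hx : 0 < x) : HasDerivWithinAt (fun k => jostIntegrand l q k x)
      (jostIntegrandDeriv l q k x) closedUpperHalfPlane k := by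
  have hl : -1 < l := by linarith [h.lower]
  have h1 : HasDerivWithinAt (fun k : ℂ => (x : ℂ) * k) x closedUpperHalfPlane k := by
    simpa using ((hasDerivAt_id k).const_mul (x : ℂ)).hasDerivWithinAt
  have h2 := (hasDerivWithinAt_freeJost hl (ofReal_mul_im_nonneg hk hx)
    (ofReal_mul_ne_zero hk0 hx)).scomp (h := fun k : ℂ => (x : ℂ) * k) k h1
    fun w hw => ofReal_mul_im_nonneg hw hx
  exact ((h2.const_mul ((x ^ (-l) : ℝ) : ℂ)).mul
    (h.differentiable_regSol_sq hx k).hasDerivAt.hasDerivWithinAt).const_mul (q x : ℂ)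

lemma integrableOn_jostIntegrand (h : Admissible l q) {k : ℂ} (hk : 0 ≤ k.im) (hk0 : k ≠ 0) :
    IntegrableOn (jostIntegrand l q k) (Set.Ioi 0) := by
  obtain ⟨C, hC, hb⟩ := h.exists_norm_freeJostSol_mul_regSol_le
  refine Integrable.mono' (h.int.const_mul C) ?_ ?_
  · refine (Complex.continuous_ofReal.comp_aestronglyMeasurable h.meas).mul ?_
    refine ContinuousOn.aestronglyMeasurable (fun x hx => ?_) measurableSet_Ioi
    exact ((hasDerivAt_freeJostSol (by linarith [h.lower]) hk hk0 hx).continuousAt.mul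
      (h.hasDerivAt_regSol _ hx).continuousAt).continuousWithinAt
  · rw [ae_restrict_iff' measurableSet_Ioi]
    refine Eventually.of_forall fun x hx => ?_
    rw [jostIntegrand, norm_mul, Complex.norm_real, Real.norm_eq_abs]
    calc _ ≤ |q x| * (C * x) := by
          gcongr
          exact (hb k x hk hk0 hx).1
      _ = _ := by ring

/-- The two limits of the Wronskian differ by the integral of its derivative. On the right, k enters
only through functions with explicit bounds. -/
lemma cpow_mul_jostFunction_eq (h : Admissible l q) {k : ℂ} (hk : 0 ≤ k.im) (hk0 : k ≠ 0) :
    k ^ (l : ℂ) * jostFunction l q k =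
      normConst l * ((2 * l + 1) * freeJost l 0) + ∫ x in Set.Ioi 0, jostIntegrand l q k x := by
  have hl : -1 < l := by linarith [h.lower]
  have hW := (isPrimitiveOn_wronskian (isPrimitiveOn_freeJostSol hl hk hk0)
    (isPrimitiveOn_freeJostSolDeriv hl hk hk0) (h.isPrimitiveOn_regSol (k ^ 2))
    (h.isPrimitiveOn_regSolDeriv (k ^ 2))).congr (g := jostIntegrand l q k) fun x _ => by
      rw [jostIntegrand, effPotential]
      push_cast
      ring
  rw [integral_Ioi_eq_sub_of_isPrimitiveOn hW (h.integrableOn_jostIntegrand hk hk0)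
    (h.tendsto_wronskian_zero hk hk0) (h.tendsto_wronskian_atTop hk hk0)]
  ring

/-- With s = |k|x, the factor s^m (1+s)^{-1-m} is at most 1/s and also at most s^m, since 1+m > 0.
-/
lemma exists_norm_jostIntegrandDeriv_le (h : Admissible l q) : ∃ C > 0, ∀ (k : ℂ) (x : ℝ),
    0 ≤ k.im → k ≠ 0 → 0 < x → ‖jostIntegrandDeriv l q k x‖ ≤ C / ‖k‖ * (x * |q x|) ∧
      ‖jostIntegrandDeriv l q k x‖ ≤
        C * ‖k‖ ^ min 0 (2 * l) * (x ^ (2 + min 0 (2 * l)) * |q x|) := by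
  obtain ⟨C, hC, hb⟩ := h.exists_norm_freeJostSol_mul_regSol_le
  refine ⟨C, hC, fun k x hk hk0 hx => ?_⟩
  have hk1 : 0 < ‖k‖ := norm_pos_iff.2 hk0
  have hb1 := (hb k x hk hk0 hx).2
  set m := min 0 (2 * l) with hm
  have hm1 : 0 < 1 + m := by
    have : -1 < m := lt_min (by norm_num) (by linarith [h.lower])
    linarith
  have hs : 0 < ‖k‖ * x := by positivity
  rw [jostIntegrandDeriv, norm_mul, Complex.norm_real, Real.norm_eq_abs]
  have h0 := mul_le_mul_of_nonneg_left hb1 (abs_nonneg (q x))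
  constructor
  · have h1 : (‖k‖ * x) ^ m * (1 + ‖k‖ * x) ^ (-1 - m) ≤ (‖k‖ * x)⁻¹ := by
      calc _ ≤ (‖k‖ * x) ^ m * (‖k‖ * x) ^ (-1 - m) := by
            refine mul_le_mul_of_nonneg_left ?_ (by positivity)
            exact Real.rpow_le_rpow_of_nonpos hs (by linarith) (by linarith)
        _ = _ := by
            rw [← Real.rpow_add hs, ← Real.rpow_neg_one]; ring_nf
    calc _ ≤ _ := h0
      _ ≤ |q x| * (C * x ^ 2 * (‖k‖ * x)⁻¹) := by gcongr
      _ = _ := by field_simp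
  · have h1 : (1 + ‖k‖ * x) ^ (-1 - m) ≤ 1 :=
      Real.rpow_le_one_of_one_le_of_nonpos (by linarith) (by linarith)
    calc _ ≤ _ := h0
      _ ≤ |q x| * (C * x ^ 2 * ((‖k‖ * x) ^ m * 1)) := by gcongr
      _ = _ := by
        rw [Real.mul_rpow hk1.le hx.le, Real.rpow_add hx, Real.rpow_two]
        ring

/-- On the half-disc of radius |k|/2 momenta have norm above |k|/2, so a constant multiple of x|q|
dominates the derivative of the integrand. -/
lemma hasDerivWithinAt_normJost (h : Admissible l q) {k : ℂ} (hk : 0 ≤ k.im) (hk0 : k ≠ 0) :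
    HasDerivWithinAt (normJost l q) (Complex.exp (-(Complex.I * Real.pi * l / 2)) *
      ∫ x in Set.Ioi 0, jostIntegrandDeriv l q k x) closedUpperHalfPlane k := by
  obtain ⟨C, hC, hb⟩ := h.exists_norm_jostIntegrandDeriv_le
  have hk1 : 0 < ‖k‖ := norm_pos_iff.2 hk0
  have hball : ∀ w ∈ closedUpperHalfPlane ∩ Metric.ball k (‖k‖ / 2), 0 ≤ w.im ∧ ‖k‖ / 2 < ‖w‖ := by
    intro w hw
    refine ⟨hw.1, ?_⟩
    have h1 := hw.2
    rw [mem_ball_iff_norm, norm_sub_rev] at h1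
    linarith [norm_sub_norm_le k w]
  have hne : ∀ w ∈ closedUpperHalfPlane ∩ Metric.ball k (‖k‖ / 2), w ≠ 0 := fun w hw =>
    norm_pos_iff.1 (by linarith [(hball w hw).2])
  have hint := hasDerivWithinAt_integral_of_dominated (μ := volume.restrict (Set.Ioi 0))
    convex_closedUpperHalfPlane (F := jostIntegrand l q) (F' := jostIntegrandDeriv l q) (k₀ := k) hk
    (half_pos hk1) (bound := fun x => C / (‖k‖ / 2) * (x * |q x|))
    (fun w hw => h.integrableOn_jostIntegrand (hball w hw).1 (hne w hw)) (h.int.const_mul _)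
    (by
      rw [ae_restrict_iff' measurableSet_Ioi]
      refine Eventually.of_forall fun x (hx : 0 < x) w hw => ?_
      refine (hb w x (hball w hw).1 (hne w hw) hx).1.trans ?_
      have := (hball w hw).2.le
      gcongr)
    (by
      rw [ae_restrict_iff' measurableSet_Ioi]
      exact Eventually.of_forall fun x hx w hw =>
        h.hasDerivWithinAt_jostIntegrand (hball w hw).1 (hne w hw) hx)
  refine ((hint.const_add (normConst l * ((2 * l + 1) * freeJost l 0))).const_mul
    (Complex.exp (-(Complex.I * Real.pi * l / 2)))).congr_of_eventuallyEq_of_mem ?_ hk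
  filter_upwards [self_mem_nhdsWithin,
    mem_nhdsWithin_of_mem_nhds (isOpen_ne.mem_nhds hk0)] with w hw hw0
  rw [normJost, mul_assoc, h.cpow_mul_jostFunction_eq hw hw0]

lemma norm_normJostDeriv (h : Admissible l q) {k : ℂ} (hk : 0 ≤ k.im) (hk0 : k ≠ 0) :
    ‖normJostDeriv l q k‖ = ‖∫ x in Set.Ioi 0, jostIntegrandDeriv l q k x‖ := by
  -- A convex set with interior determines derivatives at its boundary points too, so `derivWithin`
  -- is the computed value even for real k.
  have hu : UniqueDiffOn ℂ closedUpperHalfPlane := by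
    refine uniqueDiffOn_convex_of_isRCLikeNormedField convex_closedUpperHalfPlane
      ⟨Complex.I, mem_interior.2 ⟨{z | 0 < z.im}, fun z (hz : 0 < z.im) => hz.le,
        isOpen_lt continuous_const Complex.continuous_im, by simp⟩⟩
  rw [normJostDeriv, (h.hasDerivWithinAt_normJost hk hk0).derivWithin (hu k hk), norm_mul]
  have : ‖Complex.exp (-(Complex.I * Real.pi * l / 2))‖ = 1 := by
    rw [Complex.norm_exp]
    simp [Complex.mul_im]
  rw [this, one_mul]

end Admissible

end RadialSchrodinger

end

/-! ### The main theorem. -/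

theorem lemma2p10 (l : ℝ) (hl : -(1 / 2) < l) (q : ℝ → ℝ)
    (hq_loc : MeasureTheory.LocallyIntegrableOn q (Set.Ioi 0))
    (hq_zero : MeasureTheory.IntegrableOn (fun x : ℝ => x * |q x|) (Set.Ioc 0 1))
    (hq_inf : MeasureTheory.IntegrableOn (fun x : ℝ => x * |q x|) (Set.Ioi 1)) :
    (∀ k : ℂ, 0 ≤ k.im → k ≠ 0 →
      DifferentiableWithinAt ℂ (RadialSchrodinger.normJost l q)
        RadialSchrodinger.closedUpperHalfPlane k) ∧
    (∃ C R : ℝ, ∀ k : ℂ, 0 ≤ k.im → R ≤ ‖k‖ →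
      ‖RadialSchrodinger.normJostDeriv l q k‖ ≤ C / (1 + ‖k‖)) ∧
    (MeasureTheory.IntegrableOn (fun x : ℝ => x ^ 2 * |q x|) (Set.Ioi 1) →
      Asymptotics.IsBigO (nhdsWithin (0 : ℂ) {k : ℂ | 0 ≤ k.im ∧ k ≠ 0})
        (RadialSchrodinger.normJostDeriv l q)
        (fun k : ℂ => ‖k‖ ^ (min 0 (2 * l)))) := by
  have h : RadialSchrodinger.Admissible l q :=
    ⟨hl, hq_loc, by
      rw [← Set.Ioc_union_Ioi_eq_Ioi zero_le_one]
      exact hq_zero.union hq_inf⟩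
  obtain ⟨C, hC, hb⟩ := h.exists_norm_jostIntegrandDeriv_le
  refine ⟨fun k hk hk0 => (h.hasDerivWithinAt_normJost hk hk0).differentiableWithinAt, ?_, ?_⟩
  · have hI : 0 ≤ ∫ x in Set.Ioi 0, x * |q x| :=
      setIntegral_nonneg measurableSet_Ioi fun x (hx : 0 < x) => by positivity
    -- The factor 2 converts 1/|k| into 1/(1+|k|), since 1+|k| ≤ 2|k| for |k| ≥ 1.
    refine ⟨2 * C * ∫ x in Set.Ioi 0, x * |q x|, 1, fun k hk hk1 => ?_⟩
    have hk0 : k ≠ 0 := norm_pos_iff.1 (by linarith)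
    rw [h.norm_normJostDeriv hk hk0]
    calc _ ≤ ∫ x in Set.Ioi 0, C / ‖k‖ * (x * |q x|) := by
          refine norm_integral_le_of_norm_le (h.int.const_mul _) ?_
          rw [ae_restrict_iff' measurableSet_Ioi]
          exact Eventually.of_forall fun x hx => (hb k x hk hk0 hx).1
      _ = (C * ∫ x in Set.Ioi 0, x * |q x|) / ‖k‖ := by rw [integral_const_mul]; ring
      _ ≤ _ := by
          rw [div_le_div_iff₀ (by linarith) (by linarith)]
          have : 0 ≤ C * ∫ x in Set.Ioi 0, x * |q x| := by positivity
          nlinarith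
  · intro hq2
    set m := min 0 (2 * l) with hm
    have hm0 : m ≤ 0 := min_le_left _ _
    have hm1 : 0 < 1 + m := by
      have : -1 < m := lt_min (by norm_num) (by linarith)
      linarith
    have hmeas : AEStronglyMeasurable (fun x : ℝ => x ^ (2 + m) * |q x|)
        (volume.restrict (Set.Ioi 0)) := by
      refine AEStronglyMeasurable.mul ?_ h.meas.norm
      exact (Real.continuous_rpow_const (by linarith)).aestronglyMeasurable
    -- The exponent satisfies 1 ≤ 2+m ≤ 2, so the first moment controls (0,1] and the second moment
    -- (1,∞).
    have hint : IntegrableOn (fun x : ℝ => x ^ (2 + m) * |q x|) (Set.Ioi 0) := by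
      rw [← Set.Ioc_union_Ioi_eq_Ioi zero_le_one]
      refine IntegrableOn.union ?_ ?_
      · refine Integrable.mono' hq_zero
          (hmeas.mono_measure (Measure.restrict_mono (fun _ hy => hy.1) le_rfl)) ?_
        rw [ae_restrict_iff' measurableSet_Ioc]
        refine Eventually.of_forall fun x hx => ?_
        have hx0 := hx.1
        rw [Real.norm_of_nonneg (by positivity)]
        refine mul_le_mul_of_nonneg_right ?_ (abs_nonneg _)
        exact (Real.rpow_le_rpow_of_exponent_ge hx0 hx.2 (by linarith)).trans_eq (Real.rpow_one x)
      · refine Integrable.mono' hq2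
          (hmeas.mono_measure (Measure.restrict_mono (Set.Ioi_subset_Ioi zero_le_one) le_rfl)) ?_
        rw [ae_restrict_iff' measurableSet_Ioi]
        refine Eventually.of_forall fun x (hx : 1 < x) => ?_
        have hx0 : 0 < x := by linarith
        rw [Real.norm_of_nonneg (by positivity)]
        refine mul_le_mul_of_nonneg_right ?_ (abs_nonneg _)
        exact (Real.rpow_le_rpow_of_exponent_le hx.le (by linarith)).trans_eq (Real.rpow_two x)
    refine Asymptotics.IsBigO.of_bound (C * ∫ x in Set.Ioi 0, x ^ (2 + m) * |q x|) ?_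
    filter_upwards [self_mem_nhdsWithin] with k ⟨hk, hk0⟩
    rw [h.norm_normJostDeriv hk hk0, Real.norm_of_nonneg (by positivity)]
    calc _ ≤ ∫ x in Set.Ioi 0, C * ‖k‖ ^ m * (x ^ (2 + m) * |q x|) := by
          refine norm_integral_le_of_norm_le (hint.const_mul _) ?_
          rw [ae_restrict_iff' measurableSet_Ioi]
          exact Eventually.of_forall fun x hx => (hb k x hk hk0 hx).2
      _ = _ := by rw [integral_const_mul]; ring
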